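/- Let $\mathcal U=\{u_m : m\in\mathbb N\}$ be a countable supply of arguments (coded by natural numbers), and let $\bot$ ("contradiction"), $\mathsf{ce}$ ("counterexample") and $\ast$ (a placeholder) be further symbols. For a countably infinite set $\mathcal A=\{a_i : i\in\mathbb N\}\subseteq\mathcal U$ listed by a computable sequence without repetition, an approximated consequence operator on $\mathcal A$ is a computable function $H$ from $\mathbb N\times P_{\rm fin}(\mathcal A)$ to $P_{\rm fin}(\mathcal A\cup\{\bot,\mathsf{ce}\})$ such that $F\subseteq G$ implies $H(n,F)\subseteq H(n,G)$, such that $F\subseteq H(n,F)\subseteq H(n+1,F)$, and such that the operator $H^\infty(Y)=\bigcup\{H(n,F) : n\in\mathbb N,\ F\subseteq Y \text{ finite}\}$ $(Y\subseteq\mathcal A)$ is a Tarskian consequence operator: $F\subseteq G$ implies $H^\infty(F)\subseteq H^\infty(G)$; $F\subseteq H^\infty(F)$; and $H^\infty(H^\infty(F)\cap\mathcal A)=H^\infty(F)$, for all $F,G\subseteq\mathcal A$. A q-dialectical system is a triple $\Gamma=(\mathcal A,H,r)$ with $\mathcal A$ and $H$ as above and $r:\mathcal A\to\mathcal A$ computable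 and acyclic ($r^n(x)\ne x$ for all $n\ge 1$ and $x\in\mathcal A$). It is a p-dialectical system if $\bot\notin H^\infty(\mathcal A)$. The run of $\Gamma$ is the sequence of finite strings $\sigma_s$ over $\mathcal A\cup\{\ast\}$ defined as follows, where $\mathrm{ran}(\sigma)$ is the set of elements of $\mathcal A$ that occur in $\sigma$, $\sigma{\restriction}_k$ is the string of the first $k$ entries of $\sigma$, and entries are numbered from $0$. The string $\sigma_0$ is empty. If neither $\bot$ nor $\mathsf{ce}$ is in $H(s,\mathrm{ran}(\sigma_s))$, then $\sigma_{s+1}=\sigma_s{}^\smallfrown a_{|\sigma_s|}$. Otherwise let $k$ be least such that $\bot$ or $\mathsf{ce}$ is in $H(s,\mathrm{ran}(\sigma_s{\restriction}_k))$; then $\sigma_{s+1}=(\sigma_s{\restriction}_{k-1})^\smallfrown\ast$ if $\bot\in H(s,\mathrm{ran}(\sigma_s{\restriction}_k))$ (excision), and $\sigma_{s+1}=(\sigma_s{\restriction}_{k-1})^\smallfrown r(\sigma_s(k-1))$ if not (replacement). (In the degenerate case $k=0$, where $\bot$ or $\mathsf{ce}$ is derived from the empty set, $\sigma_{s+1}$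 is the empty string.) Write $\lim_s\sigma_s(n)=x$ for $x\in\mathcal A\cup\{\ast\}$ if $\sigma_s(n)$ is defined and equal to $x$ for all sufficiently large $s$. The system $\Gamma$ is loopless if for every $n$ there is such an $x$, and its limiting belief set is $B_\Gamma=\{a\in\mathcal A : a=\lim_s\sigma_s(n)\text{ for some } n\}$. **Theorem.** There is a loopless q-dialectical system $\Gamma$ such that $B_\Gamma\ne B_\Lambda$ for every p-dialectical system $\Lambda$ (loopless or not). -/

import Mathlib

namespace Dialectical

/-- The elements of `A ∪ {⊥, ce}`. A set of arguments `A = {a_i : i ∈ ℕ}`, listed without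
repetition, is handled through its indices: `Sum.inl i` stands for the argument `a_i`; the two
logical symbols are `Sum.inr true` (contradiction) and `Sum.inr false` (counterexample). -/
abbrev Formula : Type := ℕ ⊕ Bool

/-- The formula given by the `i`-th argument. -/
abbrev Formula.arg (i : ℕ) : Formula := Sum.inl i

/-- The symbol `⊥` for a contradiction. -/
abbrev Formula.bot : Formula := Sum.inr true

/-- The symbol `ce` for a counterexample. -/
abbrev Formula.ce : Formula := Sum.inr false

/-- Tarskian consequence operators `P(A) → P(A ∪ {⊥, ce})`. -/
structure IsTarskian (C : Set ℕ → Set Formula) : Prop where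
  monotony : ∀ F G : Set ℕ, F ⊆ G → C F ⊆ C G
  inclusion : ∀ F : Set ℕ, ∀ i ∈ F, Formula.arg i ∈ C F
  iteration : ∀ F : Set ℕ, C {i | Formula.arg i ∈ C F} = C F

/-- The operator `H^∞(Y) = ⋃ {H(n, F) : n ∈ ℕ, F ⊆ Y finite}`. -/
def limitOp (H : ℕ → Finset ℕ → Finset Formula) (Y : Set ℕ) : Set Formula :=
  {x | ∃ (n : ℕ) (F : Finset ℕ), (F : Set ℕ) ⊆ Y ∧ x ∈ H n F}

/-- Computability of `H : ℕ × P_fin(A) → P_fin(A ∪ {⊥, ce})`: finite sets are presented to, and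
returned by, an algorithm as finite lists of their elements (in any order, repetitions allowed). -/
def IsComputableOp (H : ℕ → Finset ℕ → Finset Formula) : Prop :=
  ∃ h : ℕ → List ℕ → List Formula, Computable₂ h ∧
    ∀ (n : ℕ) (l : List ℕ), (h n l).toFinset = H n l.toFinset

/-- Approximated consequence operators on `A`. -/
structure IsApproxOp (H : ℕ → Finset ℕ → Finset Formula) : Prop where
  computable : IsComputableOp H
  mono : ∀ (n : ℕ) (F G : Finset ℕ), F ⊆ G → H n F ⊆ H n G
  subset : ∀ (n : ℕ) (F : Finset ℕ), ∀ i ∈ F, Formula.arg i ∈ H n F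
  step : ∀ (n : ℕ) (F : Finset ℕ), H n F ⊆ H (n + 1) F
  tarskian : IsTarskian (limitOp H)

/-- A q-dialectical system `(A, H, r)`. The arguments of all systems are taken from one common
supply, coded by natural numbers: `a i` is (the code of) the `i`-th argument of this system.
`H` and `r` act on arguments through their indices: `r` sends `a i` to `a (r i)`. -/
structure QSystem where
  a : ℕ → ℕ
  a_computable : Computable a
  a_injective : Function.Injective a
  H : ℕ → Finset ℕ → Finset Formula
  H_approx : IsApproxOp H
  r : ℕ → ℕ
  r_computable : Computable r
  r_acyclic : ∀ n : ℕ, 1 ≤ n → ∀ i : ℕ, r^[n] i ≠ i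

/-- The set of (indices of) arguments that occur in a string over `A ∪ {∗}`; `none` is the
placeholder `∗`. -/
def ran (σ : List (Option ℕ)) : Finset ℕ := σ.reduceOption.toFinset

namespace QSystem

/-- `⊥` or `ce` is in `H(s, F)`. -/
def Conflict (Γ : QSystem) (s : ℕ) (F : Finset ℕ) : Prop :=
  Formula.bot ∈ Γ.H s F ∨ Formula.ce ∈ Γ.H s F

instance (Γ : QSystem) (s : ℕ) (F : Finset ℕ) : Decidable (Γ.Conflict s F) :=
  inferInstanceAs (Decidable (_ ∨ _))

theorem exists_conflict_take {Γ : QSystem} {s : ℕ} {σ : List (Option ℕ)}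
    (h : Γ.Conflict s (ran σ)) : ∃ k, Γ.Conflict s (ran (σ.take k)) :=
  ⟨σ.length, by rwa [List.take_length]⟩

/-- One stage of a run: the string of stage `s + 1` computed from the string `σ` of stage `s`.
In the case of a conflict, `Nat.find` is the least `k` such that the first `k` entries of `σ` give
a conflict. The value `k = 0` means that the empty set of arguments is already in conflict, so that
there is nothing to revise; the string is then empty (from this stage on). -/
def next (Γ : QSystem) (s : ℕ) (σ : List (Option ℕ)) : List (Option ℕ) :=
  if h : Γ.Conflict s (ran σ) then
    match Nat.find (exists_conflict_take h) with
    | 0 => []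
    | k + 1 =>
      if Formula.bot ∈ Γ.H s (ran (σ.take (k + 1))) then
        σ.take k ++ [none]
      else
        σ.take k ++ [(σ.getD k none).map Γ.r]
  else
    σ ++ [some σ.length]

/-- The run of `Γ`: the string `σ_s` of stage `s`. -/
def run (Γ : QSystem) : ℕ → List (Option ℕ)
  | 0 => []
  | s + 1 => Γ.next s (run Γ s)

/-- `lim_s σ_s(n) = x`: at all sufficiently large stages the string has an entry in position `n`,
and this entry is `x` (an argument or the placeholder). -/
def HasLimit (Γ : QSystem) (n : ℕ) (x : Option ℕ) : Prop :=
  ∃ t : ℕ, ∀ s : ℕ, t ≤ s → (Γ.run s)[n]? = some x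

/-- `Γ` is loopless: the entry in each position is eventually constant. -/
def Loopless (Γ : QSystem) : Prop :=
  ∀ n : ℕ, ∃ x : Option ℕ, Γ.HasLimit n x

/-- The limiting belief set `B_Γ`: all arguments that are the limit of some position. -/
def beliefs (Γ : QSystem) : Set ℕ :=
  {b | ∃ n i : ℕ, Γ.HasLimit n (some i) ∧ Γ.a i = b}

/-- p-dialectical systems: contradictions are never produced, `⊥ ∉ H^∞(A)`. -/
def IsP (Γ : QSystem) : Prop :=
  Formula.bot ∉ limitOp Γ.H Set.univ

end QSystem

end Dialectical

/-!
A p-dialectical system `Δ` never sees `⊥`. If its belief set `B` is infinite, then `Δ` is loopless,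
`B` is consistent, and the limit string is determined by `B`: position `j` holds the first member of
`B` on the chain `j, r j, r (r j), …`, and each earlier entry of the chain is refuted by beliefs
held in positions before `j` (`QSystem.exists_isLimitString`). So, if `B` is changed, what `Δ` puts in
the place of a lost argument is fixed in advance by `r`. A q-dialectical system may instead excise
the lost argument, and which of the two it does can depend on the time at which it looks.

The system `blockSystem` makes use of this. Its arguments come in blocks of three, conflicts arise
inside blocks only, and it diagonalizes against `Δ` with an argument `e` and a later block
`{x, q, p}`, `p = r x`, in which `q` and `p` exclude each other once `Δ` has shown which of them comes
first in its limit string for a set that contains `x`, `q` and `p`.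

* If `p` comes first, then `p` is rejected in favour of `q`. Now `Δ` has to refute `p` with beliefs
  other than `q`. When such a refutation is found, `p` is accepted instead of `q`, and the
  refutation consists of beliefs.
* If `q` comes first, then `x` is made to derive `ce` and is replaced by `p`, which excludes `q`. Now
  `Δ` has to refute `q`. If this is possible with beliefs other than `p`, then again the roles of
  `p` and `q` are exchanged, and the refutation consists of beliefs. Otherwise `Δ` holds `p` in a
  position before that of `q`, and it has come to `p` there by way of `x`, without meeting `q` in
  between (`PassesTo`). In this case `e` is rejected and `x` is made to derive `⊥` as well. The run
  of `blockSystem` is cut at `e`, and when it comes back to `x` it excises `x`, so that `q` is accepted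
  and excludes `p`. But `Δ` still goes on from `x` to `p` and has to refute `p` with beliefs held in
  earlier positions. None of these is `q`, and after a last exchange of `p` and `q` the refutation
  consists of beliefs.

The rejection of `e` can also change what `Δ` holds in earlier positions. It must not bring in
`q` there, and therefore `e` has been rejected once before the block `{x, q, p}` was chosen: then the
chain of `e` went on to some accepted argument (`Meets`). In the block `{e₀, e₀', e}` the conflict that
removed `e` is resolved by giving up `e₀` or `e₀'` instead, whichever is not that argument, and the
block `{x, q, p}` is chosen among larger numbers.

In each of these situations `Δ` owes a fact that can be found by a computable search
(`QSystem.Test`), and some code carries out all searches about `Δ` (`exists_code_test`). The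
construction serves all codes by a finite injury priority argument (`exists_final_record`). The
requirement of a code for `Δ` gets stuck in one of the situations, and this contradicts the
assumption that `Δ` has the same beliefs (`IsStuck.not_isLimitString`). On the other side,
`mem_beliefs_blockSystem` shows that the limit beliefs of `blockSystem` are those that the final
statuses of the blocks prescribe.
-/

namespace Dialectical

/-! ### Runs of q-dialectical systems -/

theorem mem_ran {σ : List (Option ℕ)} {i : ℕ} : i ∈ ran σ ↔ some i ∈ σ := by
  simp [ran, List.reduceOption_mem_iff]

theorem mem_ran_take {σ : List (Option ℕ)} {i k : ℕ} :
    i ∈ ran (σ.take k) ↔ ∃ j < k, σ[j]? = some (some i) := by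
  rw [mem_ran, List.mem_iff_getElem?]
  constructor
  · rintro ⟨j, hj⟩
    rw [List.getElem?_take] at hj
    split_ifs at hj with h
    exact ⟨j, h, hj⟩
  · rintro ⟨j, h, hj⟩
    exact ⟨j, by rw [List.getElem?_take, if_pos h, hj]⟩

theorem ran_take_succ_of_some {σ : List (Option ℕ)} {k y : ℕ} (h : σ[k]? = some (some y)) :
    ran (σ.take (k + 1)) = insert y (ran (σ.take k)) := by
  ext i
  rw [Finset.mem_insert, mem_ran_take, mem_ran_take]
  constructor
  · rintro ⟨j, hj, e⟩
    rcases Nat.lt_succ_iff_lt_or_eq.1 hj with hj | rfl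
    · exact Or.inr ⟨j, hj, e⟩
    · rw [h] at e; left; simpa using e.symm
  · rintro (rfl | ⟨j, hj, e⟩)
    · exact ⟨k, Nat.lt_succ_self k, h⟩
    · exact ⟨j, hj.trans (Nat.lt_succ_self k), e⟩

theorem ran_take_succ_of_none {σ : List (Option ℕ)} {k : ℕ} (h : σ[k]? = some none) :
    ran (σ.take (k + 1)) = ran (σ.take k) := by
  ext i
  rw [mem_ran_take, mem_ran_take]
  constructor
  · rintro ⟨j, hj, e⟩
    rcases Nat.lt_succ_iff_lt_or_eq.1 hj with hj | rfl
    · exact ⟨j, hj, e⟩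
    · rw [h] at e; simp at e
  · rintro ⟨j, hj, e⟩
    exact ⟨j, hj.trans (Nat.lt_succ_self k), e⟩

namespace QSystem

variable {Γ : QSystem}

theorem H_mono {s t : ℕ} (hst : s ≤ t) {F G : Finset ℕ} (hFG : F ⊆ G) :
    Γ.H s F ⊆ Γ.H t G := by
  induction t, hst using Nat.le_induction with
  | base => exact Γ.H_approx.mono s F G hFG
  | succ t _ ih => exact ih.trans (Γ.H_approx.step t G)

theorem Conflict.mono {s t : ℕ} (hst : s ≤ t) {F G : Finset ℕ} (hFG : F ⊆ G)
    (h : Γ.Conflict s F) : Γ.Conflict t G :=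
  h.imp (fun h => H_mono hst hFG h) (fun h => H_mono hst hFG h)

theorem r_ne (Γ : QSystem) (i : ℕ) : Γ.r i ≠ i := Γ.r_acyclic 1 le_rfl i

/-- The three ways in which a stage can act on a string: append the next argument, erase everything
because the empty set is in conflict, or revise the first entry `y` that produces a conflict. -/
theorem next_cases (Γ : QSystem) (s : ℕ) (σ : List (Option ℕ)) :
    (¬ Γ.Conflict s (ran σ) ∧ Γ.next s σ = σ ++ [some σ.length]) ∨
    (Γ.Conflict s ∅ ∧ Γ.next s σ = []) ∨
    ∃ i y, σ[i]? = some (some y) ∧ ¬ Γ.Conflict s (ran (σ.take i)) ∧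
      ((Formula.bot ∈ Γ.H s (insert y (ran (σ.take i))) ∧ Γ.next s σ = σ.take i ++ [none]) ∨
       (Formula.bot ∉ Γ.H s (insert y (ran (σ.take i))) ∧
        Formula.ce ∈ Γ.H s (insert y (ran (σ.take i))) ∧
          Γ.next s σ = σ.take i ++ [some (Γ.r y)])) := by
  by_cases h : Γ.Conflict s (ran σ)
  · right
    have hspec := Nat.find_spec (exists_conflict_take h)
    have hmin : ∀ m, m < Nat.find (exists_conflict_take h) → ¬ Γ.Conflict s (ran (σ.take m)) :=
      fun m hm => Nat.find_min (exists_conflict_take h) hm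
    have hnext : (Nat.find (exists_conflict_take h) = 0 → Γ.next s σ = []) ∧
        ∀ k, Nat.find (exists_conflict_take h) = k + 1 → Γ.next s σ =
          if Formula.bot ∈ Γ.H s (ran (σ.take (k + 1))) then σ.take k ++ [none]
          else σ.take k ++ [(σ.getD k none).map Γ.r] := by
      unfold next
      rw [dif_pos h]
      exact ⟨fun e => by simp [e], fun k e => by simp [e]⟩
    generalize Nat.find (exists_conflict_take h) = k at hspec hmin hnext
    cases k with
    | zero => exact Or.inl ⟨hspec, hnext.1 rfl⟩
    | succ k =>
      right
      replace hnext := hnext.2 k rfl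
      have hk := hmin k (Nat.lt_succ_self k)
      rcases hx : σ[k]? with _ | _ | y
      · have : σ.length ≤ k := by simpa using hx
        rw [List.take_of_length_le (by omega)] at hspec hk
        exact absurd hspec hk
      · rw [ran_take_succ_of_none hx] at hspec
        exact absurd hspec hk
      · refine ⟨k, y, hx, hk, ?_⟩
        rw [ran_take_succ_of_some hx] at hspec hnext
        by_cases hb : Formula.bot ∈ Γ.H s (insert y (ran (σ.take k)))
        · exact Or.inl ⟨hb, by simpa [hb] using hnext⟩
        · refine Or.inr ⟨hb, hspec.resolve_left hb, ?_⟩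
          simpa [hb, List.getD_eq_getElem?_getD, hx] using hnext
  · left
    refine ⟨h, ?_⟩
    unfold next
    rw [dif_neg h]

theorem run_succ (Γ : QSystem) (s : ℕ) : Γ.run (s + 1) = Γ.next s (Γ.run s) := rfl

theorem length_run_le (Γ : QSystem) (s : ℕ) : (Γ.run s).length ≤ s := by
  induction s with
  | zero => simp [run]
  | succ s ih =>
    rw [run_succ]
    rcases Γ.next_cases s (Γ.run s) with ⟨_, h⟩ | ⟨_, h⟩ | ⟨i, y, hi, _, ⟨_, h⟩ | ⟨_, _, h⟩⟩ <;>
      rw [h] <;> simp <;> omega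

/-- Every entry of the string is justified by its predecessors: in position `j` the arguments
`j, r j, …` were refuted by counterexamples one after the other, and the entry is the argument
reached in this way or, if that one led to a contradiction, the placeholder. -/
def Certified (Γ : QSystem) (s : ℕ) (σ : List (Option ℕ)) : Prop :=
  ∀ j x, σ[j]? = some x → ∃ m,
    (∀ i < m, Formula.ce ∈ Γ.H s (insert (Γ.r^[i] j) (ran (σ.take j)))) ∧
    (x = some (Γ.r^[m] j) ∨
      x = none ∧ Formula.bot ∈ Γ.H s (insert (Γ.r^[m] j) (ran (σ.take j))))

theorem Certified.snoc {s : ℕ} {σ : List (Option ℕ)} (h : Γ.Certified s σ) {k : ℕ}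
    (hk : k ≤ σ.length) {x : Option ℕ} {m : ℕ}
    (hm : ∀ i < m, Formula.ce ∈ Γ.H (s + 1) (insert (Γ.r^[i] k) (ran (σ.take k))))
    (hx : x = some (Γ.r^[m] k) ∨
      x = none ∧ Formula.bot ∈ Γ.H (s + 1) (insert (Γ.r^[m] k) (ran (σ.take k)))) :
    Γ.Certified (s + 1) (σ.take k ++ [x]) := by
  intro j z hj
  have hlen : (σ.take k).length = k := by simpa using hk
  rcases lt_trichotomy j k with hjk | rfl | hjk
  · rw [List.getElem?_append_left (by omega), List.getElem?_take, if_pos hjk] at hj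
    obtain ⟨m, h1, h2⟩ := h j z hj
    have ht : (σ.take k ++ [x]).take j = σ.take j := by
      rw [List.take_append_of_le_length (by omega), List.take_take, min_eq_left hjk.le]
    rw [ht]
    exact ⟨m, fun i hi => Γ.H_approx.step _ _ (h1 i hi),
      h2.imp_right (And.imp_right fun h => Γ.H_approx.step _ _ h)⟩
  · rw [List.getElem?_append_right (by omega), hlen] at hj
    have hz : x = z := by simpa using hj
    subst hz
    have ht : (σ.take j ++ [x]).take j = σ.take j := by
      rw [List.take_append_of_le_length (by omega), List.take_take, min_self]
    rw [ht]
    exact ⟨m, hm, hx⟩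
  · rw [List.getElem?_eq_none (by simp; omega)] at hj
    simp at hj

theorem certified_run (Γ : QSystem) (s : ℕ) : Γ.Certified s (Γ.run s) := by
  induction s with
  | zero => intro j x hj; simp [run] at hj
  | succ s ih =>
    rw [run_succ]
    rcases Γ.next_cases s (Γ.run s) with
      ⟨_, h⟩ | ⟨_, h⟩ | ⟨k, y, hk, _, ⟨hb, h⟩ | ⟨_, hc, h⟩⟩ <;> rw [h]
    · have := ih.snoc le_rfl (x := some (Γ.run s).length) (m := 0) (by simp) (by simp)
      rwa [List.take_length] at this
    · intro j x hj; simp at hj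
    · have hkl : k < (Γ.run s).length := (List.getElem?_eq_some_iff.1 hk).1
      obtain ⟨m, h1, h2⟩ := ih k _ hk
      have hy : y = Γ.r^[m] k := by simpa using h2
      subst hy
      exact ih.snoc hkl.le (fun i hi => Γ.H_approx.step _ _ (h1 i hi))
        (Or.inr ⟨rfl, Γ.H_approx.step _ _ hb⟩)
    · have hkl : k < (Γ.run s).length := (List.getElem?_eq_some_iff.1 hk).1
      obtain ⟨m, h1, h2⟩ := ih k _ hk
      have hy : y = Γ.r^[m] k := by simpa using h2
      subst hy
      refine ih.snoc hkl.le (m := m + 1) (fun i hi => ?_)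
        (Or.inl (by rw [Function.iterate_succ_apply']))
      rcases Nat.lt_succ_iff_lt_or_eq.1 hi with hi | rfl
      · exact Γ.H_approx.step _ _ (h1 i hi)
      · exact Γ.H_approx.step _ _ hc

theorem HasLimit.unique {n : ℕ} {x y : Option ℕ} (hx : Γ.HasLimit n x) (hy : Γ.HasLimit n y) :
    x = y := by
  obtain ⟨t, ht⟩ := hx
  obtain ⟨u, hu⟩ := hy
  have h1 := ht (max t u) (le_max_left _ _)
  rw [hu _ (le_max_right _ _)] at h1
  simpa using h1.symm

/-- The set of arguments among the limits of the first `k` positions. -/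
def limRan (X : ℕ → Option ℕ) (k : ℕ) : Finset ℕ := ran ((List.range k).map X)

theorem mem_limRan {X : ℕ → Option ℕ} {k i : ℕ} : i ∈ limRan X k ↔ ∃ j < k, X j = some i := by
  simp [limRan, mem_ran]

theorem ran_take_run_eq {X : ℕ → Option ℕ} {s k : ℕ}
    (h : ∀ j < k, (Γ.run s)[j]? = some (X j)) : ran ((Γ.run s).take k) = limRan X k := by
  ext i
  rw [mem_ran_take, mem_limRan]
  refine exists_congr fun j => and_congr_right fun hj => ?_
  rw [h j hj]; simp

theorem exists_stable_prefix {X : ℕ → Option ℕ} {k : ℕ} (h : ∀ j < k, Γ.HasLimit j (X j)) :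
    ∃ t, ∀ s, t ≤ s → ∀ j < k, (Γ.run s)[j]? = some (X j) := by
  induction k with
  | zero => exact ⟨0, by simp⟩
  | succ k ih =>
    obtain ⟨t, ht⟩ := ih fun j hj => h j (by omega)
    obtain ⟨u, hu⟩ := h k (by omega)
    refine ⟨max t u, fun s hs j hj => ?_⟩
    rcases Nat.lt_succ_iff_lt_or_eq.1 hj with hj | rfl
    · exact ht s (le_trans (le_max_left _ _) hs) j hj
    · exact hu s (le_trans (le_max_right _ _) hs)

/-- A stage that leaves the first `k` entries unchanged finds no conflict among them. -/
theorem not_conflict_of_stable {X : ℕ → Option ℕ} {k s : ℕ}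
    (h : ∀ j < k, (Γ.run s)[j]? = some (X j)) (h' : ∀ j < k, (Γ.run (s + 1))[j]? = some (X j))
    (hk : 0 < k ∨ Γ.run (s + 1) ≠ []) :
    ¬ Γ.Conflict s (limRan X k) := by
  intro hc
  have hc' : Γ.Conflict s (ran ((Γ.run s).take k)) := by rwa [ran_take_run_eq h]
  rw [run_succ] at h' hk
  rcases Γ.next_cases s (Γ.run s) with ⟨hn, e⟩ | ⟨hn, e⟩ | ⟨i, y, hi, hn, e⟩
  · refine hn (hc'.mono le_rfl fun a ha => ?_)
    rw [mem_ran_take] at ha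
    obtain ⟨j, _, hj⟩ := ha
    exact mem_ran.2 (List.mem_of_getElem? hj)
  · rcases hk with hk | hk
    · have := h' 0 hk
      rw [e] at this; simp at this
    · exact hk e
  · have hik : i < k := by
      by_contra hki
      refine hn (hc'.mono le_rfl fun a ha => ?_)
      rw [mem_ran_take] at ha ⊢
      obtain ⟨j, hj, e⟩ := ha
      exact ⟨j, by omega, e⟩
    have hil : i < (Γ.run s).length := (List.getElem?_eq_some_iff.1 hi).1
    have hX : X i = some y := by
      have := h i hik; rw [hi] at this; simpa using this.symm
    have hl : ((Γ.run s).take i).length = i := by simpa using hil.le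
    have h1 := h' i hik
    rw [hX] at h1
    rcases e with ⟨_, e⟩ | ⟨_, _, e⟩ <;>
      rw [e, List.getElem?_append_right (by omega), hl] at h1 <;> simp at h1
    exact Γ.r_ne y h1

/-- What a stage can do when it keeps the first `k` entries: the entry in position `k` is then
defined, and it is either new, or kept, or revised. -/
theorem getElem?_succ_of_stable {X : ℕ → Option ℕ} {k s : ℕ}
    (h : ∀ j < k, (Γ.run s)[j]? = some (X j)) (h' : ∀ j < k, (Γ.run (s + 1))[j]? = some (X j))
    (hk : 0 < k ∨ Γ.run (s + 1) ≠ []) :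
    ((Γ.run s)[k]? = none ∧ (Γ.run (s + 1))[k]? = some (some k)) ∨
    (∃ x, (Γ.run s)[k]? = some x ∧ (Γ.run (s + 1))[k]? = some x) ∨
    (∃ y, (Γ.run s)[k]? = some (some y) ∧
      ((Formula.bot ∈ Γ.H s (insert y (limRan X k)) ∧
        (Γ.run (s + 1)) = (Γ.run s).take k ++ [none]) ∨
       (Formula.bot ∉ Γ.H s (insert y (limRan X k)) ∧
        Formula.ce ∈ Γ.H s (insert y (limRan X k)) ∧
          (Γ.run (s + 1)) = (Γ.run s).take k ++ [some (Γ.r y)]))) := by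
  have hnc := not_conflict_of_stable h h' hk
  rw [← ran_take_run_eq h] at hnc ⊢
  have hkl : k ≤ (Γ.run s).length := by
    rcases Nat.eq_zero_or_pos k with rfl | hpos
    · exact Nat.zero_le _
    · have := h (k - 1) (by omega)
      have := (List.getElem?_eq_some_iff.1 this).1
      omega
  rw [run_succ] at h' hk ⊢
  rcases Γ.next_cases s (Γ.run s) with ⟨hn, e⟩ | ⟨hn, e⟩ | ⟨i, y, hi, hn, e⟩
  · rcases hkl.eq_or_lt with rfl | hlt
    · left; rw [e]; simp
    · right; left
      refine ⟨(Γ.run s)[k], by simp [hlt], ?_⟩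
      rw [e, List.getElem?_append_left hlt]; simp
  · exfalso
    rcases hk with hk | hk
    · have := h' 0 hk
      rw [e] at this; simp at this
    · exact hk e
  · have hil : i < (Γ.run s).length := (List.getElem?_eq_some_iff.1 hi).1
    have hl : ((Γ.run s).take i).length = i := by simpa using hil.le
    rcases lt_trichotomy i k with hik | rfl | hik
    · exfalso
      have hX : X i = some y := by
        have := h i hik; rw [hi] at this; simpa using this.symm
      have h1 := h' i hik
      rw [hX] at h1
      rcases e with ⟨_, e⟩ | ⟨_, _, e⟩ <;>
        rw [e, List.getElem?_append_right (by omega), hl] at h1 <;> simp at h1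
      exact Γ.r_ne y h1
    · exact Or.inr (Or.inr ⟨y, hi, e⟩)
    · right; left
      refine ⟨(Γ.run s)[k], by simp [hik.trans hil], ?_⟩
      rcases e with ⟨_, e⟩ | ⟨_, _, e⟩ <;>
        rw [e, List.getElem?_append_left (by omega), List.getElem?_take, if_pos hik] <;>
        simp [hik.trans hil]

/-- The set of all limits of a loopless run is free of conflicts. -/
theorem not_conflict_of_limits {X : ℕ → Option ℕ} (hX : ∀ j, Γ.HasLimit j (X j)) (s : ℕ)
    {F : Finset ℕ} (hF : ∀ i ∈ F, ∃ j, X j = some i) : ¬ Γ.Conflict s F := by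
  obtain ⟨k, hk⟩ : ∃ k, F ⊆ limRan X k := by
    choose! f hf using hF
    refine ⟨F.sup f + 1, fun i hi => mem_limRan.2 ⟨f i, ?_, hf i hi⟩⟩
    exact Nat.lt_succ_of_le (Finset.le_sup hi)
  obtain ⟨t, ht⟩ := exists_stable_prefix (k := k + 1) fun j _ => hX j
  intro hc
  refine not_conflict_of_stable (k := k + 1) (ht (max s t) (le_max_right _ _))
    (ht (max s t + 1) (by omega)) (Or.inl (by omega)) (hc.mono (le_max_left _ _) ?_)
  intro i hi
  obtain ⟨j, hj, e⟩ := mem_limRan.1 (hk hi)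
  exact mem_limRan.2 ⟨j, by omega, e⟩

/-- The limit string of a loopless run is certified. -/
theorem certified_limits {X : ℕ → Option ℕ} (hX : ∀ j, Γ.HasLimit j (X j)) (j : ℕ) :
    ∃ m s, (∀ i < m, Formula.ce ∈ Γ.H s (insert (Γ.r^[i] j) (limRan X j))) ∧
    (X j = some (Γ.r^[m] j) ∨
      X j = none ∧ Formula.bot ∈ Γ.H s (insert (Γ.r^[m] j) (limRan X j))) := by
  obtain ⟨t, ht⟩ := exists_stable_prefix (k := j + 1) fun j _ => hX j
  have h := ht t le_rfl
  obtain ⟨m, h1, h2⟩ := Γ.certified_run t j (X j) (h j (by omega))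
  rw [ran_take_run_eq fun i hi => h i (by omega)] at h1 h2
  exact ⟨m, t, h1, h2⟩

/-- If some position has no limit, then only finitely many positions have one. -/
theorem finite_beliefs_of_not_loopless (h : ¬ Γ.Loopless) : Γ.beliefs.Finite := by
  classical
  unfold Loopless at h
  push Not at h
  have hm : ∀ j < Nat.find h, ∃ x, Γ.HasLimit j x := fun j hj => by
    simpa using Nat.find_min h hj
  have hk := Nat.find_spec h
  generalize Nat.find h = k at hm hk
  choose! X hX using hm
  obtain ⟨t, ht⟩ := exists_stable_prefix hX
  refine ((Finset.finite_toSet (limRan X k)).image Γ.a).subset ?_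
  rintro b ⟨n, i, ⟨u, hu⟩, rfl⟩
  refine ⟨i, ?_, rfl⟩
  by_cases hnk : n < k
  · exact Finset.mem_coe.2 (mem_limRan.2 ⟨n, hnk, (hX n hnk).unique ⟨u, hu⟩⟩)
  · exfalso
    -- position `k ≤ n` is defined and is not revised any more
    have hdef : ∀ s, u ≤ s → n < (Γ.run s).length := fun s hs =>
      (List.getElem?_eq_some_iff.1 (hu s hs)).1
    have hne : ∀ s, u ≤ s → Γ.run s ≠ [] := fun s hs e => by
      have := hdef s hs; rw [e] at this; simp at this
    have hnk : n ≠ k := fun e => hk (some i) ⟨u, by rwa [e] at hu⟩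
    set w := max t u
    have hw : k < (Γ.run w).length := by have := hdef w (le_max_right _ _); omega
    refine hk (Γ.run w)[k] ⟨w, fun s hs => ?_⟩
    induction s, hs using Nat.le_induction with
    | base => simp [hw]
    | succ s hs ih =>
      have hts : t ≤ s := (le_max_left _ _).trans hs
      have hus : u ≤ s := (le_max_right _ _).trans hs
      rcases getElem?_succ_of_stable (ht s hts) (ht (s + 1) (by omega))
        (Or.inr (hne (s + 1) (by omega))) with ⟨e, _⟩ | ⟨x, e, e'⟩ | ⟨y, _, e⟩
      · rw [ih] at e; simp at e
      · rw [ih] at e; rw [e', ← e]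
      · have hl := hdef (s + 1) (by omega)
        rcases e with ⟨_, e⟩ | ⟨_, _, e⟩ <;> rw [e] at hl <;> simp at hl <;> omega

end QSystem

/-! ### Blocks of arguments and their statuses -/

/-- The status of a block `{3k, 3k+1, 3k+2}` of three arguments. It fixes which subsets of the
block are in conflict; there are none as long as the block is `fresh`.

The statuses `guard`, `freed`, `spent` belong to the first block `{e₀, e₀', e}` of a requirement,
whose last argument is to be removed, restored and removed again: `guard` lets the three arguments
together derive `⊥`, `freed b` in addition `e₀'` or `e₀` alone (according to `b`), and `spent b` in
addition `e` alone.

The statuses from `rival` on belong to the second block `{x, q, p}`. Under `rival`, `replaced` and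
`excised`, `q` and `p` together derive `⊥`; under `rivalLost` and `excisedBack` already `q` alone
does, and under `replacedBack` already `p`. From `replaced` on `x` derives `ce`, and under
`excised` and `excisedBack` it derives `⊥` as well. -/
inductive Status
  | fresh
  | guard
  | freed (b : Bool)
  | spent (b : Bool)
  | rival
  | rivalLost
  | replaced
  | replacedBack
  | excised
  | excisedBack
  deriving DecidableEq, Fintype

namespace Status

/-- Whether those arguments of the block that are marked by the three truth values derive `⊥`. -/
def bot : Status → Bool → Bool → Bool → Bool
  | fresh, _, _, _ => false
  | guard, u, v, w => u && v && w
  | freed b, u, v, w => (u && v && w) || (if b then v else u)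
  | spent b, u, v, w => (u && v && w) || (if b then v else u) || w
  | rival, _, v, w => v && w
  | rivalLost, _, v, _ => v
  | replaced, _, v, w => v && w
  | replacedBack, _, _, w => w
  | excised, u, v, w => u || (v && w)
  | excisedBack, u, v, _ => u || v

/-- Whether the first argument of the block derives `ce`. -/
def ce : Status → Bool
  | replaced | replacedBack | excised | excisedBack => true
  | _ => false

/-- Which arguments of the block are accepted in the long run under the given status. -/
def accepted : Status → Bool × Bool × Bool
  | fresh => (true, true, true)
  | guard => (true, true, false)
  | freed b => (b, !b, true)
  | spent b => (b, !b, false)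
  | rival => (true, true, false)
  | rivalLost => (true, false, true)
  | replaced => (false, false, true)
  | replacedBack => (false, true, false)
  | excised => (false, true, false)
  | excisedBack => (false, false, true)

/-- Whether the argument in place `i` of the block is accepted. -/
def mem (e : Status) (i : ℕ) : Bool :=
  if i = 0 then e.accepted.1 else if i = 1 then e.accepted.2.1 else e.accepted.2.2

/-- The number of status changes a block has gone through. -/
def rank : Status → ℕ
  | fresh => 0
  | guard => 1
  | freed _ => 2
  | spent _ => 3
  | rival => 1
  | rivalLost => 2
  | replaced => 1
  | replacedBack => 2
  | excised => 2
  | excisedBack => 3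

/-- The next statuses of the two blocks of a requirement when it receives the answer `b`. The third
component tells whether a new second block is to be appointed. -/
def trans : Status → Status → Bool → Option (Status × Status × Bool)
  | fresh, e, _ => some (guard, e, false)
  | guard, e, b => some (freed b, e, true)
  | freed d, fresh, b => some (freed d, if b then replaced else rival, false)
  | freed d, rival, _ => some (freed d, rivalLost, false)
  | freed d, replaced, b => some (if b then spent d else freed d,
      if b then excised else replacedBack, false)
  | spent d, excised, _ => some (spent d, excisedBack, false)
  | _, _, _ => none

/-- The pairs of statuses that occur as the statuses of the two blocks of a requirement. -/
def paired : Status → Status → Bool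
  | freed _, fresh => true
  | freed _, rival => true
  | freed _, rivalLost => true
  | freed _, replaced => true
  | freed _, replacedBack => true
  | spent _, excised => true
  | spent _, excisedBack => true
  | _, _ => false

/-- `e.Below f` if `f` may be a later status of a block with the status `e`: every conflict under
`e` is one under `f`. -/
def Below (e f : Status) : Prop :=
  e = f ∨ e.rank < f.rank ∧ (∀ u v w, e.bot u v w → f.bot u v w) ∧ (e.ce → f.ce)

instance : DecidableRel Below := fun _ _ => inferInstanceAs (Decidable (_ ∨ _))

theorem rank_le (e : Status) : e.rank ≤ 3 := by
  revert e; decide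

theorem bot_mono {e : Status} {u v w u' v' w' : Bool} (hu : u → u') (hv : v → v') (hw : w → w')
    (h : e.bot u v w) : e.bot u' v' w' := by
  cases e <;> decide +revert

theorem trans_below {e f e' f' : Status} {b n : Bool} (h : trans e f b = some (e', f', n)) :
    e.Below e' ∧ f.Below f' ∧ e.rank + f.rank < e'.rank + f'.rank := by
  have key : ∀ e f b, ∀ z ∈ trans e f b,
      e.Below z.1 ∧ f.Below z.2.1 ∧ e.rank + f.rank < z.1.rank + z.2.1.rank := by
    intro e f b z hz
    cases e <;> cases f <;> simp only [trans, Option.mem_def, reduceCtorEq, Option.some.injEq] at hz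
      <;> subst hz <;> decide +revert
  exact key e f b _ h

theorem trans_new {e f e' f' : Status} {b n : Bool} (h : trans e f b = some (e', f', n)) :
    (e = fresh ∧ e' = guard ∧ f' = f ∧ n = false) ∨
    (e = guard ∧ e' = freed b ∧ f' = f ∧ n = true) ∨
    (paired e f ∧ paired e' f' ∧ n = false) := by
  have key : ∀ e f b, ∀ z ∈ trans e f b,
      (e = fresh ∧ z.1 = guard ∧ z.2.1 = f ∧ z.2.2 = false) ∨
      (e = guard ∧ z.1 = freed b ∧ z.2.1 = f ∧ z.2.2 = true) ∨
      (paired e f ∧ paired z.1 z.2.1 ∧ z.2.2 = false) := by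
    intro e f b z hz
    cases e <;> cases f <;> simp only [trans, Option.mem_def, reduceCtorEq, Option.some.injEq] at hz
      <;> subst hz <;> decide +revert
  exact key e f b _ h

theorem Below.bot {e f : Status} (h : e.Below f) {u v w : Bool} (hb : e.bot u v w) :
    f.bot u v w := by
  rcases h with rfl | ⟨_, h, _⟩
  exacts [hb, h u v w hb]

theorem Below.ce {e f : Status} (h : e.Below f) (hb : e.ce) : f.ce := by
  rcases h with rfl | ⟨_, _, h⟩
  exacts [hb, h hb]

theorem Below.rank_le {e f : Status} (h : e.Below f) : e.rank ≤ f.rank := by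
  rcases h with rfl | ⟨h, _, _⟩
  exacts [le_rfl, h.le]

noncomputable instance : Primcodable Status := Primcodable.ofEquiv _ (Fintype.equivFin Status)

theorem primrec_mem : Primrec₂ mem := by
  refine Primrec.ite (Primrec.eq.comp Primrec.snd (Primrec.const 0)) ?_
    (Primrec.ite (Primrec.eq.comp Primrec.snd (Primrec.const 1)) ?_ ?_)
  · exact (Primrec.dom_finite fun e : Status => e.accepted.1).comp Primrec.fst
  · exact (Primrec.dom_finite fun e : Status => e.accepted.2.1).comp Primrec.fst
  · exact (Primrec.dom_finite fun e : Status => e.accepted.2.2).comp Primrec.fst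

end Status

/-! ### The priority construction -/

open Nat.Partrec (Code)

/-- A record `(k, l, t)` of a requirement: its first block `k`, its second block `l` (or `0` as long
as there is none) and the last stage `t` at which it was appointed or acted. -/
abbrev Record : Type := ℕ × ℕ × ℕ

/-- A state of the construction: the statuses of the blocks appointed so far, and the stack of the
records of the active requirements, in order of priority. -/
abbrev State : Type := List Status × List Record

/-- The status of the block `k` in a state; untouched blocks are `fresh`. -/
def State.status (S : State) (k : ℕ) : Status := S.1.getD k Status.fresh

/-- The action of the requirement `c` that is considered at stage `s`, if there is one. Stage `s`
codes the requirement, the number `n` of blocks about which it asks its code, and an arbitrary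
third number. -/
noncomputable def action (s : ℕ) (S : State) : Option (Record × Status × Status × Bool) :=
  (S.2[s.unpair.1]?).bind fun ρ =>
    (Code.evaln s (Denumerable.ofNat Code s.unpair.1)
      (Encodable.encode (ρ.1, ρ.2.1, S.1.take s.unpair.2.unpair.1))).bind fun v =>
        (Status.trans (S.status ρ.1) (S.status ρ.2.1) v.bodd).map fun q => (ρ, q)

/-- One stage of the construction. If the requirement considered acts, then all requirements of
lower priority lose their records; otherwise one more requirement gets a record. -/
noncomputable def step (s : ℕ) (S : State) : State :=
  ((action s S).map fun z =>
    (((S.1.set z.1.1 z.2.1).set z.1.2.1 z.2.2.1) ++ [Status.fresh],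
      S.2.take s.unpair.1 ++ [(z.1.1, bif z.2.2.2 then s + 1 else z.1.2.1, s + 1)])).getD
    (S.1 ++ [Status.fresh], S.2 ++ [(s + 1, 0, s + 1)])

/-- The state of the construction at stage `s`. -/
noncomputable def stage (s : ℕ) : State :=
  Nat.rec ([Status.fresh], []) step s

theorem stage_succ (s : ℕ) : stage (s + 1) = step s (stage s) := rfl

theorem primrec_action : Primrec₂ action := by
  have hs : Primrec fun p : ℕ × State => p.1 := Primrec.fst
  have hc : Primrec fun p : ℕ × State => p.1.unpair.1 := Primrec.fst.comp (Primrec.unpair.comp hs)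
  have hn : Primrec fun p : ℕ × State => p.1.unpair.2.unpair.1 :=
    Primrec.fst.comp (Primrec.unpair.comp (Primrec.snd.comp (Primrec.unpair.comp hs)))
  have hstat : Primrec₂ fun (S : State) (k : ℕ) => S.status k :=
    (Primrec.list_getD Status.fresh).comp (Primrec.fst.comp Primrec.fst) Primrec.snd
  refine Primrec.option_bind
    (Primrec.list_getElem?.comp (Primrec.snd.comp Primrec.snd) hc) ?_
  refine Primrec.option_bind (f := fun p : (ℕ × State) × Record =>
    Code.evaln p.1.1 (Denumerable.ofNat Code p.1.1.unpair.1)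
      (Encodable.encode (p.2.1, p.2.2.1, p.1.2.1.take p.1.1.unpair.2.unpair.1))) ?_ ?_
  · refine Code.primrec_evaln.comp (Primrec.pair (Primrec.pair (hs.comp Primrec.fst)
      ((Primrec.ofNat Code).comp (hc.comp Primrec.fst))) (Primrec.encode.comp ?_))
    refine Primrec.pair (Primrec.fst.comp Primrec.snd)
      (Primrec.pair (Primrec.fst.comp (Primrec.snd.comp Primrec.snd)) ?_)
    exact Primrec.list_take.comp (hn.comp Primrec.fst)
      (Primrec.fst.comp (Primrec.snd.comp Primrec.fst))
  · refine Primrec.option_map (f := fun p : ((ℕ × State) × Record) × ℕ =>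
      Status.trans (p.1.1.2.status p.1.2.1) (p.1.1.2.status p.1.2.2.1) p.2.bodd) ?_ ?_
    · have ht := Primrec.dom_finite fun z : Status × Status × Bool => Status.trans z.1 z.2.1 z.2.2
      refine ht.comp (Primrec.pair ?_ (Primrec.pair ?_ (Primrec.nat_bodd.comp Primrec.snd)))
      · exact hstat.comp (Primrec.snd.comp (Primrec.fst.comp Primrec.fst))
          (Primrec.fst.comp (Primrec.snd.comp Primrec.fst))
      · exact hstat.comp (Primrec.snd.comp (Primrec.fst.comp Primrec.fst))
          (Primrec.fst.comp (Primrec.snd.comp (Primrec.snd.comp Primrec.fst)))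
    · exact Primrec.pair (Primrec.snd.comp (Primrec.fst.comp Primrec.fst)) Primrec.snd

theorem primrec_stage : Primrec stage := by
  refine Primrec.nat_rec₁ _ ?_
  have hs : Primrec fun p : ℕ × State => p.1 + 1 := Primrec.succ.comp Primrec.fst
  have hbl : Primrec fun p : ℕ × State => p.2.1 := Primrec.fst.comp Primrec.snd
  have hst : Primrec fun p : ℕ × State => p.2.2 := Primrec.snd.comp Primrec.snd
  refine Primrec.option_getD.comp (Primrec.option_map primrec_action ?_) ?_
  · have hz : Primrec fun p : (ℕ × State) × Record × Status × Status × Bool => p.2 := Primrec.snd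
    have hk := Primrec.fst.comp (Primrec.fst.comp hz)
    have hl := Primrec.fst.comp (Primrec.snd.comp (Primrec.fst.comp hz))
    refine Primrec.pair ?_ ?_
    · refine Primrec.list_concat.comp ?_ (Primrec.const _)
      refine Primrec.list_set.comp (Primrec.list_set.comp (hbl.comp Primrec.fst)
        (Primrec.pair hk (Primrec.fst.comp (Primrec.snd.comp hz)))) (Primrec.pair hl ?_)
      exact Primrec.fst.comp (Primrec.snd.comp (Primrec.snd.comp hz))
    · refine Primrec.list_concat.comp ?_ ?_
      · exact Primrec.list_take.comp (Primrec.fst.comp (Primrec.unpair.comp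
          (Primrec.fst.comp Primrec.fst))) (hst.comp Primrec.fst)
      · refine Primrec.pair hk (Primrec.pair (Primrec.cond ?_ (hs.comp Primrec.fst) hl)
          (hs.comp Primrec.fst))
        exact Primrec.snd.comp (Primrec.snd.comp (Primrec.snd.comp hz))
  · exact Primrec.pair (Primrec.list_concat.comp hbl (Primrec.const _))
      (Primrec.list_concat.comp hst (Primrec.pair hs (Primrec.pair (Primrec.const 0) hs)))

/-- The status of the block `k` at stage `s`. -/
noncomputable def st (s k : ℕ) : Status := (stage s).status k

theorem action_eq_some {s : ℕ} {S : State} {ρ : Record} {q : Status × Status × Bool} :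
    action s S = some (ρ, q) ↔ S.2[s.unpair.1]? = some ρ ∧
      ∃ v ∈ Code.evaln s (Denumerable.ofNat Code s.unpair.1)
        (Encodable.encode (ρ.1, ρ.2.1, S.1.take s.unpair.2.unpair.1)),
        Status.trans (S.status ρ.1) (S.status ρ.2.1) v.bodd = some q := by
  simp only [action, Option.bind_eq_some_iff, Option.map_eq_some_iff, Prod.mk.injEq, Option.mem_def]
  constructor
  · rintro ⟨ρ', h, v, hv, q', hq, rfl, rfl⟩
    exact ⟨h, v, hv, hq⟩
  · rintro ⟨h, v, hv, hq⟩
    exact ⟨ρ, h, v, hv, q, hq, rfl, rfl⟩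

theorem step_of_none {s : ℕ} {S : State} (h : action s S = none) :
    step s S = (S.1 ++ [Status.fresh], S.2 ++ [(s + 1, 0, s + 1)]) := by
  simp [step, h]

theorem step_of_some {s : ℕ} {S : State} {ρ : Record} {q : Status × Status × Bool}
    (h : action s S = some (ρ, q)) :
    step s S = (((S.1.set ρ.1 q.1).set ρ.2.1 q.2.1) ++ [Status.fresh],
      S.2.take s.unpair.1 ++ [(ρ.1, bif q.2.2 then s + 1 else ρ.2.1, s + 1)]) := by
  simp [step, h]

theorem status_concat (bl : List Status) (stk stk' : List Record) (k : ℕ) :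
    State.status (bl ++ [Status.fresh], stk) k = State.status (bl, stk') k := by
  unfold State.status
  simp only [List.getD_eq_getElem?_getD, List.getElem?_append]
  split_ifs with h
  · rfl
  · rw [List.getElem?_eq_none (by omega : bl.length ≤ k)]
    rcases hk : ([Status.fresh] : List Status)[k - bl.length]? with _ | x
    · rfl
    · have := List.mem_of_getElem? hk
      simpa using this

theorem status_set (bl : List Status) (stk stk' : List Record) {k : ℕ} (e : Status)
    (hk : k < bl.length) (j : ℕ) :
    State.status (bl.set k e, stk) j = if j = k then e else State.status (bl, stk') j := by
  unfold State.status
  simp only [List.getD_eq_getElem?_getD, List.getElem?_set]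
  by_cases h : k = j
  · subst h; simp [hk]
  · simp [h, Ne.symm h]

theorem length_stage (s : ℕ) : (stage s).1.length = s + 1 := by
  induction s with
  | zero => rfl
  | succ s ih =>
    rw [stage_succ]
    rcases h : action s (stage s) with _ | ⟨ρ, q⟩
    · simp [step_of_none h, ih]
    · simp [step_of_some h, ih]

theorem st_of_lt {s k : ℕ} (h : s < k) : st s k = Status.fresh := by
  unfold st State.status
  rw [List.getD_eq_getElem?_getD, List.getElem?_eq_none (by rw [length_stage]; omega)]
  rfl

theorem st_succ_of_none {s : ℕ} (h : action s (stage s) = none) (k : ℕ) :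
    st (s + 1) k = st s k := by
  unfold st
  rw [stage_succ, step_of_none h]
  exact status_concat _ _ _ _

theorem stack_succ_of_none {s : ℕ} (h : action s (stage s) = none) :
    (stage (s + 1)).2 = (stage s).2 ++ [(s + 1, 0, s + 1)] := by
  rw [stage_succ, step_of_none h]

theorem stack_succ_of_some {s : ℕ} {ρ : Record} {q : Status × Status × Bool}
    (h : action s (stage s) = some (ρ, q)) : (stage (s + 1)).2 =
      (stage s).2.take s.unpair.1 ++ [(ρ.1, bif q.2.2 then s + 1 else ρ.2.1, s + 1)] := by
  rw [stage_succ, step_of_some h]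

theorem st_succ_of_some {s : ℕ} {ρ : Record} {q : Status × Status × Bool}
    (h : action s (stage s) = some (ρ, q)) (h1 : ρ.1 ≤ s) (h2 : ρ.2.1 ≤ s) (k : ℕ) :
    st (s + 1) k = if k = ρ.2.1 then q.2.1 else if k = ρ.1 then q.1 else st s k := by
  unfold st
  rw [stage_succ, step_of_some h, status_concat _ _ [] k,
    status_set _ _ [] _ (by rw [List.length_set, length_stage]; omega),
    status_set _ _ (stage s).2 _ (by rw [length_stage]; omega)]

/-- What is known about the record of a requirement at stage `s`: the blocks were appointed before
the last action, and the second block is missing as long as the first one is only guarded. -/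
def GoodRecord (s : ℕ) (ρ : Record) : Prop :=
  1 ≤ ρ.1 ∧ ρ.1 ≤ ρ.2.2 ∧ ρ.2.2 ≤ s ∧
    ((ρ.2.1 = 0 ∧ (st s ρ.1 = Status.fresh ∨ st s ρ.1 = Status.guard)) ∨
      (ρ.1 < ρ.2.1 ∧ ρ.2.1 ≤ ρ.2.2 ∧ Status.paired (st s ρ.1) (st s ρ.2.1)))

/-- The structure of a stage: records are good, blocks of requirements of lower priority
were appointed after the last action of the requirements of higher priority, and block `0` is never
used. -/
structure GoodStage (s : ℕ) : Prop where
  zero : st s 0 = Status.fresh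
  good : ∀ (c : ℕ) (ρ : Record), (stage s).2[c]? = some ρ → GoodRecord s ρ
  ordered : ∀ (c d : ℕ) (ρ τ : Record), c < d → (stage s).2[c]? = some ρ →
    (stage s).2[d]? = some τ → ρ.2.2 < τ.1

theorem GoodRecord.second_le {s : ℕ} {ρ : Record} (h : GoodRecord s ρ) : ρ.2.1 ≤ ρ.2.2 := by
  rcases h with ⟨_, _, _, ⟨h, _⟩ | ⟨_, h, _⟩⟩ <;> omega

/-- The effect of an action on the statuses. Nothing is written to block `0`, the stand-in for a
missing second block. -/
theorem GoodStage.st_succ {s : ℕ} (hs : GoodStage s) {ρ : Record} {q : Status × Status × Bool}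
    (h : action s (stage s) = some (ρ, q)) (k : ℕ) :
    st (s + 1) k = if k = ρ.1 then q.1 else if ρ.2.1 ≠ 0 ∧ k = ρ.2.1 then q.2.1 else st s k := by
  obtain ⟨hρ, v, _, hv⟩ := action_eq_some.1 h
  have hg := hs.good _ _ hρ
  have hle := hg.second_le
  obtain ⟨h1, h2, h3, h4⟩ := hg
  rw [st_succ_of_some h (by omega) (by omega)]
  rcases h4 with ⟨h0, h4⟩ | ⟨h4, _, _⟩
  · rw [h0] at hv ⊢
    have hq : q.2.1 = Status.fresh := by
      have h00 : (stage s).status 0 = Status.fresh := hs.zero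
      rw [h00] at hv
      rcases Status.trans_new (e' := q.1) (f' := q.2.1) (n := q.2.2) hv with
        ⟨_, _, h, _⟩ | ⟨_, _, h, _⟩ | ⟨h, _, _⟩
      · exact h
      · exact h
      · change Status.paired (st s ρ.1) _ = _ at h
        rcases h4 with h4 | h4 <;> rw [h4] at h <;> simp [Status.paired] at h
    by_cases hk : k = 0
    · subst hk
      rw [if_pos rfl, if_neg (by omega), if_neg (by simp), hq, hs.zero]
    · simp [hk]
  · by_cases hk : k = ρ.1
    · rw [if_neg (by omega), if_pos hk, if_pos hk]
    · by_cases hk' : k = ρ.2.1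
      · rw [if_pos hk', if_neg hk, if_pos ⟨by omega, hk'⟩]
      · rw [if_neg hk', if_neg hk, if_neg hk, if_neg (by tauto)]

theorem getElem?_stack_of_some {s : ℕ} {ρ τ : Record} {q : Status × Status × Bool} {c : ℕ}
    (h : action s (stage s) = some (ρ, q)) (hc : (stage (s + 1)).2[c]? = some τ) :
    (c < s.unpair.1 ∧ (stage s).2[c]? = some τ) ∨
      (c = s.unpair.1 ∧ τ = (ρ.1, bif q.2.2 then s + 1 else ρ.2.1, s + 1)) := by
  obtain ⟨hρ, _⟩ := action_eq_some.1 h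
  have hlen := (List.getElem?_eq_some_iff.1 hρ).1
  rw [stack_succ_of_some h, List.getElem?_append] at hc
  simp only [List.length_take, min_eq_left hlen.le] at hc
  split_ifs at hc with hlt
  · rw [List.getElem?_take, if_pos hlt] at hc
    exact Or.inl ⟨hlt, hc⟩
  · have hz : c - s.unpair.1 = 0 := by
      by_contra hne
      rw [List.getElem?_eq_none (by simp; omega)] at hc
      simp at hc
    rw [hz] at hc
    exact Or.inr ⟨by omega, by simpa using hc.symm⟩

theorem getElem?_stack_of_none {s : ℕ} {τ : Record} {c : ℕ}
    (h : action s (stage s) = none) (hc : (stage (s + 1)).2[c]? = some τ) :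
    (stage s).2[c]? = some τ ∨ (c = (stage s).2.length ∧ τ = (s + 1, 0, s + 1)) := by
  rw [stack_succ_of_none h, List.getElem?_append] at hc
  split_ifs at hc with hlt
  · exact Or.inl hc
  · have hz : c - (stage s).2.length = 0 := by
      by_contra hne
      rw [List.getElem?_eq_none (by simp; omega)] at hc
      simp at hc
    rw [hz] at hc
    exact Or.inr ⟨by omega, by simpa using hc.symm⟩

/-- The blocks of a requirement of higher priority than the acting one keep their statuses. -/
theorem GoodStage.st_succ_of_le {s : ℕ} (hs : GoodStage s) {ρ τ : Record}
    {q : Status × Status × Bool} (h : action s (stage s) = some (ρ, q)) {c : ℕ}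
    (hc : c < s.unpair.1) (hτ : (stage s).2[c]? = some τ) {k : ℕ} (hk : k ≤ τ.2.2) :
    st (s + 1) k = st s k := by
  obtain ⟨hρ, _⟩ := action_eq_some.1 h
  have h1 := hs.ordered _ _ _ _ hc hτ hρ
  have h2 := (hs.good _ _ hρ).2.2.2
  rw [hs.st_succ h, if_neg (by omega), if_neg (by omega)]

theorem goodStage (s : ℕ) : GoodStage s := by
  induction s with
  | zero => exact ⟨rfl, by simp [stage], by simp [stage]⟩
  | succ s ih =>
    rcases h : action s (stage s) with _ | ⟨ρ, q⟩
    · have hst := st_succ_of_none h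
      refine ⟨by rw [hst, ih.zero], fun c τ hτ => ?_, fun c d τ υ hcd hτ hυ => ?_⟩
      · rcases getElem?_stack_of_none h hτ with hτ | ⟨_, rfl⟩
        · have := ih.good c τ hτ
          unfold GoodRecord at this ⊢
          simp only [hst]
          exact ⟨this.1, this.2.1, by omega, this.2.2.2⟩
        · exact ⟨by simp, le_rfl, le_rfl, Or.inl ⟨rfl, Or.inl (by rw [hst, st_of_lt (by simp)])⟩⟩
      · rcases getElem?_stack_of_none h hτ with hτ | ⟨hc, rfl⟩
        · rcases getElem?_stack_of_none h hυ with hυ | ⟨_, rfl⟩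
          · exact ih.ordered _ _ _ _ hcd hτ hυ
          · have := (ih.good _ _ hτ).2.2.1
            simp only; omega
        · rcases getElem?_stack_of_none h hυ with hυ | ⟨hd, _⟩
          · have := (List.getElem?_eq_some_iff.1 hυ).1
            omega
          · omega
    · have hst := ih.st_succ h
      obtain ⟨hρ, v, _, hv⟩ := action_eq_some.1 h
      have hg := ih.good _ _ hρ
      have htr := Status.trans_new (e' := q.1) (f' := q.2.1) (n := q.2.2) hv
      change (st s ρ.1 = _ ∧ _ ∧ q.2.1 = st s ρ.2.1 ∧ _) ∨
        (st s ρ.1 = _ ∧ _ ∧ q.2.1 = st s ρ.2.1 ∧ _) ∨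
        (Status.paired (st s ρ.1) (st s ρ.2.1) ∧ _) at htr
      refine ⟨?_, fun c τ hτ => ?_, fun c d τ υ hcd hτ hυ => ?_⟩
      · have := hg.1
        rw [hst, if_neg (by omega), if_neg (by omega), ih.zero]
      · rcases getElem?_stack_of_some h hτ with ⟨hc, hτ⟩ | ⟨_, rfl⟩
        · have hτg := ih.good c τ hτ
          have hle := hτg.second_le
          unfold GoodRecord at hτg ⊢
          rw [ih.st_succ_of_le h hc hτ hτg.2.1, ih.st_succ_of_le h hc hτ hle]
          exact ⟨hτg.1, hτg.2.1, by omega, hτg.2.2.2⟩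
        · obtain ⟨g1, g2, g3, g4⟩ := hg
          have hE : st (s + 1) ρ.1 = q.1 := by rw [hst, if_pos rfl]
          refine ⟨g1, by simp only; omega, le_rfl, ?_⟩
          simp only [hE]
          rcases htr with ⟨e1, e2, e3, e4⟩ | ⟨e1, e2, e3, e4⟩ | ⟨e1, e2, e3⟩
          · rcases g4 with ⟨g4, _⟩ | ⟨_, _, g4⟩
            · exact Or.inl ⟨by simp [e4, g4], Or.inr e2⟩
            · rw [e1] at g4; simp [Status.paired] at g4
          · refine Or.inr ⟨by simp [e4]; omega, by simp [e4], ?_⟩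
            have : st (s + 1) (s + 1) = Status.fresh := by
              rw [hst, if_neg (by omega), if_neg, st_of_lt (by omega)]
              rintro ⟨_, h⟩
              rcases g4 with ⟨g4, _⟩ | ⟨_, g4, _⟩ <;> omega
            simp [e4, this, e2, Status.paired]
          · rcases g4 with ⟨_, g4⟩ | ⟨g4, g5, _⟩
            · rcases g4 with g4 | g4 <;> rw [g4] at e1 <;> simp [Status.paired] at e1
            · refine Or.inr ⟨by simpa [e3] using g4, by simp [e3]; omega, ?_⟩
              simp only [e3, cond_false]
              rwa [hst ρ.2.1, if_neg (by omega), if_pos ⟨by omega, rfl⟩]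
      · rcases getElem?_stack_of_some h hτ with ⟨hc, hτ⟩ | ⟨hc, _⟩
        · rcases getElem?_stack_of_some h hυ with ⟨_, hυ⟩ | ⟨_, rfl⟩
          · exact ih.ordered _ _ _ _ hcd hτ hυ
          · exact ih.ordered c _ τ ρ hc hτ hρ
        · rcases getElem?_stack_of_some h hυ with ⟨hd, _⟩ | ⟨hd, _⟩ <;> omega

theorem st_below_succ (s k : ℕ) : (st s k).Below (st (s + 1) k) := by
  rcases h : action s (stage s) with _ | ⟨ρ, q⟩
  · rw [st_succ_of_none h]; exact Or.inl rfl
  · rw [(goodStage s).st_succ h]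
    obtain ⟨_, v, _, hv⟩ := action_eq_some.1 h
    have ht := Status.trans_below (e' := q.1) (f' := q.2.1) (n := q.2.2) hv
    split_ifs with h1 h2
    · rw [h1]; exact ht.1
    · rw [h2.2]; exact ht.2.1
    · exact Or.inl rfl

theorem bot_st_mono {s t : ℕ} (h : s ≤ t) {k : ℕ} {u v w : Bool} (hb : (st s k).bot u v w) :
    (st t k).bot u v w := by
  induction t, h using Nat.le_induction with
  | base => exact hb
  | succ t _ ih => exact (st_below_succ t k).bot ih

theorem ce_st_mono {s t : ℕ} (h : s ≤ t) {k : ℕ} (hb : (st s k).ce) : (st t k).ce := by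
  induction t, h using Nat.le_induction with
  | base => exact hb
  | succ t _ ih => exact (st_below_succ t k).ce ih

/-- A sequence of natural numbers that is bounded and nondecreasing from some point on is
eventually constant. -/
theorem exists_eventually_const {f : ℕ → ℕ} {s₀ b : ℕ} (hf : ∀ s, s₀ ≤ s → f s ≤ f (s + 1))
    (hb : ∀ s, f s ≤ b) : ∃ t, s₀ ≤ t ∧ ∀ s, t ≤ s → f s = f t := by
  obtain ⟨t, ht, hmax⟩ : ∃ t, s₀ ≤ t ∧ ∀ s, s₀ ≤ s → f s ≤ f t := by
    by_contra hcon
    push Not at hcon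
    have : ∀ n, ∃ t, s₀ ≤ t ∧ n ≤ f t := by
      intro n
      induction n with
      | zero => exact ⟨s₀, le_rfl, Nat.zero_le _⟩
      | succ n ih =>
        obtain ⟨t, ht, hn⟩ := ih
        obtain ⟨s, hs, hlt⟩ := hcon t ht
        exact ⟨s, hs, by omega⟩
    obtain ⟨t, _, h⟩ := this (b + 1)
    have := hb t
    omega
  refine ⟨t, ht, fun s hs => le_antisymm (hmax s (ht.trans hs)) ?_⟩
  induction s, hs using Nat.le_induction with
  | base => exact le_rfl
  | succ s hs ih => exact ih.trans (hf s (ht.trans hs))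

theorem exists_final_status (k : ℕ) : ∃ e t, ∀ s, t ≤ s → st s k = e := by
  obtain ⟨t, _, ht⟩ := exists_eventually_const (f := fun s => (st s k).rank) (s₀ := 0) (b := 3)
    (fun s _ => (st_below_succ s k).rank_le) (fun s => Status.rank_le _)
  refine ⟨st t k, t, fun s hs => ?_⟩
  induction s, hs using Nat.le_induction with
  | base => rfl
  | succ s hs ih =>
    rcases st_below_succ s k with h | ⟨h, _⟩
    · rw [← h, ih]
    · have h1 := ht s hs
      have h2 := ht (s + 1) (by omega)
      omega

/-- The final status of the block `k`. -/
noncomputable def finalSt (k : ℕ) : Status := (exists_final_status k).choose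

theorem exists_forall_st_eq (k : ℕ) : ∃ t, ∀ s, t ≤ s → st s k = finalSt k :=
  (exists_final_status k).choose_spec

theorem exists_forall_lt_st_eq (n : ℕ) : ∃ t, ∀ s, t ≤ s → ∀ k < n, st s k = finalSt k := by
  induction n with
  | zero => exact ⟨0, by simp⟩
  | succ n ih =>
    obtain ⟨t, ht⟩ := ih
    obtain ⟨u, hu⟩ := exists_forall_st_eq n
    refine ⟨max t u, fun s hs k hk => ?_⟩
    rcases Nat.lt_succ_iff_lt_or_eq.1 hk with hk | rfl
    · exact ht s ((le_max_left _ _).trans hs) k hk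
    · exact hu s ((le_max_right _ _).trans hs)

/-- Every requirement has a record from some stage on, and those of higher or equal priority do not
act any more. -/
theorem exists_settled (c : ℕ) : ∃ s₀, ∀ s, s₀ ≤ s → c ≤ (stage s).2.length ∧
    (s.unpair.1 < c → action s (stage s) = none) := by
  induction c with
  | zero => exact ⟨0, by simp⟩
  | succ c ih =>
    obtain ⟨s₀, h₀⟩ := ih
    -- the record exists
    have hkeep : ∀ s, s₀ ≤ s → c + 1 ≤ (stage s).2.length → c + 1 ≤ (stage (s + 1)).2.length := by
      intro s hs hl
      rcases h : action s (stage s) with _ | ⟨ρ, q⟩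
      · rw [stack_succ_of_none h]; simp; omega
      · obtain ⟨hρ, _⟩ := action_eq_some.1 h
        have := (List.getElem?_eq_some_iff.1 hρ).1
        rw [stack_succ_of_some h]
        have hc : ¬ s.unpair.1 < c := fun hlt => by
          have := (h₀ s hs).2 hlt; rw [h] at this; simp at this
        simp; omega
    have hlen : ∀ s, s₀ + 1 ≤ s → c + 1 ≤ (stage s).2.length := by
      intro s hs
      induction s, hs using Nat.le_induction with
      | base =>
        by_cases hl : c + 1 ≤ (stage s₀).2.length
        · exact hkeep _ le_rfl hl
        · have hl' := (h₀ s₀ le_rfl).1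
          have : action s₀ (stage s₀) = none := by
            by_cases hc : s₀.unpair.1 < c
            · exact (h₀ s₀ le_rfl).2 hc
            · rcases h : action s₀ (stage s₀) with _ | ⟨ρ, q⟩
              · rfl
              · obtain ⟨hρ, _⟩ := action_eq_some.1 h
                have := (List.getElem?_eq_some_iff.1 hρ).1
                omega
          rw [stack_succ_of_none this]; simp; omega
      | succ s hs ih => exact hkeep s (by omega) ih
    -- the ranks of its blocks do not decrease, and increase with every action
    set f : ℕ → ℕ := fun s =>
      (((stage s).2[c]?).map fun ρ => (st s ρ.1).rank + (st s ρ.2.1).rank).getD 0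
      with hf
    have hfb : ∀ s, f s ≤ 6 := fun s => by
      simp only [hf]
      rcases (stage s).2[c]? with _ | ρ
      · simp
      · have h1 := (st s ρ.1).rank_le
        have h2 := (st s ρ.2.1).rank_le
        simp; omega
    have hstep : ∀ s, s₀ + 1 ≤ s → f s ≤ f (s + 1) ∧
        (s.unpair.1 = c → action s (stage s) ≠ none → f s < f (s + 1)) := by
      intro s hs
      have hl := hlen s hs
      have hg := goodStage s
      obtain ⟨ρ, hρ⟩ : ∃ ρ, (stage s).2[c]? = some ρ :=
        ⟨(stage s).2[c], by simp [show c < (stage s).2.length by omega]⟩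
      rcases h : action s (stage s) with _ | ⟨σ, q⟩
      · refine ⟨le_of_eq ?_, fun _ h => absurd rfl h⟩
        have : (stage (s + 1)).2[c]? = some ρ := by
          rw [stack_succ_of_none h, List.getElem?_append_left (by omega), hρ]
        simp only [hf, hρ, this, st_succ_of_none h]
      · obtain ⟨hσ, v, _, hv⟩ := action_eq_some.1 h
        have hsl := (List.getElem?_eq_some_iff.1 hσ).1
        have hc : ¬ s.unpair.1 < c := fun hlt => by
          have := (h₀ s (by omega)).2 hlt; rw [h] at this; simp at this
        by_cases hce : s.unpair.1 = c
        · have hσρ : σ = ρ := by rw [hce, hρ] at hσ; simpa using hσ.symm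
          subst hσρ
          have hrec : (stage (s + 1)).2[c]? =
              some (σ.1, bif q.2.2 then s + 1 else σ.2.1, s + 1) := by
            rw [stack_succ_of_some h, List.getElem?_append_right (by simp; omega)]
            simp [hce, show min c (stage s).2.length = c by omega]
          obtain ⟨_, _, ht⟩ := Status.trans_below (e' := q.1) (f' := q.2.1) (n := q.2.2) hv
          have hst := hg.st_succ h
          have key : f s < f (s + 1) := by
            simp only [hf, hρ, hrec, Option.map_some, Option.getD_some]
            refine lt_of_lt_of_le ht ?_
            rw [hst σ.1, if_pos rfl]
            refine Nat.add_le_add_left ?_ _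
            have h4 := (hg.good _ _ hρ)
            have htr := Status.trans_new (e' := q.1) (f' := q.2.1) (n := q.2.2) hv
            change (st s σ.1 = _ ∧ _ ∧ q.2.1 = st s σ.2.1 ∧ _) ∨
              (st s σ.1 = _ ∧ _ ∧ q.2.1 = st s σ.2.1 ∧ _) ∨
              (Status.paired (st s σ.1) (st s σ.2.1) ∧ _) at htr
            rcases h4.2.2.2 with ⟨h0, h4⟩ | ⟨h4, h5, h6⟩
            · have : q.2.1 = Status.fresh := by
                rcases htr with ⟨_, _, e, _⟩ | ⟨_, _, e, _⟩ | ⟨e, _, _⟩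
                · rw [e, h0, hg.zero]
                · rw [e, h0, hg.zero]
                · rcases h4 with h4 | h4 <;> rw [h4] at e <;> simp [Status.paired] at e
              rw [this]; exact Nat.zero_le _
            · have : q.2.2 = false := by
                rcases htr with ⟨e, _⟩ | ⟨e, _⟩ | ⟨_, _, e⟩
                · rw [e] at h6; simp [Status.paired] at h6
                · rw [e] at h6; simp [Status.paired] at h6
                · exact e
              rw [this, cond_false, hst σ.2.1, if_neg (by omega), if_pos ⟨by omega, rfl⟩]
          exact ⟨key.le, fun _ _ => key⟩
        · have hlt : c < s.unpair.1 := by omega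
          refine ⟨le_of_eq ?_, fun h => absurd h hce⟩
          have hrec : (stage (s + 1)).2[c]? = some ρ := by
            rw [stack_succ_of_some h, List.getElem?_append_left (by simp; omega),
              List.getElem?_take, if_pos hlt, hρ]
          simp only [hf, hρ, hrec, Option.map_some, Option.getD_some]
          rw [hg.st_succ_of_le h hlt hρ (hg.good _ _ hρ).2.1,
            hg.st_succ_of_le h hlt hρ (hg.good _ _ hρ).second_le]
    obtain ⟨t, ht, hconst⟩ := exists_eventually_const (fun s hs => (hstep s hs).1) hfb
    refine ⟨t, fun s hs => ⟨hlen s (ht.trans hs), fun hlt => ?_⟩⟩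
    rcases Nat.lt_succ_iff_lt_or_eq.1 hlt with hlt | he
    · exact (h₀ s (by omega)).2 hlt
    · by_contra hne
      have h1 := (hstep s (ht.trans hs)).2 he hne
      have h2 := hconst s hs
      have h3 := hconst (s + 1) (by omega)
      omega

/-- Every requirement eventually has a record that does not change any more. -/
theorem exists_final_record (c : ℕ) : ∃ ρ s₀, ∀ s, s₀ ≤ s → (stage s).2[c]? = some ρ ∧
    (s.unpair.1 = c → action s (stage s) = none) := by
  obtain ⟨s₀, h₀⟩ := exists_settled (c + 1)
  have hl : c < (stage s₀).2.length := (h₀ s₀ le_rfl).1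
  refine ⟨(stage s₀).2[c], s₀, fun s hs => ⟨?_, fun h => (h₀ s hs).2 (by omega)⟩⟩
  induction s, hs using Nat.le_induction with
  | base => simp [hl]
  | succ s hs ih =>
    rcases h : action s (stage s) with _ | ⟨ρ, q⟩
    · rw [stack_succ_of_none h, List.getElem?_append_left (h₀ s hs).1, ih]
    · obtain ⟨hρ, _⟩ := action_eq_some.1 h
      have hsl := (List.getElem?_eq_some_iff.1 hρ).1
      have hc : ¬ s.unpair.1 < c + 1 := fun hlt => by
        have := (h₀ s hs).2 hlt; rw [h] at this; simp at this
      rw [stack_succ_of_some h, List.getElem?_append_left (by simp; omega),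
        List.getElem?_take, if_pos (by omega), ih]

/-! ### The q-dialectical system of the construction -/

/-- The block `k` derives `⊥` from the set of arguments `F` at stage `s`. -/
def BlockBot (s : ℕ) (F : Finset ℕ) (k : ℕ) : Prop :=
  (st s k).bot (decide (3 * k ∈ F)) (decide (3 * k + 1 ∈ F)) (decide (3 * k + 2 ∈ F)) = true

/-- The block `k` derives `ce` from the set of arguments `F` at stage `s`. -/
def BlockCe (s : ℕ) (F : Finset ℕ) (k : ℕ) : Prop :=
  (st s k).ce = true ∧ 3 * k ∈ F

open Classical in
/-- The approximated consequence operator of the construction. No argument is derived from others;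
conflicts arise inside the blocks, according to their current statuses. -/
noncomputable def blockOp (s : ℕ) (F : Finset ℕ) : Finset Formula :=
  F.image Formula.arg ∪ (if ∃ k < s + 1, BlockBot s F k then {Formula.bot} else ∅) ∪
    (if ∃ k < s + 1, BlockCe s F k then {Formula.ce} else ∅)

theorem arg_mem_blockOp {s : ℕ} {F : Finset ℕ} {i : ℕ} : Formula.arg i ∈ blockOp s F ↔ i ∈ F := by
  unfold blockOp
  split_ifs <;> simp

theorem Status.bot_fresh (u v w : Bool) : Status.fresh.bot u v w = false := rfl

theorem bot_mem_blockOp {s : ℕ} {F : Finset ℕ} :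
    Formula.bot ∈ blockOp s F ↔ ∃ k, BlockBot s F k := by
  have h : (∃ k, BlockBot s F k) ↔ ∃ k < s + 1, BlockBot s F k := by
    refine exists_congr fun k => ⟨fun h => ⟨?_, h⟩, And.right⟩
    by_contra hk
    unfold BlockBot at h
    rw [st_of_lt (by omega), Status.bot_fresh] at h
    simp at h
  rw [h]
  unfold blockOp
  split_ifs <;> simp_all

theorem ce_mem_blockOp {s : ℕ} {F : Finset ℕ} :
    Formula.ce ∈ blockOp s F ↔ ∃ k, BlockCe s F k := by
  have h : (∃ k, BlockCe s F k) ↔ ∃ k < s + 1, BlockCe s F k := by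
    refine exists_congr fun k => ⟨fun h => ⟨?_, h⟩, And.right⟩
    by_contra hk
    unfold BlockCe at h
    rw [st_of_lt (by omega)] at h
    simp [Status.ce] at h
  rw [h]
  unfold blockOp
  split_ifs <;> simp_all

theorem BlockBot.mono {s t : ℕ} (hst : s ≤ t) {F G : Finset ℕ} {k : ℕ}
    (hFG : ∀ i ∈ F, i / 3 = k → i ∈ G) (h : BlockBot s F k) : BlockBot t G k := by
  refine bot_st_mono hst (Status.bot_mono ?_ ?_ ?_ h) <;> simp only [decide_eq_true_eq] <;>
    intro hi <;> exact hFG _ hi (by omega)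

theorem BlockCe.mono {s t : ℕ} (hst : s ≤ t) {F G : Finset ℕ} {k : ℕ}
    (hFG : ∀ i ∈ F, i / 3 = k → i ∈ G) (h : BlockCe s F k) : BlockCe t G k :=
  ⟨ce_st_mono hst h.1, hFG _ h.2 (by omega)⟩

theorem blockOp_mono {s t : ℕ} (hst : s ≤ t) {F G : Finset ℕ} (hFG : F ⊆ G) :
    blockOp s F ⊆ blockOp t G := by
  rintro (i | b | b) hx
  · exact arg_mem_blockOp.2 (hFG (arg_mem_blockOp.1 hx))
  · obtain ⟨k, hk⟩ := ce_mem_blockOp.1 hx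
    exact ce_mem_blockOp.2 ⟨k, hk.mono hst fun i hi _ => hFG hi⟩
  · obtain ⟨k, hk⟩ := bot_mem_blockOp.1 hx
    exact bot_mem_blockOp.2 ⟨k, hk.mono hst fun i hi _ => hFG hi⟩

theorem primrec_mem_list : PrimrecRel fun (l : List ℕ) (i : ℕ) => i ∈ l :=
  (PrimrecRel.exists_mem_list (Primrec.eq (α := ℕ))).of_eq fun l i => by simp

theorem primrec_st : Primrec₂ st :=
  (Primrec.list_getD Status.fresh).comp (Primrec.fst.comp (primrec_stage.comp Primrec.fst))
    Primrec.snd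

theorem blockOp_computable : IsComputableOp blockOp := by
  classical
  have hk : Primrec fun p : ℕ × ℕ × List ℕ => 3 * p.1 :=
    Primrec.nat_mul.comp (Primrec.const 3) Primrec.fst
  have hl : Primrec fun p : ℕ × ℕ × List ℕ => p.2.2 := Primrec.snd.comp Primrec.snd
  have hst : Primrec fun p : ℕ × ℕ × List ℕ => st p.2.1 p.1 :=
    primrec_st.comp (Primrec.fst.comp Primrec.snd) Primrec.fst
  have hm : ∀ c, Primrec fun p : ℕ × ℕ × List ℕ => decide (3 * p.1 + c ∈ p.2.2) := fun c =>
    (primrec_mem_list.comp hl (Primrec.nat_add.comp hk (Primrec.const c))).decide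
  have hbot : PrimrecRel fun (k : ℕ) (p : ℕ × List ℕ) => BlockBot p.1 p.2.toFinset k := by
    have hb := Primrec.dom_finite fun z : Status × Bool × Bool × Bool =>
      z.1.bot z.2.1 z.2.2.1 z.2.2.2
    refine (Primrec.eq.comp (hb.comp (Primrec.pair hst (Primrec.pair (hm 0)
      (Primrec.pair (hm 1) (hm 2))))) (Primrec.const true)).of_eq fun p => ?_
    simp [BlockBot]
  have hce : PrimrecRel fun (k : ℕ) (p : ℕ × List ℕ) => BlockCe p.1 p.2.toFinset k := by
    have hb := Primrec.dom_finite fun z : Status × Bool => z.1.ce && z.2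
    refine (Primrec.eq.comp (hb.comp (Primrec.pair hst (hm 0))) (Primrec.const true)).of_eq
      fun p => ?_
    simp [BlockCe]
  have hs : Primrec fun p : ℕ × List ℕ => p.1 + 1 := Primrec.succ.comp Primrec.fst
  have hbot' : PrimrecPred fun p : ℕ × List ℕ => ∃ k < p.1 + 1, BlockBot p.1 p.2.toFinset k :=
    (hbot.exists_mem_list.comp (Primrec.list_range.comp hs) Primrec.id).of_eq fun p => by simp
  have hce' : PrimrecPred fun p : ℕ × List ℕ => ∃ k < p.1 + 1, BlockCe p.1 p.2.toFinset k :=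
    (hce.exists_mem_list.comp (Primrec.list_range.comp hs) Primrec.id).of_eq fun p => by simp
  refine ⟨fun s l => l.map Formula.arg ++
    (if ∃ k < s + 1, BlockBot s l.toFinset k then [Formula.bot] else []) ++
    (if ∃ k < s + 1, BlockCe s l.toFinset k then [Formula.ce] else []), ?_, fun s l => ?_⟩
  · refine Primrec.to_comp ?_
    refine Primrec.list_append.comp (Primrec.list_append.comp
      (Primrec.list_map Primrec.snd (Primrec.sumInl.comp Primrec.snd)) ?_) ?_
    · exact Primrec.ite hbot' (Primrec.const _) (Primrec.const _)
    · exact Primrec.ite hce' (Primrec.const _) (Primrec.const _)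
  · unfold blockOp
    beta_reduce
    ext x
    split_ifs <;> simp [or_left_comm]

/-- The q-dialectical system built by the construction, with replacement function `i ↦ i + 2`. -/
noncomputable def blockSystem : QSystem where
  a := id
  a_computable := Computable.id
  a_injective := Function.injective_id
  H := blockOp
  H_approx :=
    { computable := blockOp_computable
      mono := fun _ _ _ h => blockOp_mono le_rfl h
      subset := fun _ _ _ h => arg_mem_blockOp.2 h
      step := fun n _ => blockOp_mono n.le_succ subset_rfl
      tarskian :=
        { monotony := fun _ _ h _ ⟨n, E, hE, hx⟩ => ⟨n, E, hE.trans h, hx⟩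
          inclusion := fun F i hi => ⟨0, {i}, by simpa using hi, arg_mem_blockOp.2 (by simp)⟩
          iteration := fun F => by
            have : {i | Formula.arg i ∈ limitOp blockOp F} = F := by
              ext i
              constructor
              · rintro ⟨n, E, hE, hx⟩
                exact hE (arg_mem_blockOp.1 hx)
              · intro hi
                exact ⟨0, {i}, by simpa using hi, arg_mem_blockOp.2 (by simp)⟩
            rw [this] } }
  r := fun i => i + 2
  r_computable := (Primrec.nat_add.comp Primrec.id (Primrec.const 2)).to_comp
  r_acyclic := fun n hn i => by
    have : ∀ m, (fun i => i + 2)^[m] i = i + 2 * m := fun m => by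
      induction m with
      | zero => rfl
      | succ m ih => rw [Function.iterate_succ_apply', ih]; ring
    rw [this]; omega

theorem blockSystem_r_iterate (m i : ℕ) : blockSystem.r^[m] i = i + 2 * m := by
  induction m with
  | zero => rfl
  | succ m ih => rw [Function.iterate_succ_apply', ih]; change i + 2 * m + 2 = _; ring

theorem blockSystem_bot {s : ℕ} {F : Finset ℕ} :
    Formula.bot ∈ blockSystem.H s F ↔ ∃ k, BlockBot s F k := bot_mem_blockOp

theorem blockSystem_ce {s : ℕ} {F : Finset ℕ} :
    Formula.ce ∈ blockSystem.H s F ↔ ∃ k, BlockCe s F k := ce_mem_blockOp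

theorem BlockBot.conflict {s k : ℕ} {F : Finset ℕ} (h : BlockBot s F k) :
    blockSystem.Conflict s F := Or.inl (blockSystem_bot.2 ⟨k, h⟩)

theorem BlockCe.conflict {s k : ℕ} {F : Finset ℕ} (h : BlockCe s F k) :
    blockSystem.Conflict s F := Or.inr (blockSystem_ce.2 ⟨k, h⟩)

/-- A conflict that is caused by one more argument is a conflict of the block of this argument. -/
theorem blockBot_of_insert {s y : ℕ} {F : Finset ℕ} (hF : ¬ blockSystem.Conflict s F)
    (h : Formula.bot ∈ blockSystem.H s (insert y F)) : BlockBot s (insert y F) (y / 3) := by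
  obtain ⟨k, hk⟩ := blockSystem_bot.1 h
  by_cases hy : y / 3 = k
  · rwa [hy]
  · refine absurd (BlockBot.conflict (hk.mono le_rfl fun i hi hik => ?_)) hF
    rcases Finset.mem_insert.1 hi with rfl | hi
    exacts [absurd hik hy, hi]

theorem blockCe_of_insert {s y : ℕ} {F : Finset ℕ} (hF : ¬ blockSystem.Conflict s F)
    (h : Formula.ce ∈ blockSystem.H s (insert y F)) : y % 3 = 0 ∧ (st s (y / 3)).ce = true := by
  obtain ⟨k, hk1, hk2⟩ := blockSystem_ce.1 h
  rcases Finset.mem_insert.1 hk2 with rfl | hi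
  · exact ⟨by omega, by rwa [show 3 * k / 3 = k by omega]⟩
  · exact absurd (BlockCe.conflict ⟨hk1, hi⟩) hF

theorem blockSystem_not_conflict_empty (s : ℕ) : ¬ blockSystem.Conflict s ∅ := by
  rintro (h | h)
  · obtain ⟨k, hk⟩ := blockSystem_bot.1 h
    simp only [BlockBot, Finset.notMem_empty, decide_false] at hk
    revert hk
    generalize st s k = e
    revert e; decide
  · obtain ⟨k, hk⟩ := blockSystem_ce.1 h
    simp [BlockCe] at hk

theorem blockSystem_run_ne_nil (s : ℕ) : blockSystem.run (s + 1) ≠ [] := by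
  rw [QSystem.run_succ]
  rcases blockSystem.next_cases s (blockSystem.run s) with
    ⟨_, h⟩ | ⟨h, _⟩ | ⟨i, y, _, _, ⟨_, h⟩ | ⟨_, _, h⟩⟩
  · simp [h]
  · exact absurd h (blockSystem_not_conflict_empty s)
  · simp [h]
  · simp [h]

/-- The system is loopless: only first arguments of blocks are ever replaced, and then by third
ones, so that an entry is revised at most twice as long as its predecessors do not change. -/
theorem blockSystem_loopless : blockSystem.Loopless := by
  intro j
  induction j using Nat.strong_induction_on with
  | _ j ih =>
    have : ∃ X : ℕ → Option ℕ, ∀ i < j, blockSystem.HasLimit i (X i) := by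
      choose! X hX using ih
      exact ⟨X, hX⟩
    obtain ⟨X, hX⟩ := this
    obtain ⟨t, ht⟩ := QSystem.exists_stable_prefix hX
    have hstep : ∀ s, t ≤ s → _ := fun s hs => QSystem.getElem?_succ_of_stable (ht s hs)
      (ht (s + 1) (by omega)) (Or.inr (blockSystem_run_ne_nil s))
    have hnc : ∀ s, t ≤ s → _ := fun s hs => QSystem.not_conflict_of_stable (ht s hs)
      (ht (s + 1) (by omega)) (Or.inr (blockSystem_run_ne_nil s))
    have hlen : ∀ s, t ≤ s → ((blockSystem.run s).take j).length = j := by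
      intro s hs
      rw [List.length_take, min_eq_left]
      rcases Nat.eq_zero_or_pos j with rfl | hpos
      · exact Nat.zero_le _
      · have := (List.getElem?_eq_some_iff.1 (ht s hs (j - 1) (by omega))).1
        omega
    have hlast : ∀ s, t ≤ s → ∀ x, ((blockSystem.run s).take j ++ [x])[j]? = some x := by
      intro s hs x
      rw [List.getElem?_append_right (hlen s hs).le, hlen s hs]
      simp
    let g : Option (Option ℕ) → ℕ := fun x =>
      x.elim 0 fun x => x.elim 3 fun y => if y % 3 = 0 then 1 else 2
    have hg : ∀ x, g x ≤ 3 := by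
      rintro (_ | _ | y) <;> simp only [g, Option.elim] <;> (try split_ifs) <;> omega
    have hmono : ∀ s, t ≤ s → (blockSystem.run s)[j]? = (blockSystem.run (s + 1))[j]? ∨
        g (blockSystem.run s)[j]? < g (blockSystem.run (s + 1))[j]? := by
      intro s hs
      rcases hstep s hs with ⟨e, e'⟩ | ⟨x, e, e'⟩ | ⟨y, e, e'⟩
      · right
        rw [e, e']
        simp only [g, Option.elim]; split_ifs <;> omega
      · left; rw [e, e']
      · right
        rcases e' with ⟨_, e'⟩ | ⟨_, hce, e'⟩
        · rw [e, e', hlast s hs]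
          simp only [g, Option.elim]; split_ifs <;> omega
        · rw [e, e', hlast s hs]
          have h3 := (blockCe_of_insert (hnc s hs) hce).1
          have hr : blockSystem.r y = y + 2 := rfl
          simp only [g, Option.elim, h3, hr]
          rw [if_pos trivial, if_neg (by omega)]; omega
    obtain ⟨u, hu, hconst⟩ := exists_eventually_const
      (f := fun s => g (blockSystem.run s)[j]?) (s₀ := t + 1)
      (fun s hs => by
        rcases hmono s (by omega) with h | h
        · rw [h]
        · exact h.le) (fun s => hg _)
    obtain ⟨x, hx⟩ : ∃ x, (blockSystem.run u)[j]? = some x := by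
      obtain ⟨v, rfl⟩ : ∃ v, u = v + 1 := ⟨u - 1, by omega⟩
      rcases hstep v (by omega) with ⟨_, e'⟩ | ⟨x, e, e'⟩ | ⟨y, e, ⟨_, e'⟩ | ⟨_, _, e'⟩⟩
      · exact ⟨_, e'⟩
      · exact ⟨_, e'⟩
      · exact ⟨none, by rw [e', hlast v (by omega)]⟩
      · exact ⟨some (blockSystem.r y), by rw [e', hlast v (by omega)]⟩
    refine ⟨x, u, fun s hs => ?_⟩
    induction s, hs using Nat.le_induction with
    | base => exact hx
    | succ s hs ih =>
      rcases hmono s (by omega) with h | h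
      · rw [← h]; exact ih
      · have h1 := hconst s hs
        have h2 := hconst (s + 1) (by omega)
        omega

/-! ### The limiting beliefs of the system -/

/-- As long as a block `e` is freed, its last argument is believed whenever the run has passed
beyond a later block. -/
theorem believed_of_freed {s e l : ℕ} {d : Bool} (he : st s e = Status.freed d) (hel : e < l)
    (ih : 3 * l < (blockSystem.run s).length →
      (blockSystem.run s)[3 * e + 2]? = some (some (3 * e + 2)))
    (hl : 3 * l < (blockSystem.run (s + 1)).length) :
    (blockSystem.run (s + 1))[3 * e + 2]? = some (some (3 * e + 2)) := by
  rw [QSystem.run_succ] at hl ⊢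
  rcases blockSystem.next_cases s (blockSystem.run s) with
    ⟨hn, h⟩ | ⟨_, h⟩ | ⟨i, y, hi, _, h⟩
  · rw [h] at hl ⊢
    simp only [List.length_append, List.length_singleton] at hl
    have hlt : 3 * e + 2 < (blockSystem.run s).length := by omega
    rw [List.getElem?_append_left hlt]
    obtain ⟨m, h1, h2⟩ := blockSystem.certified_run s (3 * e + 2) _
      (List.getElem?_eq_getElem hlt)
    have hsub : ran ((blockSystem.run s).take (3 * e + 2)) ⊆ ran (blockSystem.run s) := by
      intro i hi
      rw [mem_ran] at hi ⊢
      exact List.mem_of_mem_take hi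
    have hn' : ¬ blockSystem.Conflict s (ran ((blockSystem.run s).take (3 * e + 2))) :=
      fun h => hn (h.mono le_rfl hsub)
    have hm : m = 0 := by
      by_contra hm
      have := (blockCe_of_insert hn' (h1 0 (by omega))).1
      simp only [Function.iterate_zero, id] at this
      omega
    subst hm
    rcases h2 with h2 | ⟨_, h2⟩
    · rw [List.getElem?_eq_getElem hlt, h2]; rfl
    · -- the last argument of a freed block does not cause a conflict
      exfalso
      have hb := blockBot_of_insert hn' h2
      simp only [Function.iterate_zero, id, show (3 * e + 2) / 3 = e by omega, BlockBot, he] at hb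
      refine hn' (BlockBot.conflict (k := e) ?_)
      have key : ∀ d u v w w', (Status.freed d).bot u v w = true →
          (Status.freed d).bot u v w' = true := by decide
      have := key _ _ _ _ (decide (3 * e + 2 ∈ ran ((blockSystem.run s).take (3 * e + 2)))) hb
      simpa [BlockBot, he] using this
  · rw [h] at hl; simp at hl
  · have hil : i < (blockSystem.run s).length := (List.getElem?_eq_some_iff.1 hi).1
    have hli : 3 * l ≤ i := by
      rcases h with ⟨_, h⟩ | ⟨_, _, h⟩ <;> rw [h] at hl <;> simp at hl <;> omega
    have := ih (by omega)
    rcases h with ⟨_, h⟩ | ⟨_, _, h⟩ <;>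
      rw [h, List.getElem?_append_left (by simp; omega), List.getElem?_take, if_pos (by omega),
        this]

theorem Status.trans_freed {e f f' : Status} {b n d : Bool}
    (h : trans e f b = some (freed d, f', n)) : n = true ∨ e = freed d := by
  have key : ∀ e f b, ∀ z ∈ trans e f b, ∀ d, z.1 = freed d → z.2.2 = true ∨ e = freed d := by
    intro e f b z hz
    cases e <;> cases f <;> simp only [trans, Option.mem_def, reduceCtorEq, Option.some.injEq] at hz
      <;> subst hz <;> decide +revert
  exact key e f b _ h d rfl

theorem Status.trans_excised {e f e' f' : Status} {b n : Bool}
    (h : trans e f b = some (e', f', n)) : e' ≠ excised ∧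
      (f' = excised → f = excised ∨ ∃ d, e = freed d ∧ e' = spent d) := by
  have key : ∀ e f b, ∀ z ∈ trans e f b, z.1 ≠ excised ∧
      (z.2.1 = excised → f = excised ∨ ∃ d, e = freed d ∧ z.1 = spent d) := by
    intro e f b z hz
    cases e <;> cases f <;> simp only [trans, Option.mem_def, reduceCtorEq, Option.some.injEq] at hz
      <;> subst hz <;> decide +revert
  exact key e f b _ h

theorem st_succ_of_spent {s e : ℕ} {d : Bool} (h : st s e = Status.spent d) :
    st (s + 1) e = Status.spent d := by
  rcases st_below_succ s e with h' | ⟨h', _⟩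
  · rw [← h', h]
  · rw [h] at h'
    have := (st (s + 1) e).rank_le
    have h3 : (Status.spent d).rank = 3 := rfl
    omega

/-- The relation between the construction and the run. While the first block `e` of a requirement is
freed, its last argument is believed as soon as the run reaches the second block. When the second
block is excised, `e` is spent, and therefore the run is cut before the second block as long as
the first argument of the second block is represented by its replacement. -/
theorem freed_and_excised (s : ℕ) :
    (∀ (c : ℕ) (ρ : Record) (d : Bool), (stage s).2[c]? = some ρ → st s ρ.1 = Status.freed d →
      3 * ρ.2.1 < (blockSystem.run s).length →
        (blockSystem.run s)[3 * ρ.1 + 2]? = some (some (3 * ρ.1 + 2))) ∧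
    (∀ k, st s k = Status.excised → ∃ e < k, ∃ d, st s e = Status.spent d ∧
      ((blockSystem.run s)[3 * k]? = some (some (3 * k + 2)) →
        (blockSystem.run s)[3 * e + 2]? = some (some (3 * e + 2)))) := by
  induction s with
  | zero =>
    refine ⟨by simp [stage], fun k hk => ?_⟩
    exfalso
    rcases Nat.eq_zero_or_pos k with rfl | hpos
    · rw [(goodStage 0).zero] at hk; simp at hk
    · rw [st_of_lt hpos] at hk; simp at hk
  | succ s ih =>
    obtain ⟨iha, ihb⟩ := ih
    have hlt : ∀ (c : ℕ) (ρ : Record) (d : Bool), (stage s).2[c]? = some ρ →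
        st s ρ.1 = Status.freed d → ρ.1 < ρ.2.1 := by
      intro c ρ d hρ hd
      rcases ((goodStage s).good c ρ hρ).2.2.2 with ⟨_, h⟩ | ⟨h, _⟩
      · rw [hd] at h; simp at h
      · exact h
    have hR : ∀ (c : ℕ) (ρ : Record) (d : Bool), (stage s).2[c]? = some ρ →
        st s ρ.1 = Status.freed d → 3 * ρ.2.1 < (blockSystem.run (s + 1)).length →
        (blockSystem.run (s + 1))[3 * ρ.1 + 2]? = some (some (3 * ρ.1 + 2)) :=
      fun c ρ d hρ hd => believed_of_freed hd (hlt c ρ d hρ hd) (iha c ρ d hρ hd)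
    refine ⟨fun c τ d hτ hd => ?_, fun k hk => ?_⟩
    · rcases h : action s (stage s) with _ | ⟨ρ, q⟩
      · rw [st_succ_of_none h] at hd
        rcases getElem?_stack_of_none h hτ with hτ | ⟨_, rfl⟩
        · exact hR c τ d hτ hd
        · rw [st_of_lt (by simp)] at hd; simp at hd
      · rcases getElem?_stack_of_some h hτ with ⟨hc, hτ⟩ | ⟨_, rfl⟩
        · rw [(goodStage s).st_succ_of_le h hc hτ ((goodStage s).good _ _ hτ).2.1] at hd
          exact hR c τ d hτ hd
        · rw [(goodStage s).st_succ h, if_pos rfl] at hd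
          obtain ⟨hρ, v, _, hv⟩ := action_eq_some.1 h
          rcases Status.trans_freed (d := d) (f' := q.2.1) (n := q.2.2) (by rw [hv, ← hd]) with
            hq | hq
          · intro hl
            have := blockSystem.length_run_le (s + 1)
            simp only [hq, cond_true] at hl
            omega
          · rcases hq2 : q.2.2 with _ | _
            · exact hR _ ρ d hρ hq
            · intro hl
              have := blockSystem.length_run_le (s + 1)
              simp only [cond_true] at hl
              omega
    · by_cases hk' : st s k = Status.excised
      · obtain ⟨e, hek, d, hd, hrun⟩ := ihb k hk'
        refine ⟨e, hek, d, st_succ_of_spent hd, ?_⟩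
        rw [QSystem.run_succ]
        rcases blockSystem.next_cases s (blockSystem.run s) with
          ⟨_, h⟩ | ⟨_, h⟩ | ⟨i, y, hi, _, h⟩
        · rw [h, List.getElem?_append]
          split_ifs with hl
          · intro hp
            rw [List.getElem?_append_left (by omega)]
            exact hrun hp
          · intro hp
            have := List.mem_of_getElem? hp
            have hl' : (blockSystem.run s).length = 3 * k := by
              have := (List.getElem?_eq_some_iff.1 hp).1
              simp at this; omega
            simp [hl'] at this
        · rw [h]; simp
        · have hil : i < (blockSystem.run s).length := (List.getElem?_eq_some_iff.1 hi).1
          intro hp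
          have hx : ∀ x, blockSystem.next s (blockSystem.run s) =
              (blockSystem.run s).take i ++ [x] →
              x = some (3 * k + 2) ∧ i = 3 * k ∨
                blockSystem.next s (blockSystem.run s) = (blockSystem.run s).take i ++ [x] ∧
                3 * k < i ∧ (blockSystem.run s)[3 * k]? = some (some (3 * k + 2)) := by
            intro x hx
            rw [hx, List.getElem?_append] at hp
            have hmin : ((blockSystem.run s).take i).length = i := by simpa using hil.le
            rw [hmin] at hp
            split_ifs at hp with hki
            · rw [List.getElem?_take, if_pos hki] at hp
              exact Or.inr ⟨hx, hki, hp⟩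
            · have hz : 3 * k - i = 0 := by
                have := (List.getElem?_eq_some_iff.1 hp).1
                simp at this; omega
              rw [hz] at hp
              exact Or.inl ⟨by simpa using hp, by omega⟩
          have hcut : ∀ x, blockSystem.next s (blockSystem.run s) =
              (blockSystem.run s).take i ++ [x] → 3 * k < i →
              (blockSystem.run s)[3 * k]? = some (some (3 * k + 2)) →
              (blockSystem.next s (blockSystem.run s))[3 * e + 2]? = some (some (3 * e + 2)) := by
            intro x hx hki hp
            rw [hx, List.getElem?_append_left (by simp; omega), List.getElem?_take,
              if_pos (by omega), hrun hp]
          rcases h with ⟨_, h⟩ | ⟨hb, _, h⟩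
          · rcases hx _ h with ⟨h', _⟩ | ⟨h', hki, hp⟩
            · simp at h'
            · exact hcut _ h' hki hp
          · rcases hx _ h with ⟨h', rfl⟩ | ⟨h', hki, hp⟩
            · -- the first argument of an excised block is not replaced any more
              have hy : y = 3 * k := by
                change some (y + 2) = _ at h'
                simpa using h'
              refine absurd (blockSystem_bot.2 ⟨k, ?_⟩) hb
              simp [BlockBot, hk', hy, Status.bot]
            · exact hcut _ h' hki hp
      · rcases h : action s (stage s) with _ | ⟨ρ, q⟩
        · rw [st_succ_of_none h] at hk; exact absurd hk hk'
        · have hst := (goodStage s).st_succ h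
          obtain ⟨hρ, v, _, hv⟩ := action_eq_some.1 h
          obtain ⟨hne, hex⟩ := Status.trans_excised (e' := q.1) (f' := q.2.1) (n := q.2.2) hv
          rw [hst] at hk
          split_ifs at hk with h1 h2
          · exact absurd hk hne
          · obtain ⟨h20, h2⟩ := h2
            rcases hex hk with hex | ⟨d, hd, hd'⟩
            · rw [h2] at hk'; exact absurd hex hk'
            · have := hlt _ ρ d hρ hd
              refine ⟨ρ.1, by omega, d, by rw [hst, if_pos rfl, hd'], fun hp => ?_⟩
              exact hR _ ρ d hρ hd (by rw [← h2]; exact (List.getElem?_eq_some_iff.1 hp).1)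
          · exact absurd hk hk'

/-- The limit of the position `i`. -/
noncomputable def limitEntry (i : ℕ) : Option ℕ := (blockSystem_loopless i).choose

theorem hasLimit_limitEntry (i : ℕ) : blockSystem.HasLimit i (limitEntry i) :=
  (blockSystem_loopless i).choose_spec

theorem limitEntry_cases (j : ℕ) :
    limitEntry j = some j ∨
    (limitEntry j = none ∧ ∃ s, BlockBot s (insert j (QSystem.limRan limitEntry j)) (j / 3)) ∨
    (j % 3 = 0 ∧ (finalSt (j / 3)).ce = true ∧ (limitEntry j = some (j + 2) ∨
      limitEntry j = none ∧
        ∃ s, BlockBot s (insert (j + 2) (QSystem.limRan limitEntry j)) (j / 3))) := by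
  obtain ⟨m, s, h1, h2⟩ := QSystem.certified_limits hasLimit_limitEntry j
  have hn : ¬ blockSystem.Conflict s (QSystem.limRan limitEntry j) :=
    QSystem.not_conflict_of_limits hasLimit_limitEntry s fun i hi => by
      obtain ⟨j, _, h⟩ := QSystem.mem_limRan.1 hi
      exact ⟨j, h⟩
  simp only [blockSystem_r_iterate] at h1 h2
  have hce : ∀ i < m, (j + 2 * i) % 3 = 0 ∧ (st s ((j + 2 * i) / 3)).ce = true :=
    fun i hi => blockCe_of_insert hn (h1 i hi)
  have hm : m < 2 := by
    by_contra hm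
    have := hce 0 (by omega)
    have := hce 1 (by omega)
    omega
  interval_cases m
  · rcases h2 with h2 | ⟨h2, h3⟩
    · exact Or.inl h2
    · exact Or.inr (Or.inl ⟨h2, s, blockBot_of_insert hn h3⟩)
  · have h0 := hce 0 (by omega)
    simp only [mul_zero, add_zero] at h0
    obtain ⟨t, ht⟩ := exists_forall_st_eq (j / 3)
    refine Or.inr (Or.inr ⟨h0.1, ?_, ?_⟩)
    · rw [← ht (max s t) (le_max_right _ _)]
      exact ce_st_mono (le_max_left _ _) h0.2
    · rcases h2 with h2 | ⟨h2, h3⟩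
      · exact Or.inl h2
      · have := blockBot_of_insert hn h3
        rw [show (j + 2 * 1) / 3 = j / 3 by omega] at this
        exact Or.inr ⟨h2, s, this⟩

theorem eq_of_limitEntry_eq_some {i j : ℕ} (h : limitEntry j = some i) :
    i = j ∨ j % 3 = 0 ∧ i = j + 2 := by
  rcases limitEntry_cases j with h' | ⟨h', _⟩ | ⟨h0, _, h' | ⟨h', _⟩⟩ <;> rw [h] at h' <;>
    simp at h'
  · exact Or.inl h'
  · exact Or.inr ⟨h0, h'⟩

theorem limitEntry_ne_of_excised {k : ℕ} (hk : finalSt k = Status.excised) :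
    limitEntry (3 * k) ≠ some (3 * k + 2) := by
  intro h
  obtain ⟨t, ht⟩ := exists_forall_st_eq k
  obtain ⟨u, hu⟩ := QSystem.exists_stable_prefix (k := 3 * k + 1)
    fun j _ => hasLimit_limitEntry j
  obtain ⟨e, hek, d, hd, hrun⟩ := (freed_and_excised (max t u)).2 k
    (by rw [ht _ (le_max_left _ _), hk])
  have h1 := hu _ (le_max_right t u)
  have h2 := hrun (by rw [h1 (3 * k) (by omega), h])
  rw [h1 (3 * e + 2) (by omega)] at h2
  refine QSystem.not_conflict_of_limits hasLimit_limitEntry (max t u) (F := {3 * e + 2}) ?_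
    (BlockBot.conflict (k := e) ?_)
  · intro i hi
    rw [Finset.mem_singleton] at hi
    exact ⟨3 * e + 2, by rw [hi]; simpa using h2⟩
  · simp [BlockBot, hd, Status.bot]

/-- A block stabilizes in the set of its accepted arguments. The truth values `u, v, w` tell
whether the three positions of the block keep their arguments, and `z` whether the first position
is taken by its replacement, the last argument. -/
theorem Status.accepted_eq (e : Status) (u v w z : Bool)
    (h0 : u = true ∨ e.bot true false false = true ∨
      e.ce = true ∧ (z = true ∨ e.bot false false true = true))
    (hz : (u && z) = false) (h1 : v = true ∨ e.bot u true z = true)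
    (h2 : w = true ∨ e.bot u v true = true) (h3 : e.bot u v (w || z) = false)
    (h4 : (e.ce && u) = false) (h5 : e = excised → z = false) :
    e.accepted = (u, v, w || z) := by
  cases e with
  | freed b | spent b =>
    cases b <;> cases u <;> cases v <;> cases w <;> cases z <;> simp_all [bot, ce, accepted]
  | _ => cases u <;> cases v <;> cases w <;> cases z <;> simp_all [bot, ce, accepted]

theorem accepted_finalSt (k : ℕ) : (finalSt k).accepted =
    (decide (limitEntry (3 * k) = some (3 * k)), decide (limitEntry (3 * k + 1) = some (3 * k + 1)),
      decide (limitEntry (3 * k + 2) = some (3 * k + 2)) ||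
        decide (limitEntry (3 * k) = some (3 * k + 2))) := by
  obtain ⟨t, ht⟩ := exists_forall_st_eq k
  have hbot : ∀ s F, BlockBot s F k → (finalSt k).bot (decide (3 * k ∈ F))
      (decide (3 * k + 1 ∈ F)) (decide (3 * k + 2 ∈ F)) = true := by
    intro s F h
    rw [← ht (max s t) (le_max_right _ _)]
    exact h.mono (le_max_left _ _) fun i hi _ => hi
  have hmem : ∀ i j, i / 3 = k → (i ∈ QSystem.limRan limitEntry j ↔
      i < j ∧ limitEntry i = some i ∨ i = 3 * k + 2 ∧ 3 * k < j ∧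
        limitEntry (3 * k) = some (3 * k + 2)) := by
    intro i j hi
    rw [QSystem.mem_limRan]
    constructor
    · rintro ⟨l, hl, h⟩
      rcases eq_of_limitEntry_eq_some h with rfl | ⟨h0, rfl⟩
      · exact Or.inl ⟨hl, h⟩
      · obtain rfl : l = 3 * k := by omega
        exact Or.inr ⟨rfl, hl, h⟩
    · rintro (⟨h, h'⟩ | ⟨rfl, h, h'⟩)
      · exact ⟨i, h, h'⟩
      · exact ⟨3 * k, h, h'⟩
  have hm0 := fun j => hmem (3 * k) j (by omega)
  have hm1 := fun j => hmem (3 * k + 1) j (by omega)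
  have hm2 := fun j => hmem (3 * k + 2) j (by omega)
  have hlim : ∀ j, ∀ i ∈ QSystem.limRan limitEntry j, ∃ l, limitEntry l = some i := fun j i hi => by
    obtain ⟨l, _, h⟩ := QSystem.mem_limRan.1 hi
    exact ⟨l, h⟩
  have hcon := QSystem.not_conflict_of_limits hasLimit_limitEntry t (hlim (3 * k + 3))
  refine Status.accepted_eq _ _ _ _ _ ?_ ?_ ?_ ?_ ?_ ?_ ?_
  · simp only [decide_eq_true_eq]
    rcases limitEntry_cases (3 * k) with h | ⟨_, s, h⟩ | ⟨_, hce, h⟩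
    · exact Or.inl h
    · rw [show 3 * k / 3 = k by omega] at h
      have := hbot _ _ h
      simp only [Finset.mem_insert, hm0, hm1, hm2] at this
      exact Or.inr (Or.inl (by simpa using this))
    · rw [show 3 * k / 3 = k by omega] at hce h
      refine Or.inr (Or.inr ⟨hce, h.imp_right ?_⟩)
      rintro ⟨_, s, h⟩
      have := hbot _ _ h
      simp only [Finset.mem_insert, hm0, hm1, hm2] at this
      simpa using this
  · by_contra h
    simp at h
    rw [h.1] at h
    simp at h
  · simp only [decide_eq_true_eq]
    rcases limitEntry_cases (3 * k + 1) with h | ⟨_, s, h⟩ | ⟨h, _⟩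
    · exact Or.inl h
    · rw [show (3 * k + 1) / 3 = k by omega] at h
      have := hbot _ _ h
      simp only [Finset.mem_insert, hm0, hm1, hm2] at this
      exact Or.inr (by simpa using this)
    · omega
  · simp only [decide_eq_true_eq]
    rcases limitEntry_cases (3 * k + 2) with h | ⟨_, s, h⟩ | ⟨h, _⟩
    · exact Or.inl h
    · rw [show (3 * k + 2) / 3 = k by omega] at h
      have := hbot _ _ h
      simp only [Finset.mem_insert, hm0, hm1, hm2] at this
      exact Or.inr (by simpa using this)
    · omega
  · by_contra h
    refine hcon (BlockBot.conflict (k := k) ?_)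
    unfold BlockBot
    rw [ht t le_rfl]
    simp only [hm0, hm1, hm2]
    simpa using h
  · by_contra h
    simp only [Bool.and_eq_true, decide_eq_true_eq, Bool.not_eq_false] at h
    refine hcon (BlockCe.conflict (k := k) ⟨by rw [ht t le_rfl]; exact h.1, ?_⟩)
    rw [hm0]
    exact Or.inl ⟨by omega, h.2⟩
  · intro h
    simpa using limitEntry_ne_of_excised h

theorem mem_beliefs_blockSystem (b : ℕ) :
    b ∈ blockSystem.beliefs ↔ (finalSt (b / 3)).mem (b % 3) = true := by
  have h : b ∈ blockSystem.beliefs ↔ ∃ j, limitEntry j = some b := by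
    constructor
    · rintro ⟨n, i, h, rfl⟩
      exact ⟨n, (hasLimit_limitEntry n).unique h⟩
    · rintro ⟨j, h⟩
      exact ⟨j, b, h ▸ hasLimit_limitEntry j, rfl⟩
  rw [h, Status.mem, accepted_finalSt]
  have hb : b = 3 * (b / 3) + b % 3 := (Nat.div_add_mod b 3).symm
  generalize b / 3 = k at hb
  generalize hr : b % 3 = r at hb
  have hr3 : r < 3 := by rw [← hr]; exact Nat.mod_lt _ (by omega)
  interval_cases r <;> simp <;> subst hb
  · refine ⟨fun ⟨j, h⟩ => ?_, fun h => ⟨_, h⟩⟩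
    rcases eq_of_limitEntry_eq_some h with h' | h'
    · rwa [← h'] at h
    · omega
  · refine ⟨fun ⟨j, h⟩ => ?_, fun h => ⟨_, h⟩⟩
    rcases eq_of_limitEntry_eq_some h with h' | h'
    · rwa [← h'] at h
    · omega
  · refine ⟨fun ⟨j, h⟩ => ?_, fun h => h.elim (fun h => ⟨_, h⟩) fun h => ⟨_, h⟩⟩
    rcases eq_of_limitEntry_eq_some h with h' | h'
    · exact Or.inl (by rwa [← h'] at h)
    · exact Or.inr (by rwa [show j = 3 * k by omega] at h)

/-! ### Belief sets of p-dialectical systems -/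

namespace QSystem

variable {Δ : QSystem}

/-- The `i`-th entry of the chain of replacements that starts in position `j`. -/
def chain (Δ : QSystem) (j i : ℕ) : ℕ := Δ.a (Δ.r^[i] j)

/-- The chain of position `j` enters `U` at its entry `m` for the first time. -/
def IsFirst (Δ : QSystem) (U : Set ℕ) (j m : ℕ) : Prop :=
  Δ.chain j m ∈ U ∧ ∀ i < m, Δ.chain j i ∉ U

theorem IsFirst.eq {U : Set ℕ} {j m n : ℕ} (hm : Δ.IsFirst U j m) (hn : Δ.IsFirst U j n) :
    m = n := by
  rcases lt_trichotomy m n with h | h | h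
  · exact absurd hm.1 (hn.2 m h)
  · exact h
  · exact absurd hn.1 (hm.2 n h)

theorem chain_add_of_eq {j j' m m' : ℕ} (h : Δ.chain j m = Δ.chain j' m') (i : ℕ) :
    Δ.chain j (m + i) = Δ.chain j' (m' + i) := by
  have h' := Δ.a_injective h
  unfold chain
  rw [add_comm m, add_comm m', Function.iterate_add_apply, Function.iterate_add_apply, h']

theorem chain_ne {j m : ℕ} (hm : 1 ≤ m) : Δ.chain j m ≠ Δ.a j :=
  fun h => Δ.r_acyclic m hm j (Δ.a_injective h)

/-- The string with the entry `r^[m j] j` in position `j` is the limit of a run without `⊥` that has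
the belief set `B`: position `j` holds the first entry of the chain of `j` that belongs to `B`, the
earlier entries are refuted by the beliefs held in earlier positions, and `B` is consistent. -/
structure IsLimitString (Δ : QSystem) (B : Set ℕ) (m : ℕ → ℕ) : Prop where
  exists_eq : ∀ b ∈ B, ∃ j, Δ.chain j (m j) = b
  isFirst : ∀ j, Δ.IsFirst B j (m j)
  refuted : ∀ j, ∀ i < m j, ∃ t, Formula.ce ∈ Δ.H t
    (insert (Δ.r^[i] j) ((Finset.range j).image fun l => Δ.r^[m l] l))
  consistent : ∀ t F, (∀ i ∈ F, Δ.a i ∈ B) → Formula.ce ∉ Δ.H t F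

theorem exists_isLimitString (hP : Δ.IsP) (hB : Δ.beliefs.Infinite) :
    ∃ m, Δ.IsLimitString Δ.beliefs m := by
  have hL : Δ.Loopless := by
    by_contra h
    exact hB (finite_beliefs_of_not_loopless h)
  choose X hX using hL
  have hbot : ∀ s F, Formula.bot ∉ Δ.H s F := fun s F h => hP ⟨s, F, Set.subset_univ _, h⟩
  choose m t hm using certified_limits hX
  have hXm : ∀ j, X j = some (Δ.r^[m j] j) := fun j => by
    rcases (hm j).2 with h | ⟨_, h⟩
    · exact h
    · exact absurd h (hbot _ _)
  have hlim : ∀ j, limRan X j = (Finset.range j).image fun l => Δ.r^[m l] l := fun j => by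
    ext i
    simp [mem_limRan, hXm]
  have hbel : ∀ b, b ∈ Δ.beliefs ↔ ∃ j, Δ.chain j (m j) = b := by
    intro b
    constructor
    · rintro ⟨n, i, h, rfl⟩
      have := (hX n).unique h
      rw [hXm] at this
      refine ⟨n, ?_⟩
      unfold chain
      congr 1
      simpa using this
    · rintro ⟨j, rfl⟩
      exact ⟨j, Δ.r^[m j] j, hXm j ▸ hX j, rfl⟩
  have hcon : ∀ t F, (∀ i ∈ F, Δ.a i ∈ Δ.beliefs) → Formula.ce ∉ Δ.H t F := by
    intro t F hF hce
    refine not_conflict_of_limits hX t (F := F) (fun i hi => ?_) (Or.inr hce)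
    obtain ⟨j, hj⟩ := (hbel _).1 (hF i hi)
    exact ⟨j, by rw [hXm, Δ.a_injective hj]⟩
  have hkill : ∀ j, ∀ i < m j, Formula.ce ∈ Δ.H (t j)
      (insert (Δ.r^[i] j) ((Finset.range j).image fun l => Δ.r^[m l] l)) := by
    intro j i hi
    have := (hm j).1 i hi
    rwa [hlim] at this
  refine ⟨m, fun b => (hbel b).1, fun j => ⟨(hbel _).2 ⟨j, rfl⟩, fun i hi hmem => ?_⟩,
    fun j i hi => ⟨t j, hkill j i hi⟩, hcon⟩
  refine hcon _ _ (fun y hy => ?_) (hkill j i hi)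
  rcases Finset.mem_insert.1 hy with rfl | hy
  · exact hmem
  · obtain ⟨l, _, rfl⟩ := Finset.mem_image.1 hy
    exact (hbel _).2 ⟨l, rfl⟩

end QSystem

/-! ### Computable predicates -/

section Computable

variable {α β : Type*} [Primcodable α] [Primcodable β]

theorem _root_.ComputablePred.and {p q : α → Prop} (hp : ComputablePred p) (hq : ComputablePred q) :
    ComputablePred fun a => p a ∧ q a := by
  classical
  exact ((Primrec.and.to_comp.comp hp.decide hq.decide).of_eq fun a => by simp).computablePred

theorem _root_.ComputablePred.or {p q : α → Prop} (hp : ComputablePred p) (hq : ComputablePred q) :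
    ComputablePred fun a => p a ∨ q a := by
  classical
  exact ((Primrec.or.to_comp.comp hp.decide hq.decide).of_eq fun a => by simp).computablePred

theorem _root_.ComputablePred.comp {p : β → Prop} (hp : ComputablePred p) {f : α → β}
    (hf : Computable f) : ComputablePred fun a => p (f a) := by
  classical
  exact (hp.decide.comp hf).computablePred

theorem _root_.ComputablePred.eq [DecidableEq β] {f g : α → β} (hf : Computable f)
    (hg : Computable g) : ComputablePred fun a => f a = g a :=
  ((Primrec.eq (α := β)).decide.to_comp.comp hf hg).computablePred

theorem _root_.ComputablePred.lt {f g : α → ℕ} (hf : Computable f) (hg : Computable g) :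
    ComputablePred fun a => f a < g a :=
  (Primrec.nat_lt.decide.to_comp.comp hf hg).computablePred

/-- Computable predicates are closed under bounded universal quantification. -/
theorem _root_.ComputablePred.ball {p : α → ℕ → Prop} {f : α → ℕ} (hf : Computable f)
    (hp : ComputablePred fun z : α × ℕ => p z.1 z.2) :
    ComputablePred fun a => ∀ i < f a, p a i := by
  classical
  have h : Computable fun a => (Nat.rec true (fun i b => b && decide (p a i)) (f a) : Bool) :=
    Computable.nat_rec hf (Computable.const true)
      (Primrec.and.to_comp.comp (Computable.snd.comp Computable.snd)
        (hp.decide.comp (Computable.pair Computable.fst (Computable.fst.comp Computable.snd)))).to₂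
  refine (h.of_eq fun a => ?_).computablePred
  generalize f a = n
  induction n with
  | zero => simp
  | succ n ih =>
    simp only [ih]
    rw [← Bool.decide_and]
    congr 1
    simp only [Nat.lt_succ_iff_lt_or_eq, eq_iff_iff]
    constructor
    · rintro ⟨h1, h2⟩ i (hi | rfl)
      exacts [h1 i hi, h2]
    · exact fun h => ⟨fun i hi => h i (Or.inl hi), h n (Or.inr rfl)⟩

/-- Computable predicates are closed under bounded existential quantification. -/
theorem _root_.ComputablePred.bex {p : α → ℕ → Prop} {f : α → ℕ} (hf : Computable f)
    (hp : ComputablePred fun z : α × ℕ => p z.1 z.2) :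
    ComputablePred fun a => ∃ i < f a, p a i :=
  (ComputablePred.ball (p := fun a i => ¬ p a i) hf hp.not).not.of_eq fun a => by simp

end Computable

/-! ### Questions about an opponent -/

/-- The arguments accepted under an assignment of statuses to the blocks. -/
def believed (f : ℕ → Status) : Set ℕ := {y | (f (y / 3)).mem (y % 3) = true}

namespace QSystem

/-- The chain of position `j` enters `U` at its entry `m` for the first time, and up to this entry
stays below `N`. -/
def FirstHit (Δ : QSystem) (U : Set ℕ) (N j m : ℕ) : Prop :=
  (Δ.chain j m ∈ U ∧ Δ.chain j m < N) ∧ ∀ i < m, Δ.chain j i ∉ U ∧ Δ.chain j i < N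

/-- The chains of the first `l` positions enter `U` after fewer than `w` steps, and none of them
does so in `bad`. -/
def Avoids (Δ : QSystem) (U : Set ℕ) (N w : ℕ) (bad : List ℕ) (l : ℕ) : Prop :=
  ∀ j < l, ∃ m < w, Δ.FirstHit U N j m ∧ Δ.chain j m ∉ bad

/-- Some position holds `z` in the limit string for the belief set `U`, and no earlier position
holds `p` or `q`. The search is limited by `w` (positions and lengths of chains) and `N`
(arguments). -/
def HitsBefore (Δ : QSystem) (U : Set ℕ) (N w p q z : ℕ) : Prop :=
  ∃ j < w, Δ.Avoids U N w [p, q] j ∧ ∃ m < w, Δ.FirstHit U N j m ∧ Δ.chain j m = z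

/-- A finite subset of `U ∪ {y}` without `z` derives `ce`; it is coded by `w`. -/
def Refuted (Δ : QSystem) (U : Set ℕ) (N w y z : ℕ) : Prop :=
  Formula.ce ∈ Δ.H w.unpair.1 (Denumerable.ofNat (List ℕ) w.unpair.2).toFinset ∧
    ∀ i ∈ Denumerable.ofNat (List ℕ) w.unpair.2, (Δ.a i ∈ U ∨ Δ.a i = y) ∧ Δ.a i ≠ z ∧ Δ.a i < N

/-- Some position holds `x` in the limit string for the belief set `U`, no earlier position holds an
argument in `bad`, and the chain of this position goes on from `x` to `p` without meeting `V` in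
between. -/
def PassesTo (Δ : QSystem) (U V : Set ℕ) (N w x p : ℕ) (bad : List ℕ) : Prop :=
  ∃ j < w, Δ.Avoids U N w bad j ∧ ∃ m < w, (Δ.FirstHit U N j m ∧ Δ.chain j m = x) ∧
    ∃ n < w, (m < n ∧ Δ.chain j n = p) ∧ ∀ i < n, ¬ m < i ∨ (Δ.chain j i ∉ V ∧ Δ.chain j i < N)

/-- The chain of `e` meets `U` after `e`, in an argument different from `z`. -/
def Meets (Δ : QSystem) (U : Set ℕ) (N w e z : ℕ) : Prop :=
  ∃ i < w, ∃ m < w, (1 ≤ m ∧ Δ.a i = e ∧ Δ.chain i m ∈ U ∧ Δ.chain i m ≠ z) ∧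
    ∀ j < m + 1, Δ.chain i j < N

/-- The question that a requirement with blocks `k` and `l` asks about its opponent `Δ`, when the
statuses of the first blocks are listed in `β` (`x = (k, l, β)`): is `w` a witness for proceeding
with the answer `b`? With the first block `{e₀, e₀', e}` and the second block `{x, q, p}`, the
answer tells whether `e₀'` or `e₀` is to be given up for `e`, whether `q` or `p` comes first in the
limit string for the current beliefs, and whether `Δ` passes from `x` to `p` or refutes `q` without
`p`. -/
def Test (Δ : QSystem) (x : ℕ × ℕ × List Status) (w : ℕ) (b : Bool) : Prop :=
  (x.1 < x.2.2.length ∧ x.2.1 < x.2.2.length) ∧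
  ((x.2.2.getD x.1 Status.fresh = Status.fresh ∧ Δ.a w = 3 * x.1 + 2) ∨
  (x.2.2.getD x.1 Status.fresh = Status.guard ∧
    Δ.Meets (believed fun i => x.2.2.getD i Status.fresh) (3 * x.2.2.length) w (3 * x.1 + 2)
      (3 * x.1 + b.toNat)) ∨
  ((x.2.2.getD x.1 Status.fresh = Status.freed false ∨
      x.2.2.getD x.1 Status.fresh = Status.freed true) ∧
    ((x.2.2.getD x.2.1 Status.fresh = Status.fresh ∧
      Δ.HitsBefore (believed fun i => x.2.2.getD i Status.fresh) (3 * x.2.2.length) w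
        (3 * x.2.1 + 2) (3 * x.2.1 + 1) (3 * x.2.1 + 2 - b.toNat)) ∨
    (x.2.2.getD x.2.1 Status.fresh = Status.rival ∧
      Δ.Refuted (believed fun i => x.2.2.getD i Status.fresh) (3 * x.2.2.length) w
        (3 * x.2.1 + 2) (3 * x.2.1 + 1)) ∨
    (x.2.2.getD x.2.1 Status.fresh = Status.replaced ∧
      ((b = false ∧
        Δ.Refuted (believed fun i => x.2.2.getD i Status.fresh) (3 * x.2.2.length) w
          (3 * x.2.1 + 1) (3 * x.2.1 + 2)) ∨
      (b = true ∧
        Δ.PassesTo ((believed fun i => x.2.2.getD i Status.fresh) ∪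
            {y | y ∈ [3 * x.2.1, 3 * x.2.1 + 1]})
          ((believed fun i => x.2.2.getD i Status.fresh) ∪ {y | y ∈ [3 * x.2.1 + 1]})
          (3 * x.2.2.length) w (3 * x.2.1) (3 * x.2.1 + 2)
          [3 * x.2.1, 3 * x.2.1 + 1, 3 * x.2.1 + 2]))))) ∨
  ((x.2.2.getD x.1 Status.fresh = Status.spent false ∨
      x.2.2.getD x.1 Status.fresh = Status.spent true) ∧
    x.2.2.getD x.2.1 Status.fresh = Status.excised ∧
      Δ.Refuted (believed fun i => x.2.2.getD i Status.fresh) (3 * x.2.2.length) w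
        (3 * x.2.1 + 2) (3 * x.2.1 + 1)))

section Computable

variable (Δ : QSystem) {α : Type*} [Primcodable α]

theorem computable_chain {j i : α → ℕ} (hj : Computable j) (hi : Computable i) :
    Computable fun a => Δ.chain (j a) (i a) := by
  have h : Computable fun a => (Nat.rec (j a) (fun _ y => Δ.r y) (i a) : ℕ) :=
    Computable.nat_rec hi hj (Δ.r_computable.comp (Computable.snd.comp Computable.snd)).to₂
  refine Δ.a_computable.comp (h.of_eq fun a => ?_)
  generalize i a = n
  induction n with
  | zero => rfl
  | succ n ih => rw [Function.iterate_succ_apply', ← ih]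

theorem computablePred_mem_list {E : α → List ℕ} {y : α → ℕ} (hE : Computable E)
    (hy : Computable y) : ComputablePred fun a => y a ∈ E a := by
  classical
  exact (primrec_mem_list.decide.to_comp.comp hE hy).computablePred

/-- A family of sets with a uniformly computable membership relation. -/
def ComputableFamily (U : α → Set ℕ) : Prop :=
  ComputablePred fun z : α × ℕ => z.2 ∈ U z.1

theorem ComputableFamily.comp {α' : Type*} [Primcodable α'] {U : α → Set ℕ}
    (hU : ComputableFamily U) {f : α' → α} (hf : Computable f) :
    ComputableFamily fun a => U (f a) :=
  ComputablePred.comp hU (f := fun z : α' × ℕ => (f z.1, z.2))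
    (Computable.pair (hf.comp Computable.fst) Computable.snd)

theorem ComputableFamily.mem {U : α → Set ℕ} (hU : ComputableFamily U) {y : α → ℕ}
    (hy : Computable y) : ComputablePred fun a => y a ∈ U a :=
  ComputablePred.comp hU (f := fun a => (a, y a)) (Computable.pair Computable.id hy)

theorem ComputableFamily.union_list {U : α → Set ℕ} (hU : ComputableFamily U) {E : α → List ℕ}
    (hE : Computable E) : ComputableFamily fun a => U a ∪ {y | y ∈ E a} :=
  ComputablePred.or hU (computablePred_mem_list (hE.comp Computable.fst) Computable.snd)

theorem computableFamily_believed {β : α → List Status} (hβ : Computable β) :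
    ComputableFamily fun a => believed fun i => (β a).getD i Status.fresh := by
  have h3 : ∀ f : ℕ → ℕ → ℕ, Primrec₂ f → Computable fun z : α × ℕ => f z.2 3 := fun f hf =>
    (hf.comp Primrec.id (Primrec.const 3)).to_comp.comp Computable.snd
  have hst : Computable fun z : α × ℕ => (β z.1).getD (z.2 / 3) Status.fresh :=
    (Primrec.list_getD Status.fresh).to_comp.comp (hβ.comp Computable.fst) (h3 _ Primrec.nat_div)
  exact ComputablePred.eq (Status.primrec_mem.to_comp.comp hst (h3 _ Primrec.nat_mod))
    (Computable.const true)

variable {U V : α → Set ℕ} (hU : ComputableFamily U) (hV : ComputableFamily V)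
  {N w x y z j m : α → ℕ} (hN : Computable N) (hw : Computable w) (hx : Computable x)
  (hy : Computable y) (hz : Computable z) (hj : Computable j) (hm : Computable m)
  {bad : α → List ℕ} (hbad : Computable bad)

section
include hU hN hj hm

theorem computablePred_firstHit :
    ComputablePred fun a => Δ.FirstHit (U a) (N a) (j a) (m a) := by
  have hc := Δ.computable_chain hj hm
  have hc' : Computable fun p : α × ℕ => Δ.chain (j p.1) p.2 :=
    Δ.computable_chain (hj.comp Computable.fst) Computable.snd
  refine ((hU.mem hc).and (ComputablePred.lt hc hN)).and (ComputablePred.ball hm ?_)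
  exact ((hU.comp Computable.fst).mem hc').not.and (ComputablePred.lt hc' (hN.comp Computable.fst))

end

section
include hU hN hw hj hbad

theorem computablePred_avoids :
    ComputablePred fun a => Δ.Avoids (U a) (N a) (w a) (bad a) (j a) := by
  refine ComputablePred.ball hj (ComputablePred.bex (hw.comp Computable.fst) ?_)
  have h1 : Computable fun p : (α × ℕ) × ℕ => p.1.1 := Computable.fst.comp Computable.fst
  have h2 : Computable fun p : (α × ℕ) × ℕ => p.1.2 := Computable.snd.comp Computable.fst
  exact (Δ.computablePred_firstHit (hU.comp h1) (hN.comp h1) h2 Computable.snd).and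
    (computablePred_mem_list (hbad.comp h1) (Δ.computable_chain h2 Computable.snd)).not

end

section
include hU hN hw hx hy hz

theorem computablePred_hitsBefore :
    ComputablePred fun a => Δ.HitsBefore (U a) (N a) (w a) (x a) (y a) (z a) := by
  have hbad : Computable fun a => [x a, y a] :=
    Computable.list_cons.comp hx (Computable.list_cons.comp hy (Computable.const []))
  refine ComputablePred.bex hw ((Δ.computablePred_avoids (hU.comp Computable.fst)
    (hN.comp Computable.fst) (hw.comp Computable.fst) Computable.snd
    (hbad.comp Computable.fst)).and (ComputablePred.bex (hw.comp Computable.fst) ?_))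
  have h1 : Computable fun p : (α × ℕ) × ℕ => p.1.1 := Computable.fst.comp Computable.fst
  have h2 : Computable fun p : (α × ℕ) × ℕ => p.1.2 := Computable.snd.comp Computable.fst
  exact (Δ.computablePred_firstHit (hU.comp h1) (hN.comp h1) h2 Computable.snd).and
    (ComputablePred.eq (Δ.computable_chain h2 Computable.snd) (hz.comp h1))

end

section
include hU hN hw hy hz

theorem computablePred_refuted :
    ComputablePred fun a => Δ.Refuted (U a) (N a) (w a) (y a) (z a) := by
  classical
  obtain ⟨h, hh, hH⟩ := Δ.H_approx.computable
  have hF : Computable fun a => Denumerable.ofNat (List ℕ) (w a).unpair.2 :=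
    (Computable.ofNat (List ℕ)).comp (Computable.snd.comp (Computable.unpair.comp hw))
  have ht : Computable fun a => (w a).unpair.1 := Computable.fst.comp (Computable.unpair.comp hw)
  have hmem : PrimrecRel fun (l : List Formula) (i : Formula) => i ∈ l :=
    (PrimrecRel.exists_mem_list (Primrec.eq (α := Formula))).of_eq fun l i => by simp
  have h1 : ComputablePred fun a => Formula.ce ∈
      Δ.H (w a).unpair.1 (Denumerable.ofNat (List ℕ) (w a).unpair.2).toFinset := by
    refine (((hmem.decide.to_comp.comp (hh.comp ht hF)
      (Computable.const Formula.ce))).computablePred).of_eq fun a => ?_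
    rw [← hH, List.mem_toFinset]
  set F := fun a => Denumerable.ofNat (List ℕ) (w a).unpair.2
  have hget : Computable fun p : α × ℕ => Δ.a ((F p.1).getD p.2 0) :=
    Δ.a_computable.comp ((Primrec.list_getD 0).to_comp.comp (hF.comp Computable.fst) Computable.snd)
  have h2 : ComputablePred fun p : α × ℕ =>
      (Δ.a ((F p.1).getD p.2 0) ∈ U p.1 ∨ Δ.a ((F p.1).getD p.2 0) = y p.1) ∧
        ¬ Δ.a ((F p.1).getD p.2 0) = z p.1 ∧ Δ.a ((F p.1).getD p.2 0) < N p.1 :=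
    (((hU.comp Computable.fst).mem hget).or (ComputablePred.eq hget (hy.comp Computable.fst))).and
      ((ComputablePred.eq hget (hz.comp Computable.fst)).not.and
        (ComputablePred.lt hget (hN.comp Computable.fst)))
  refine h1.and ((ComputablePred.ball (p := fun a i =>
    (Δ.a ((F a).getD i 0) ∈ U a ∨ Δ.a ((F a).getD i 0) = y a) ∧
      ¬ Δ.a ((F a).getD i 0) = z a ∧ Δ.a ((F a).getD i 0) < N a)
    (Computable.list_length.comp hF) h2).of_eq fun a => ?_)
  change _ ↔ ∀ i ∈ F a, _
  generalize F a = F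
  rw [List.forall_mem_iff_getElem]
  refine forall_congr' fun i => forall_congr' fun hi => ?_
  rw [List.getD_eq_getElem _ _ hi]

end

section
include hU hN hw hy hz

theorem computablePred_meets :
    ComputablePred fun a => Δ.Meets (U a) (N a) (w a) (y a) (z a) := by
  have h1 : Computable fun p : (α × ℕ) × ℕ => p.1.1 := Computable.fst.comp Computable.fst
  have h2 : Computable fun p : (α × ℕ) × ℕ => p.1.2 := Computable.snd.comp Computable.fst
  have hc := Δ.computable_chain h2 Computable.snd
  refine ComputablePred.bex hw (ComputablePred.bex (hw.comp Computable.fst) (ComputablePred.and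
    ((ComputablePred.lt (Computable.const 0) Computable.snd).and
      ((ComputablePred.eq (Δ.a_computable.comp h2) (hy.comp h1)).and (((hU.comp h1).mem hc).and
        (ComputablePred.eq hc (hz.comp h1)).not)))
    (ComputablePred.ball (Computable.succ.comp Computable.snd) ?_)))
  exact ComputablePred.lt (Δ.computable_chain (h2.comp Computable.fst) Computable.snd)
    (hN.comp (h1.comp Computable.fst))

end

section
include hU hV hN hw hx hy hbad

theorem computablePred_passesTo :
    ComputablePred fun a => Δ.PassesTo (U a) (V a) (N a) (w a) (x a) (y a) (bad a) := by
  have h1 : Computable fun p : (α × ℕ) × ℕ => p.1.1 := Computable.fst.comp Computable.fst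
  have h2 : Computable fun p : (α × ℕ) × ℕ => p.1.2 := Computable.snd.comp Computable.fst
  have g1 : Computable fun p : ((α × ℕ) × ℕ) × ℕ => p.1.1.1 := h1.comp Computable.fst
  have g2 : Computable fun p : ((α × ℕ) × ℕ) × ℕ => p.1.1.2 := h2.comp Computable.fst
  have g3 : Computable fun p : ((α × ℕ) × ℕ) × ℕ => p.1.2 := Computable.snd.comp Computable.fst
  refine ComputablePred.bex hw ((Δ.computablePred_avoids (hU.comp Computable.fst)
    (hN.comp Computable.fst) (hw.comp Computable.fst) Computable.snd
    (hbad.comp Computable.fst)).and (ComputablePred.bex (hw.comp Computable.fst)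
    (ComputablePred.and ((Δ.computablePred_firstHit (hU.comp h1) (hN.comp h1) h2
      Computable.snd).and (ComputablePred.eq (Δ.computable_chain h2 Computable.snd) (hx.comp h1)))
    (ComputablePred.bex (hw.comp h1) (ComputablePred.and ((ComputablePred.lt g3 Computable.snd).and
      (ComputablePred.eq (Δ.computable_chain g2 Computable.snd) (hy.comp g1)))
      (ComputablePred.ball Computable.snd ?_))))))
  have hc := Δ.computable_chain (g2.comp Computable.fst)
    (Computable.snd (α := ((α × ℕ) × ℕ) × ℕ) (β := ℕ))
  exact (ComputablePred.lt (g3.comp Computable.fst) Computable.snd).not.or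
    (((hV.comp (g1.comp Computable.fst)).mem hc).not.and
      (ComputablePred.lt hc (hN.comp (g1.comp Computable.fst))))

end

theorem computablePred_test : ComputablePred
    fun p : (ℕ × ℕ × List Status) × ℕ × Bool => Δ.Test p.1 p.2.1 p.2.2 := by
  have hk : Computable fun p : (ℕ × ℕ × List Status) × ℕ × Bool => p.1.1 :=
    Computable.fst.comp Computable.fst
  have hl : Computable fun p : (ℕ × ℕ × List Status) × ℕ × Bool => p.1.2.1 :=
    Computable.fst.comp (Computable.snd.comp Computable.fst)
  have hβ : Computable fun p : (ℕ × ℕ × List Status) × ℕ × Bool => p.1.2.2 :=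
    Computable.snd.comp (Computable.snd.comp Computable.fst)
  have hw : Computable fun p : (ℕ × ℕ × List Status) × ℕ × Bool => p.2.1 :=
    Computable.fst.comp Computable.snd
  have hb : Computable fun p : (ℕ × ℕ × List Status) × ℕ × Bool => p.2.2 :=
    Computable.snd.comp Computable.snd
  have hb' : Computable fun p : (ℕ × ℕ × List Status) × ℕ × Bool => p.2.2.toNat :=
    (Primrec.dom_bool Bool.toNat).to_comp.comp hb
  have hlen := Computable.list_length.comp hβ
  have hN : Computable fun p : (ℕ × ℕ × List Status) × ℕ × Bool => 3 * p.1.2.2.length :=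
    Primrec.nat_mul.to_comp.comp (Computable.const 3) hlen
  have hlin : ∀ {f : (ℕ × ℕ × List Status) × ℕ × Bool → ℕ}, Computable f → ∀ c,
      Computable fun p => 3 * f p + c := fun hf c =>
    Primrec.nat_add.to_comp.comp (Primrec.nat_mul.to_comp.comp (Computable.const 3) hf)
      (Computable.const c)
  have hE := (Primrec.list_getD Status.fresh).to_comp.comp hβ hk
  have hX := (Primrec.list_getD Status.fresh).to_comp.comp hβ hl
  have hB := computableFamily_believed hβ
  have hEe := fun e => ComputablePred.eq hE (Computable.const e)
  have hXe := fun e => ComputablePred.eq hX (Computable.const e)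
  have hx := hlin hl 0
  have hq := hlin hl 1
  have hp := hlin hl 2
  have href := fun {y z : (ℕ × ℕ × List Status) × ℕ × Bool → ℕ} (hy : Computable y)
    (hz : Computable z) => Δ.computablePred_refuted hB hN hw hy hz
  have hlist1 := fun {f : (ℕ × ℕ × List Status) × ℕ × Bool → ℕ} (hf : Computable f) =>
    Computable.list_cons.comp hf (Computable.const [])
  refine ((ComputablePred.lt hk hlen).and (ComputablePred.lt hl hlen)).and ?_
  refine ((hEe Status.fresh).and (ComputablePred.eq (Δ.a_computable.comp hw) (hlin hk 2))).or ?_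
  refine ((hEe Status.guard).and (Δ.computablePred_meets hB hN hw (hlin hk 2)
    (Primrec.nat_add.to_comp.comp (hlin hk 0) hb'))).or ?_
  refine (((hEe (Status.freed false)).or (hEe (Status.freed true))).and ?_).or
    (((hEe (Status.spent false)).or (hEe (Status.spent true))).and
      ((hXe Status.excised).and (href hp hq)))
  refine ((hXe Status.fresh).and (Δ.computablePred_hitsBefore hB hN hw hp hq
    (Primrec.nat_sub.to_comp.comp hp hb'))).or ?_
  refine ((hXe Status.rival).and (href hp hq)).or ((hXe Status.replaced).and ?_)
  refine ((ComputablePred.eq hb (Computable.const false)).and (href hq hp)).or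
    ((ComputablePred.eq hb (Computable.const true)).and ?_)
  exact Δ.computablePred_passesTo (hB.union_list (Computable.list_cons.comp hx (hlist1 hq)))
    (hB.union_list (hlist1 hq)) hN hw hx hp
    (Computable.list_cons.comp hx (Computable.list_cons.comp hq (hlist1 hp)))

end Computable

/-- Some code searches for witnesses to the questions about `Δ`, and returns the answers. -/
theorem exists_code_test (Δ : QSystem) : ∃ c : Code,
    (∀ x v, v ∈ c.eval (Encodable.encode x) → ∃ w, Δ.Test x w v.bodd) ∧
    ∀ x w b, Δ.Test x w b → ∃ v, v ∈ c.eval (Encodable.encode x) := by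
  classical
  have htest : ComputablePred fun p : (ℕ × ℕ × List Status) × ℕ =>
      Δ.Test p.1 p.2.unpair.1 p.2.unpair.2.bodd := by
    have h2 : Computable fun p : (ℕ × ℕ × List Status) × ℕ => p.2.unpair :=
      Computable.unpair.comp Computable.snd
    exact Δ.computablePred_test.comp (f := fun p : (ℕ × ℕ × List Status) × ℕ =>
      (p.1, p.2.unpair.1, p.2.unpair.2.bodd)) (Computable.pair Computable.fst (Computable.pair
        (Computable.fst.comp h2) (Computable.nat_bodd.comp (Computable.snd.comp h2))))
  have hf : Partrec fun x : ℕ × ℕ × List Status =>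
      (Nat.rfind fun n => Part.some (decide (Δ.Test x n.unpair.1 n.unpair.2.bodd))).map
        fun n => n.unpair.2 :=
    (Partrec.rfind htest.decide.partrec.to₂).map
      ((Computable.snd.comp (Computable.unpair.comp Computable.snd)).to₂)
  obtain ⟨c, hc⟩ := Code.exists_code.1 hf
  have heval : ∀ x v, v ∈ c.eval (Encodable.encode x) ↔
      ∃ n ∈ Nat.rfind fun n => Part.some (decide (Δ.Test x n.unpair.1 n.unpair.2.bodd)),
        n.unpair.2 = v := by
    intro x v
    rw [hc]
    simp
  refine ⟨c, fun x v hv => ?_, fun x w b h => ?_⟩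
  · obtain ⟨n, hn, rfl⟩ := (heval x v).1 hv
    have := Nat.rfind_spec hn
    simp only [Part.mem_some_iff] at this
    exact ⟨_, of_decide_eq_true this.symm⟩
  · obtain ⟨n, hn, _⟩ := Nat.rfind_min'
      (p := fun n => decide (Δ.Test x n.unpair.1 n.unpair.2.bodd)) (m := Nat.pair w b.toNat) (by
        have : b.toNat.bodd = b := by cases b <;> rfl
        simpa [this] using h)
    exact ⟨_, (heval x _).2 ⟨n, hn, rfl⟩⟩

end QSystem

/-! ### The questions answered so far -/

/-- What the record `(k, l, t)` of a requirement says about its opponent `Δ` when the statuses are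
`f`: each change of status was caused by a positively answered question, asked about a list `β` of
statuses that differs from `f` in the blocks `k` and `l` at most. The list is not longer than `l`
for the question that preceded the choice of `l`. -/
structure History (Δ : QSystem) (f : ℕ → Status) (k l t : ℕ) : Prop where
  of_ne_fresh : f k ≠ Status.fresh → ∃ i, Δ.a i = 3 * k + 2
  of_ne_guard : f k ≠ Status.fresh → f k ≠ Status.guard → ∃ (β : List Status) (w : ℕ) (b : Bool),
    β.length ≤ l ∧ (∀ i < β.length, i ≠ k → β.getD i Status.fresh = f i) ∧
      β.getD k Status.fresh = Status.guard ∧ (f k = Status.freed b ∨ f k = Status.spent b) ∧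
        Δ.Meets (believed fun i => β.getD i Status.fresh) (3 * β.length) w (3 * k + 2)
          (3 * k + b.toNat)
  of_second : f l ≠ Status.fresh → ∃ (β : List Status) (w : ℕ) (b : Bool),
    β.length ≤ t + 1 ∧
      (∀ i < β.length, i ≠ k → i ≠ l → β.getD i Status.fresh = f i) ∧
        Δ.Test (k, l, β) w b ∧ Status.trans (β.getD k Status.fresh) (β.getD l Status.fresh) b =
          some (f k, f l, false)

theorem History.congr {Δ : QSystem} {f g : ℕ → Status} {k l t : ℕ} (h : History Δ f k l t)
    (hk : k ≤ t) (hl : l ≤ t) (hfg : ∀ i ≤ t, g i = f i) : History Δ g k l t := by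
  refine ⟨fun hg => h.of_ne_fresh (by rwa [← hfg k hk]), fun h1 h2 => ?_, fun h1 => ?_⟩
  · rw [hfg k hk] at h1 h2 ⊢
    obtain ⟨β, w, b, hβ, ha, h'⟩ := h.of_ne_guard h1 h2
    exact ⟨β, w, b, hβ, fun i hi hik => by rw [ha i hi hik, hfg i (by omega)], h'⟩
  · rw [hfg l hl] at h1 ⊢
    rw [hfg k hk]
    obtain ⟨β, w, b, hβ, ha, h'⟩ := h.of_second h1
    exact ⟨β, w, b, hβ, fun i hi hik hil => by rw [ha i hi hik hil, hfg i (by omega)], h'⟩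

theorem Status.trans_freed_or_spent {e f e' f' : Status} {b n d : Bool}
    (h : Status.trans e f b = some (e', f', n)) (he : e = Status.freed d ∨ e = Status.spent d) :
    e' = Status.freed d ∨ e' = Status.spent d := by
  rcases he with rfl | rfl <;> cases f <;> simp [Status.trans] at h
  · exact Or.inl h.1.symm
  · exact Or.inl h.1.symm
  · cases b <;> simp at h
    · exact Or.inl h.1.symm
    · exact Or.inr h.1.symm
  · exact Or.inr h.1.symm

/-- The statuses that the code of a requirement gets to see are those of the stage. -/
theorem getD_take_stage {s n i : ℕ} (hi : i < ((stage s).1.take n).length) :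
    ((stage s).1.take n).getD i Status.fresh = st s i := by
  have : i < n ∧ i < (stage s).1.length := by simpa using hi
  unfold st State.status
  rw [List.getD_eq_getElem?_getD, List.getD_eq_getElem?_getD, List.getElem?_take, if_pos this.1]

/-- If the answers of a code are right for `Δ`, then so are the records of its requirement. -/
theorem history_of_record {Δ : QSystem} {c : Code}
    (hc : ∀ x v, v ∈ c.eval (Encodable.encode x) → ∃ w, Δ.Test x w v.bodd) (s : ℕ) :
    ∀ ρ : Record, (stage s).2[Encodable.encode c]? = some ρ →
      History Δ (st s) ρ.1 ρ.2.1 ρ.2.2 := by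
  induction s with
  | zero => simp [stage]
  | succ s ih =>
    intro τ hτ
    have hgs := goodStage s
    rcases h : action s (stage s) with _ | ⟨ρ, q⟩
    · have hst := st_succ_of_none h
      rcases getElem?_stack_of_none h hτ with hτ | ⟨_, rfl⟩
      · have hg := hgs.good _ _ hτ
        exact (ih τ hτ).congr hg.2.1 hg.second_le fun i _ => hst i
      · have h1 : st (s + 1) (s + 1) = Status.fresh := by rw [hst, st_of_lt (by simp)]
        have h0 : st (s + 1) 0 = Status.fresh := by rw [hst, hgs.zero]
        exact ⟨fun h => absurd h1 h, fun h => absurd h1 h, fun h => absurd h0 h⟩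
    · rcases getElem?_stack_of_some h hτ with ⟨hlt, hτ⟩ | ⟨hcs, rfl⟩
      · have hg := hgs.good _ _ hτ
        exact (ih τ hτ).congr hg.2.1 hg.second_le fun i hi => hgs.st_succ_of_le h hlt hτ hi
      · obtain ⟨hρ, v, hv, htr⟩ := action_eq_some.1 h
        rw [← hcs] at hρ hv
        rw [Denumerable.ofNat_encode] at hv
        obtain ⟨w, hw⟩ := hc _ _ (Code.evaln_sound hv)
        obtain ⟨g1, g2, g3, g4⟩ := hgs.good _ _ hρ
        have hst := hgs.st_succ h
        have hold := ih ρ hρ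
        obtain ⟨k, l, t⟩ := ρ
        obtain ⟨e, e', n⟩ := q
        change Status.trans (st s k) (st s l) v.bodd = _ at htr
        dsimp only at hst hold g1 g2 g3 g4 hw ⊢
        generalize hβ : (stage s).1.take s.unpair.2.unpair.1 = β at hw
        have hβs : ∀ i < β.length, β.getD i Status.fresh = st s i := fun i hi => by
          subst hβ; exact getD_take_stage hi
        have hβl : β.length ≤ s + 1 := by
          rw [← hβ, List.length_take, length_stage]; exact min_le_right _ _
        have hkl := hw.1
        dsimp only at hkl
        have hsk : st (s + 1) k = e := by rw [hst, if_pos rfl]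
        rcases Status.trans_new htr with ⟨e1, rfl, -, rfl⟩ | ⟨e1, rfl, -, rfl⟩ | ⟨hp, -, rfl⟩
        · rcases g4 with ⟨rfl, -⟩ | ⟨-, -, g4⟩
          · refine ⟨fun _ => ?_, fun _ h => absurd hsk h, fun h => ?_⟩
            · rcases hw.2 with ⟨-, h⟩ | ⟨h, -⟩ | ⟨h | h, -⟩ | ⟨h | h, -⟩
              · exact ⟨w, h⟩
              all_goals (dsimp only at h; rw [hβs k hkl.1, e1] at h; simp at h)
            · dsimp only [cond_false] at h
              rw [hst, if_neg (by omega), if_neg (by simp), hgs.zero] at h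
              exact absurd rfl h
          · rw [e1] at g4; simp [Status.paired] at g4
        · rcases g4 with ⟨rfl, -⟩ | ⟨-, -, g4⟩
          · refine ⟨fun _ => hold.of_ne_fresh (by rw [e1]; simp), fun _ _ => ?_, fun h => ?_⟩
            · refine ⟨β, w, v.bodd, hβl, fun i hi hik => ?_, by rw [hβs k hkl.1, e1],
                Or.inl hsk, ?_⟩
              · rw [hβs i hi, hst, if_neg hik, if_neg (by simp)]
              · rcases hw.2 with ⟨h, -⟩ | ⟨-, h⟩ | ⟨h | h, -⟩ | ⟨h | h, -⟩
                · dsimp only at h; rw [hβs k hkl.1, e1] at h; simp at h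
                · exact h
                all_goals (dsimp only at h; rw [hβs k hkl.1, e1] at h; simp at h)
            · dsimp only [cond_true] at h
              rw [hst, if_neg (by omega), if_neg (by simp), st_of_lt (by omega)] at h
              exact absurd rfl h
          · rw [e1] at g4; simp [Status.paired] at g4
        · have hne : st s k ≠ Status.fresh ∧ st s k ≠ Status.guard := by
            constructor <;> intro h <;> rw [h] at hp <;> simp [Status.paired] at hp
          rcases g4 with ⟨-, g4⟩ | ⟨g4, g5, -⟩
          · exact absurd g4 (by tauto)
          · dsimp only [cond_false]
            refine ⟨fun _ => hold.of_ne_fresh hne.1, fun _ _ => ?_, fun _ => ?_⟩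
            · obtain ⟨β', w', b', h1, h2, h3, h4, h5⟩ := hold.of_ne_guard hne.1 hne.2
              refine ⟨β', w', b', h1, fun i hi hik => ?_, h3, ?_, h5⟩
              · rw [h2 i hi hik, hst, if_neg hik, if_neg (by omega)]
              · rw [hsk]; exact Status.trans_freed_or_spent htr h4
            · refine ⟨β, w, v.bodd, by omega, fun i hi hik hil => ?_, hw, ?_⟩
              · rw [hβs i hi, hst, if_neg hik, if_neg (by tauto)]
              · rw [hβs k hkl.1, hβs l hkl.2, htr, hsk, hst l, if_neg (by omega),
                  if_pos ⟨by omega, rfl⟩]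

/-- The list of the first `n` values of `f`. -/
def initial (f : ℕ → Status) (n : ℕ) : List Status := (List.range n).map f

theorem length_initial (f : ℕ → Status) (n : ℕ) : (initial f n).length = n := by simp [initial]

theorem getD_initial {f : ℕ → Status} {n i : ℕ} (hi : i < n) :
    (initial f n).getD i Status.fresh = f i := by
  simp [initial, List.getD_eq_getElem?_getD, hi]

/-- A positively answered question allows the requirement to act. -/
theorem QSystem.Test.isSome_trans {Δ : QSystem} {k l w : ℕ} {β : List Status} {b b' : Bool}
    (h : Δ.Test (k, l, β) w b) :
    (Status.trans (β.getD k Status.fresh) (β.getD l Status.fresh) b').isSome := by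
  obtain ⟨-, ⟨h, -⟩ | ⟨h, -⟩ | ⟨h | h, ⟨h', -⟩ | ⟨h', -⟩ | ⟨h', -⟩⟩ | ⟨h | h, h', -⟩⟩ := h <;>
    dsimp only at * <;> rw [h] <;> (try rw [h']) <;> rfl

/-- In the end a requirement with a complete code has no question left that would be answered
positively, because it would act otherwise. -/
theorem not_test_of_final {Δ : QSystem} {c : Code}
    (hc : ∀ x w b, Δ.Test x w b → ∃ v, v ∈ c.eval (Encodable.encode x)) {ρ : Record} {s₀ : ℕ}
    (hρ : ∀ s, s₀ ≤ s → (stage s).2[Encodable.encode c]? = some ρ ∧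
      (s.unpair.1 = Encodable.encode c → action s (stage s) = none)) (n w : ℕ) (b : Bool) :
    ¬ Δ.Test (ρ.1, ρ.2.1, initial finalSt n) w b := by
  intro h
  obtain ⟨v, hv⟩ := hc _ _ _ h
  obtain ⟨z, hz⟩ := Code.evaln_complete.1 hv
  obtain ⟨t, ht⟩ := exists_forall_lt_st_eq n
  set u := max s₀ (max z (max t n)) with hu
  set s := Nat.pair (Encodable.encode c) (Nat.pair n u) with hs
  have hus : u ≤ s := (Nat.right_le_pair n u).trans (Nat.right_le_pair _ _)
  have hlist : (stage s).1.take n = initial finalSt n := by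
    refine List.ext_getElem (by simp [length_initial, length_stage]; omega) fun i h1 h2 => ?_
    have hin : i < n := by simpa [length_initial] using h2
    have h3 := getD_take_stage h1
    rw [List.getD_eq_getElem _ _ h1, ht s (by omega) i hin] at h3
    rw [h3]
    simp [initial]
  obtain ⟨h1, h2⟩ := hρ s (by omega)
  have hpair : s.unpair = (Encodable.encode c, Nat.pair n u) := by rw [hs, Nat.unpair_pair]
  have hnone := h2 (by rw [hpair])
  have htest := h.isSome_trans (b' := v.bodd)
  have hkl := h.1
  dsimp only [length_initial] at hkl
  rw [length_initial] at hkl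
  rw [getD_initial hkl.1, getD_initial hkl.2, ← ht s (by omega) _ hkl.1,
    ← ht s (by omega) _ hkl.2] at htest
  obtain ⟨q, hq⟩ := Option.isSome_iff_exists.1 htest
  have : action s (stage s) = some (ρ, q) := by
    refine action_eq_some.2 ⟨by rw [hpair]; exact h1, v, ?_, hq⟩
    rw [hpair]
    dsimp only
    rw [Nat.unpair_pair, Denumerable.ofNat_encode]
    dsimp only
    rw [hlist]
    exact Code.evaln_mono (by omega) hz
  rw [hnone] at this
  simp at this

/-! ### Every p-dialectical system has a different belief set -/

/-- The arguments accepted under the statuses that are listed in `β`. -/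
abbrev believedList (β : List Status) : Set ℕ := believed fun i => β.getD i Status.fresh

theorem mem_believed_congr {f g : ℕ → Status} {y : ℕ} (h : f (y / 3) = g (y / 3)) :
    y ∈ believed f ↔ y ∈ believed g := by
  simp only [believed, Set.mem_ofPred_eq, h]

theorem mem_believedList_initial {f : ℕ → Status} {n y : ℕ} (hy : y < 3 * n) :
    y ∈ believedList (initial f n) ↔ y ∈ believed f :=
  mem_believed_congr (getD_initial (by omega))

theorem believed_of_block {f : ℕ → Status} {k : ℕ} {e : Status} (h : f k = e) :
    (3 * k ∈ believed f ↔ e.accepted.1 = true) ∧ (3 * k + 1 ∈ believed f ↔ e.accepted.2.1 = true) ∧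
      (3 * k + 2 ∈ believed f ↔ e.accepted.2.2 = true) := by
  subst h
  refine ⟨?_, ?_, ?_⟩
  · simp [believed, Status.mem, show 3 * k / 3 = k by omega]
  · simp [believed, Status.mem, show (3 * k + 1) / 3 = k by omega,
      show (3 * k + 1) % 3 = 1 by omega]
  · simp [believed, Status.mem, show (3 * k + 2) / 3 = k by omega,
      show (3 * k + 2) % 3 = 2 by omega]

theorem eq_or_of_div_eq {y k : ℕ} (h : y / 3 = k) : y = 3 * k ∨ y = 3 * k + 1 ∨ y = 3 * k + 2 := by
  omega

namespace QSystem

variable {Δ : QSystem} {U V B : Set ℕ} {m : ℕ → ℕ} {N w : ℕ}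

theorem exists_chain_lt (Δ : QSystem) (j M : ℕ) : ∃ N, ∀ i < j, ∀ s < M, Δ.chain i s < N := by
  refine ⟨((Finset.range j).sup fun i => (Finset.range M).sup fun s => Δ.chain i s) + 1,
    fun i hi s hs => Nat.lt_succ_of_le ?_⟩
  refine le_trans ?_ (Finset.le_sup (f := fun i => (Finset.range M).sup fun s => Δ.chain i s)
    (Finset.mem_range.2 hi))
  exact Finset.le_sup (f := fun s => Δ.chain i s) (Finset.mem_range.2 hs)

theorem exists_forall_lt (m : ℕ → ℕ) (j : ℕ) : ∃ w, ∀ i < j, m i < w :=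
  ⟨(Finset.range j).sup m + 1, fun _ hi =>
    Nat.lt_succ_of_le (Finset.le_sup (Finset.mem_range.2 hi))⟩

theorem FirstHit.isFirst {j s : ℕ} (h : Δ.FirstHit U N j s) (hUV : ∀ y < N, y ∈ U ↔ y ∈ V) :
    Δ.IsFirst V j s :=
  ⟨(hUV _ h.1.2).1 h.1.1, fun i hi hV => (h.2 i hi).1 ((hUV _ (h.2 i hi).2).2 hV)⟩

theorem IsFirst.firstHit {j s : ℕ} (h : Δ.IsFirst V j s) (hUV : ∀ y < N, y ∈ U ↔ y ∈ V)
    (hN : ∀ i < s + 1, Δ.chain j i < N) : Δ.FirstHit U N j s :=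
  ⟨⟨(hUV _ (hN s (by omega))).2 h.1, hN s (by omega)⟩, fun i hi =>
    ⟨fun hU => h.2 i hi ((hUV _ (hN i (by omega))).1 hU), hN i (by omega)⟩⟩

theorem Avoids.exists_isFirst {bad : List ℕ} {l : ℕ} (h : Δ.Avoids U N w bad l)
    (hUV : ∀ y < N, y ∈ U ↔ y ∈ V) {j : ℕ} (hj : j < l) :
    ∃ s, Δ.IsFirst V j s ∧ Δ.chain j s ∉ bad := by
  obtain ⟨s, _, h1, h2⟩ := h j hj
  exact ⟨s, h1.isFirst hUV, h2⟩

/-- The witness for a refutation: it is found as soon as the list of statuses is long enough. -/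
theorem exists_refuted {f : ℕ → Status} {t y z : ℕ} {F : Finset ℕ} (hce : Formula.ce ∈ Δ.H t F)
    (hF : ∀ i ∈ F, (Δ.a i ∈ believed f ∨ Δ.a i = y) ∧ Δ.a i ≠ z) (k : ℕ) : ∃ n > k, ∃ w,
      Δ.Refuted (believedList (initial f n)) (3 * n) w y z := by
  obtain ⟨n, hn⟩ := exists_forall_lt Δ.a (F.sup id + 1)
  refine ⟨max (k + 1) n, by omega, Nat.pair t (Encodable.encode F.toList), ?_⟩
  unfold Refuted
  rw [Nat.unpair_pair]
  dsimp only
  rw [Denumerable.ofNat_encode, Finset.toList_toFinset]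
  refine ⟨hce, fun i hi => ?_⟩
  rw [Finset.mem_toList] at hi
  have hlt : Δ.a i < n := hn i (Nat.lt_succ_of_le (Finset.le_sup (f := id) hi))
  refine ⟨(hF i hi).1.imp_left fun h => (mem_believedList_initial (by omega)).2 h, (hF i hi).2, ?_⟩
  omega

theorem avoids_of_isFirst {bad : List ℕ} {l : ℕ} {s : ℕ → ℕ} (hUV : ∀ y < N, y ∈ U ↔ y ∈ V)
    (hs : ∀ j < l, Δ.IsFirst V j (s j)) (hbad : ∀ j < l, Δ.chain j (s j) ∉ bad)
    (hw : ∀ j < l, s j < w) (hN : ∀ j < l, ∀ i < w, Δ.chain j i < N) : Δ.Avoids U N w bad l :=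
  fun j hj => ⟨s j, hw j hj,
    (hs j hj).firstHit hUV fun i hi => hN j hj i (by have := hw j hj; omega), hbad j hj⟩

namespace IsLimitString

variable (hm : Δ.IsLimitString B m)
include hm

theorem mem (j : ℕ) : Δ.chain j (m j) ∈ B := (hm.isFirst j).1

theorem eq_of_isFirst {j s : ℕ} (hB : B ⊆ V) (h : Δ.IsFirst V j s) (hs : Δ.chain j s ∈ B) :
    s = m j :=
  IsFirst.eq ⟨hs, fun i hi hiB => h.2 i hi (hB hiB)⟩ (hm.isFirst j)

theorem lt_of_forall_notMem {j s : ℕ} (h : ∀ i ≤ s, Δ.chain j i ∉ B) : s < m j := by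
  by_contra hlt
  exact h (m j) (by omega) (hm.mem j)

theorem lt_of_isFirst {j s : ℕ} (hB : B ⊆ V) (h : Δ.IsFirst V j s) (hs : Δ.chain j s ∉ B) :
    s < m j := by
  refine hm.lt_of_forall_notMem fun i hi => ?_
  rcases hi.lt_or_eq with hi | rfl
  · exact fun hiB => h.2 i hi (hB hiB)
  · exact hs

theorem eq_iff {j s : ℕ} : m j = s ↔ Δ.IsFirst B j s :=
  ⟨fun h => h ▸ hm.isFirst j, fun h => (hm.isFirst j).eq h⟩

/-- An entry of a chain that was given up is refuted by the earlier beliefs. -/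
theorem exists_refuted {f : ℕ → Status} (hf : B = believed f) {j i z : ℕ} (hi : i < m j)
    (hz : Δ.chain j i ≠ z) (hj : ∀ j' < j, Δ.chain j' (m j') ≠ z) (k : ℕ) : ∃ n > k, ∃ w,
      Δ.Refuted (believedList (initial f n)) (3 * n) w (Δ.chain j i) z := by
  obtain ⟨t, ht⟩ := hm.refuted j i hi
  refine QSystem.exists_refuted ht (fun i' hi' => ?_) k
  rcases Finset.mem_insert.1 hi' with rfl | hi'
  · exact ⟨Or.inr rfl, hz⟩
  · obtain ⟨j', hj', rfl⟩ := Finset.mem_image.1 hi'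
    refine ⟨Or.inl (hf ▸ hm.mem j'), hj j' (Finset.mem_range.1 hj')⟩

end IsLimitString

/-- There are no counterexamples among the beliefs. -/
theorem IsLimitString.not_refuted (hm : Δ.IsLimitString B m) {y z : ℕ}
    (hU : ∀ x < N, x ∈ U ∨ x = y → x ≠ z → x ∈ B) : ¬ Δ.Refuted U N w y z :=
  fun h => hm.consistent _ _ (fun i hi => by
    obtain ⟨h1, h2, h3⟩ := h.2 i (List.mem_toFinset.1 hi)
    exact hU _ h3 h1 h2) h.1

end QSystem

theorem Status.eq_freed_or (d : Bool) : Status.freed d = Status.freed false ∨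
    Status.freed d = Status.freed true := by cases d <;> simp

theorem Status.eq_spent_or (d : Bool) : Status.spent d = Status.spent false ∨
    Status.spent d = Status.spent true := by cases d <;> simp

/-- A requirement whose blocks `k` and `l` have their final statuses under `f`, and which has no
question about `Δ` left that would be answered positively. -/
def IsStuck (Δ : QSystem) (f : ℕ → Status) (k l : ℕ) : Prop :=
  ∀ n w b, ¬ Δ.Test (k, l, initial f n) w b

section

variable {Δ : QSystem} {f : ℕ → Status} {k l t : ℕ} {m : ℕ → ℕ} {d : Bool}

theorem IsStuck.not_refuted_of_rival (h : IsStuck Δ f k l) (hk : f k = Status.freed d)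
    (hl : f l = Status.rival) {n w : ℕ} (hkn : k < n) (hln : l < n) :
    ¬ Δ.Refuted (believedList (initial f n)) (3 * n) w (3 * l + 2) (3 * l + 1) := by
  intro hr
  refine h n w true ⟨by simp [length_initial, hkn, hln], ?_⟩
  dsimp only
  rw [getD_initial hkn, getD_initial hln, hk, hl, length_initial]
  exact Or.inr (Or.inr (Or.inl ⟨Status.eq_freed_or d, Or.inr (Or.inl ⟨rfl, hr⟩)⟩))

theorem IsStuck.not_refuted_of_replaced (h : IsStuck Δ f k l) (hk : f k = Status.freed d)
    (hl : f l = Status.replaced) {n w : ℕ} (hkn : k < n) (hln : l < n) :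
    ¬ Δ.Refuted (believedList (initial f n)) (3 * n) w (3 * l + 1) (3 * l + 2) := by
  intro hr
  refine h n w false ⟨by simp [length_initial, hkn, hln], ?_⟩
  dsimp only
  rw [getD_initial hkn, getD_initial hln, hk, hl, length_initial]
  exact Or.inr (Or.inr (Or.inl ⟨Status.eq_freed_or d, Or.inr (Or.inr ⟨rfl, Or.inl ⟨rfl, hr⟩⟩)⟩))

theorem IsStuck.not_passesTo (h : IsStuck Δ f k l) (hk : f k = Status.freed d)
    (hl : f l = Status.replaced) {n w : ℕ} (hkn : k < n) (hln : l < n) :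
    ¬ Δ.PassesTo (believedList (initial f n) ∪ {y | y ∈ [3 * l, 3 * l + 1]})
      (believedList (initial f n) ∪ {y | y ∈ [3 * l + 1]}) (3 * n) w (3 * l) (3 * l + 2)
      [3 * l, 3 * l + 1, 3 * l + 2] := by
  intro hr
  refine h n w true ⟨by simp [length_initial, hkn, hln], ?_⟩
  dsimp only
  rw [getD_initial hkn, getD_initial hln, hk, hl, length_initial]
  exact Or.inr (Or.inr (Or.inl ⟨Status.eq_freed_or d, Or.inr (Or.inr ⟨rfl, Or.inr ⟨rfl, hr⟩⟩)⟩))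

theorem IsStuck.not_refuted_of_excised (h : IsStuck Δ f k l) (hk : f k = Status.spent d)
    (hl : f l = Status.excised) {n w : ℕ} (hkn : k < n) (hln : l < n) :
    ¬ Δ.Refuted (believedList (initial f n)) (3 * n) w (3 * l + 2) (3 * l + 1) := by
  intro hr
  refine h n w false ⟨by simp [length_initial, hkn, hln], ?_⟩
  dsimp only
  rw [getD_initial hkn, getD_initial hln, hk, hl, length_initial]
  exact Or.inr (Or.inr (Or.inr ⟨Status.eq_spent_or d, rfl, hr⟩))

theorem IsStuck.not_hitsBefore (h : IsStuck Δ f k l) (hk : f k = Status.freed d)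
    (hl : f l = Status.fresh) {n w : ℕ} (hkn : k < n) (hln : l < n) (b : Bool) :
    ¬ Δ.HitsBefore (believedList (initial f n)) (3 * n) w (3 * l + 2) (3 * l + 1)
      (3 * l + 2 - b.toNat) := by
  intro hr
  refine h n w b ⟨by simp [length_initial, hkn, hln], ?_⟩
  dsimp only
  rw [getD_initial hkn, getD_initial hln, hk, hl, length_initial]
  exact Or.inr (Or.inr (Or.inl ⟨Status.eq_freed_or d, Or.inl ⟨rfl, hr⟩⟩))

theorem IsStuck.not_meets (h : IsStuck Δ f k l) (hk : f k = Status.guard)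
    {n w : ℕ} (hkn : k < n) (hln : l < n) (b : Bool) :
    ¬ Δ.Meets (believedList (initial f n)) (3 * n) w (3 * k + 2) (3 * k + b.toNat) := by
  intro hr
  refine h n w b ⟨by simp [length_initial, hkn, hln], ?_⟩
  dsimp only
  rw [getD_initial hkn, hk, length_initial]
  exact Or.inr (Or.inl ⟨rfl, hr⟩)

/-- The first block cannot stay fresh, since its last argument must belong to the opponent. -/
theorem IsStuck.ne_fresh (h : IsStuck Δ f k l) (hm : Δ.IsLimitString (believed f) m) :
    f k ≠ Status.fresh := by
  intro hk
  obtain ⟨j, hj⟩ := hm.exists_eq (3 * k + 2) ((believed_of_block hk).2.2.2 rfl)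
  have hkn : k < k + l + 1 := by omega
  refine h (k + l + 1) (Δ.r^[m j] j) true ⟨by simp [length_initial], Or.inl ⟨?_, hj⟩⟩
  dsimp only
  rw [getD_initial hkn, hk]

/-- The first block cannot stay guarded, since the chain of its last argument meets the beliefs. -/
theorem IsStuck.ne_guard (h : IsStuck Δ f k l) (hm : Δ.IsLimitString (believed f) m)
    (hH : History Δ f k l t) : f k ≠ Status.guard := by
  intro hk
  obtain ⟨i, hi⟩ := hH.of_ne_fresh (by rw [hk]; simp)
  have hpos : 1 ≤ m i := by
    by_contra hlt
    have h0 : Δ.chain i 0 ∈ believed f := by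
      have := hm.mem i
      rwa [show m i = 0 by omega] at this
    have : Δ.chain i 0 = 3 * k + 2 := hi
    rw [this, (believed_of_block hk).2.2] at h0
    simp [Status.accepted] at h0
  obtain ⟨b, hb⟩ : ∃ b : Bool, Δ.chain i (m i) ≠ 3 * k + b.toNat := by
    by_cases hc : Δ.chain i (m i) = 3 * k + 0
    · exact ⟨true, by simp [hc]⟩
    · exact ⟨false, hc⟩
  obtain ⟨N, hN⟩ := Δ.exists_chain_lt (i + 1) (m i + 1)
  refine h.not_meets hk (n := k + l + 1 + N) (w := i + m i + 1) (by omega) (by omega) b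
    ⟨i, by omega, m i, by omega, ⟨hpos, hi, ?_, hb⟩, fun j hj => ?_⟩
  · have := hN i (by omega) (m i) (by omega)
    exact (mem_believedList_initial (by omega)).2 (hm.mem i)
  · have := hN i (by omega) j hj
    omega

/-- The second block cannot stay fresh, since one of its last two arguments comes first in the limit
string. -/
theorem IsStuck.second_ne_fresh (h : IsStuck Δ f k l) (hm : Δ.IsLimitString (believed f) m)
    (hk : f k = Status.freed d) : f l ≠ Status.fresh := by
  classical
  intro hl
  have hex : ∃ j, Δ.chain j (m j) ∈ [3 * l + 2, 3 * l + 1] := by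
    obtain ⟨j, hj⟩ := hm.exists_eq (3 * l + 2) ((believed_of_block hl).2.2.2 rfl)
    exact ⟨j, by simp [hj]⟩
  have hspec := Nat.find_spec hex
  have hmin : ∀ j < Nat.find hex, _ := fun j hj => Nat.find_min hex hj
  generalize Nat.find hex = j at hspec hmin
  obtain ⟨w, hw⟩ := QSystem.exists_forall_lt m (j + 1)
  obtain ⟨N, hN⟩ := Δ.exists_chain_lt (j + 1) (w + j + 1)
  obtain ⟨b, hb⟩ : ∃ b : Bool, Δ.chain j (m j) = 3 * l + 2 - b.toNat := by
    rcases List.mem_pair.1 hspec with hc | hc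
    · exact ⟨false, hc⟩
    · exact ⟨true, hc⟩
  have hU : ∀ y < 3 * (k + l + 1 + N),
      (y ∈ believedList (initial f (k + l + 1 + N)) ↔ y ∈ believed f) :=
    fun y hy => mem_believedList_initial hy
  refine h.not_hitsBefore hk hl (n := k + l + 1 + N) (w := w + j + 1) (by omega) (by omega) b
    ⟨j, by omega, ?_, m j, by have := hw j (by omega); omega, ?_, hb⟩
  · exact QSystem.avoids_of_isFirst hU (fun i _ => hm.isFirst i) hmin
      (fun i hi => by have := hw i (by omega); omega)
      (fun i hi s hs => by have := hN i (by omega) s hs; omega)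
  · exact (hm.isFirst j).firstHit hU fun i hi => by
      have := hN j (by omega) i (by have := hw j (by omega); omega); omega

end

/-- The transitions between the statuses of two appointed blocks. -/
theorem Status.trans_cases {e g e' f : Status} {b : Bool}
    (h : Status.trans e g b = some (e', f, false)) (he : e' ≠ guard) :
    (∃ d, e = freed d ∧ e' = freed d ∧ g = fresh ∧ f = if b then replaced else rival) ∨
    (∃ d, e = freed d ∧ e' = freed d ∧ g = rival ∧ f = rivalLost) ∨
    (∃ d, e = freed d ∧ e' = freed d ∧ g = replaced ∧ b = false ∧ f = replacedBack) ∨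
    (∃ d, e = freed d ∧ e' = spent d ∧ g = replaced ∧ b = true ∧ f = excised) ∨
    (∃ d, e = spent d ∧ e' = spent d ∧ g = excised ∧ f = excisedBack) := by
  cases e <;> cases g <;>
    simp only [trans, reduceCtorEq, Option.some.injEq, Prod.mk.injEq, Bool.true_eq_false,
      and_false] at h <;> obtain ⟨rfl, rfl, -⟩ := h
  all_goals cases b <;> simp at he ⊢

theorem Status.eq_of_trans_rival {e g : Status} {b d : Bool}
    (h : Status.trans e g b = some (freed d, rival, false)) :
    e = freed d ∧ g = fresh ∧ b = false := by
  cases b <;> cases d <;> simpa using trans_cases h (by simp)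

theorem Status.eq_of_trans_rivalLost {e g : Status} {b d : Bool}
    (h : Status.trans e g b = some (freed d, rivalLost, false)) : e = freed d ∧ g = rival := by
  cases b <;> cases d <;> simpa using trans_cases h (by simp)

theorem Status.eq_of_trans_replaced {e g : Status} {b d : Bool}
    (h : Status.trans e g b = some (freed d, replaced, false)) :
    e = freed d ∧ g = fresh ∧ b = true := by
  cases b <;> cases d <;> simpa using trans_cases h (by simp)

theorem Status.eq_of_trans_replacedBack {e g : Status} {b d : Bool}
    (h : Status.trans e g b = some (freed d, replacedBack, false)) :
    e = freed d ∧ g = replaced ∧ b = false := by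
  cases b <;> cases d <;> simpa using trans_cases h (by simp)

theorem Status.eq_of_trans_excised {e g : Status} {b d : Bool}
    (h : Status.trans e g b = some (spent d, excised, false)) :
    e = freed d ∧ g = replaced ∧ b = true := by
  cases b <;> cases d <;> simpa using trans_cases h (by simp)

theorem Status.eq_of_trans_excisedBack {e g : Status} {b d : Bool}
    (h : Status.trans e g b = some (spent d, excisedBack, false)) :
    e = spent d ∧ g = excised := by
  cases b <;> cases d <;> simpa using trans_cases h (by simp)

namespace QSystem.Test

variable {Δ : QSystem} {k l w : ℕ} {β : List Status} {b d : Bool} (h : Δ.Test (k, l, β) w b)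
include h

theorem hitsBefore (hk : β.getD k Status.fresh = Status.freed d)
    (hl : β.getD l Status.fresh = Status.fresh) : Δ.HitsBefore (believedList β) (3 * β.length) w
      (3 * l + 2) (3 * l + 1) (3 * l + 2 - b.toNat) := by
  have h := h.2
  dsimp only at h
  rw [hk, hl] at h
  simpa [believedList] using h

theorem refuted_of_rival (hk : β.getD k Status.fresh = Status.freed d)
    (hl : β.getD l Status.fresh = Status.rival) :
    Δ.Refuted (believedList β) (3 * β.length) w (3 * l + 2) (3 * l + 1) := by
  have h := h.2
  dsimp only at h
  rw [hk, hl] at h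
  simpa [believedList] using h

theorem of_replaced (hk : β.getD k Status.fresh = Status.freed d)
    (hl : β.getD l Status.fresh = Status.replaced) :
    (b = false ∧ Δ.Refuted (believedList β) (3 * β.length) w (3 * l + 1) (3 * l + 2)) ∨
    (b = true ∧ Δ.PassesTo (believedList β ∪ {y | y ∈ [3 * l, 3 * l + 1]})
      (believedList β ∪ {y | y ∈ [3 * l + 1]}) (3 * β.length) w (3 * l) (3 * l + 2)
      [3 * l, 3 * l + 1, 3 * l + 2]) := by
  have h := h.2
  dsimp only at h
  rw [hk, hl] at h
  simpa [believedList] using h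

theorem refuted_of_excised (hk : β.getD k Status.fresh = Status.spent d)
    (hl : β.getD l Status.fresh = Status.excised) :
    Δ.Refuted (believedList β) (3 * β.length) w (3 * l + 2) (3 * l + 1) := by
  have h := h.2
  dsimp only at h
  rw [hk, hl] at h
  simpa [believedList] using h

end QSystem.Test

theorem mem_believedList_of_agree {β : List Status} {f : ℕ → Status} {k l : ℕ}
    (hβ : ∀ i < β.length, i ≠ k → i ≠ l → β.getD i Status.fresh = f i)
    (hk : β.getD k Status.fresh = f k) {y : ℕ} (hy : y < 3 * β.length) (hyl : y / 3 ≠ l) :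
    y ∈ believedList β ↔ y ∈ believed f := by
  refine mem_believed_congr ?_
  by_cases hyk : y / 3 = k
  · rw [hyk, hk]
  · exact hβ _ (by omega) hyk hyl

theorem believedList_of_block {β : List Status} {k : ℕ} {e : Status}
    (h : β.getD k Status.fresh = e) : (3 * k ∈ believedList β ↔ e.accepted.1 = true) ∧
      (3 * k + 1 ∈ believedList β ↔ e.accepted.2.1 = true) ∧
      (3 * k + 2 ∈ believedList β ↔ e.accepted.2.2 = true) :=
  believed_of_block (f := fun i => β.getD i Status.fresh) h

section

variable {Δ : QSystem} {f : ℕ → Status} {k l t : ℕ} {m : ℕ → ℕ} {d : Bool}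

/-- While `p` is given up in favour of `q`, the opponent replaces `p` in a position without an
earlier `q`. -/
theorem IsStuck.second_ne_rival (h : IsStuck Δ f k l) (hm : Δ.IsLimitString (believed f) m)
    (hH : History Δ f k l t) (hk : f k = Status.freed d) : f l ≠ Status.rival := by
  intro hl
  obtain ⟨β, w, b, -, hβ, hw, htr⟩ := hH.of_second (by rw [hl]; simp)
  rw [hk, hl] at htr
  obtain ⟨hβk, hβl, rfl⟩ := Status.eq_of_trans_rival htr
  have hB := believed_of_block hl
  have hU : ∀ y < 3 * β.length, (y ∈ believedList β ↔ y ∈ believed f ∪ {3 * l + 2}) := by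
    intro y hy
    by_cases hyl : y / 3 = l
    · have hB' := believedList_of_block hβl
      rcases eq_or_of_div_eq hyl with rfl | rfl | rfl <;> simp [hB, hB', Status.accepted]
    · rw [mem_believedList_of_agree hβ (hβk.trans hk.symm) hy hyl, Set.mem_union,
        Set.mem_singleton_iff]
      exact (or_iff_left (by omega)).symm
  have hp : 3 * l + 2 ∉ believed f := by rw [hB.2.2]; simp [Status.accepted]
  obtain ⟨j, -, hav, s, -, hs, hjs⟩ := hw.hitsBefore hβk hβl
  replace hjs : Δ.chain j s = 3 * l + 2 := hjs
  have hs' := hs.isFirst hU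
  have hlt := hm.lt_of_isFirst Set.subset_union_left hs' (by rw [hjs]; exact hp)
  obtain ⟨n, hn, w', hr⟩ := hm.exists_refuted (z := 3 * l + 1) rfl hlt
    (by rw [hjs]; simp) (fun i hi heq => by
      obtain ⟨s', h1, h2⟩ := hav.exists_isFirst hU hi
      have := hm.eq_of_isFirst Set.subset_union_left h1
        (h1.1.resolve_right fun hc => h2 (by simp [Set.mem_singleton_iff.1 hc]))
      subst this
      exact h2 (by simp [heq])) (k + l)
  rw [hjs] at hr
  exact h.not_refuted_of_rival hk hl (by omega) (by omega) hr

/-- While `x` and `q` are given up in favour of `p = r x`, the opponent replaces `q` in a position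
without an earlier `p`, or there is an earlier position whose chain goes through `x` to `p`. -/
theorem IsStuck.second_ne_replaced (h : IsStuck Δ f k l) (hm : Δ.IsLimitString (believed f) m)
    (hH : History Δ f k l t) (hk : f k = Status.freed d) : f l ≠ Status.replaced := by
  classical
  intro hl
  obtain ⟨β, w, b, -, hβ, hw, htr⟩ := hH.of_second (by rw [hl]; simp)
  rw [hk, hl] at htr
  obtain ⟨hβk, hβl, rfl⟩ := Status.eq_of_trans_replaced htr
  have hB := believed_of_block hl
  have hx : 3 * l ∉ believed f := by rw [hB.1]; simp [Status.accepted]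
  have hq : 3 * l + 1 ∉ believed f := by rw [hB.2.1]; simp [Status.accepted]
  have hp : 3 * l + 2 ∈ believed f := by rw [hB.2.2]; simp [Status.accepted]
  set V : Set ℕ := believed f ∪ {y | y ∈ [3 * l, 3 * l + 1]} with hV
  have hBV : believed f ⊆ V := Set.subset_union_left
  have hU : ∀ y < 3 * β.length, (y ∈ believedList β ↔ y ∈ V) := by
    intro y hy
    by_cases hyl : y / 3 = l
    · have hB' := believedList_of_block hβl
      rcases eq_or_of_div_eq hyl with rfl | rfl | rfl <;> simp [hV, hB, hB', Status.accepted]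
    · rw [mem_believedList_of_agree hβ (hβk.trans hk.symm) hy hyl, hV, Set.mem_union]
      exact (or_iff_left (by simp; omega)).symm
  obtain ⟨j, -, hav, s, -, hs, hjs⟩ := hw.hitsBefore hβk hβl
  replace hjs : Δ.chain j s = 3 * l + 1 := hjs
  have hlt := hm.lt_of_isFirst hBV (hs.isFirst hU) (by rw [hjs]; exact hq)
  -- `q` is refuted in a position only if an earlier one holds `p`
  have hqref : ∀ {j s}, Δ.chain j s = 3 * l + 1 → s < m j →
      ∃ i < j, Δ.chain i (m i) = 3 * l + 2 := by
    intro j s hjs hlt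
    by_contra hno
    push Not at hno
    obtain ⟨n, hn, w', hr⟩ := hm.exists_refuted (z := 3 * l + 2) rfl hlt (by rw [hjs]; simp) hno
      (k + l)
    rw [hjs] at hr
    exact h.not_refuted_of_replaced hk hl (by omega) (by omega) hr
  have hex : ∃ i, i < j ∧ Δ.chain i (m i) = 3 * l + 2 := hqref hjs hlt
  obtain ⟨hij, hip⟩ := Nat.find_spec hex
  have hmin : ∀ i' < Nat.find hex, Δ.chain i' (m i') ≠ 3 * l + 2 := fun i' hi' hc =>
    Nat.find_min hex hi' ⟨hi'.trans hij, hc⟩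
  generalize Nat.find hex = i at hij hip hmin
  -- for the beliefs with `x` and `q`, the positions up to `i` hold `x` or the same as now
  have hfirst : ∀ i' ≤ i, ∃ s', Δ.IsFirst V i' s' ∧
      (Δ.chain i' s' = 3 * l ∨ s' = m i' ∧ Δ.chain i' s' ∉ [3 * l, 3 * l + 1, 3 * l + 2]) := by
    intro i' hi'
    obtain ⟨s', h1, h2⟩ := hav.exists_isFirst hU (show i' < j by omega)
    refine ⟨s', h1, ?_⟩
    have h2' : Δ.chain i' s' ≠ 3 * l + 1 ∧ Δ.chain i' s' ≠ 3 * l + 2 := by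
      constructor <;> intro hc <;> exact h2 (by simp [hc])
    by_cases hx' : Δ.chain i' s' = 3 * l
    · exact Or.inl hx'
    · right
      have hB' : Δ.chain i' s' ∈ believed f := h1.1.resolve_right fun hc => by
        rcases List.mem_pair.1 hc with hc | hc
        · exact hx' hc
        · exact h2'.1 hc
      exact ⟨hm.eq_of_isFirst hBV h1 hB', by simp [hx', h2']⟩
  obtain ⟨s', h1, h2⟩ := hfirst i le_rfl
  replace h2 : Δ.chain i s' = 3 * l := h2.resolve_right fun h2 => h2.2 (by rw [h2.1, hip]; simp)
  have hlt' := hm.lt_of_isFirst hBV h1 (by rw [h2]; exact hx)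
  choose! g hg using hfirst
  have hgi : g i = s' := (hg i le_rfl).1.eq h1
  -- an earlier chain through `x` would reach `p` as well
  have hnox : ∀ i' < i, Δ.chain i' (g i') ≠ 3 * l := by
    intro i' hi' hc
    have hadd := QSystem.chain_add_of_eq (hc.trans h2.symm)
    have hlt'' := hm.lt_of_isFirst hBV (hg i' hi'.le).1 (by rw [hc]; exact hx)
    have hm' : m i' = g i' + (m i - s') := by
      refine hm.eq_iff.2 ⟨?_, fun n hn => ?_⟩
      · rw [hadd, Nat.add_sub_cancel' hlt'.le, hip]; exact hp
      · rcases lt_trichotomy n (g i') with hn' | rfl | hn'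
        · exact fun hB' => (hg i' hi'.le).1.2 n hn' (hBV hB')
        · rw [hc]; exact hx
        · have := hadd (n - g i')
          rw [Nat.add_sub_cancel' hn'.le] at this
          rw [this]
          exact (hm.isFirst i).2 _ (by omega)
    refine hmin i' hi' ?_
    rw [hm', hadd, Nat.add_sub_cancel' hlt'.le, hip]
  -- between `x` and `p` the chain of `i` does not meet `q`
  have hnoq : ∀ n < m i, Δ.chain i n ≠ 3 * l + 1 := by
    intro n hn hc
    obtain ⟨i', hi', hc'⟩ := hqref hc hn
    exact hmin i' hi' hc'
  obtain ⟨w, hw⟩ := QSystem.exists_forall_lt (fun i => g i + m i) (i + 1)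
  obtain ⟨N, hN⟩ := Δ.exists_chain_lt (i + 1) (w + i + 1)
  have hwi := hw i (by omega)
  have hUV : ∀ y < 3 * (k + l + 1 + N), (y ∈ believedList (initial f (k + l + 1 + N)) ∪
      {y | y ∈ [3 * l, 3 * l + 1]} ↔ y ∈ V) := by
    intro y hy
    rw [hV, Set.mem_union, Set.mem_union, mem_believedList_initial hy]
  have hbound : ∀ i' ≤ i, ∀ n < w + i + 1, Δ.chain i' n < 3 * (k + l + 1 + N) := by
    intro i' hi' n hn
    have := hN i' (by omega) n hn; omega
  refine h.not_passesTo hk hl (n := k + l + 1 + N) (w := w + i + 1) (by omega) (by omega)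
    ⟨i, by omega, ?_, s', by omega, ⟨h1.firstHit hUV fun n hn => hbound i le_rfl n (by omega), h2⟩,
      m i, by omega, ⟨hlt', hip⟩, fun n hn => ?_⟩
  · exact QSystem.avoids_of_isFirst hUV (fun i' hi' => (hg i' hi'.le).1)
      (fun i' hi' => ((hg i' hi'.le).2.resolve_left (hnox i' hi')).2)
      (fun i' hi' => by have := hw i' (by omega); omega)
      (fun i' hi' n hn => hbound i' hi'.le n hn)
  · refine Or.inr ⟨?_, hbound i le_rfl n (by omega)⟩
    rintro (hc | hc)
    · rw [mem_believedList_initial (hbound i le_rfl n (by omega))] at hc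
      exact (hm.isFirst i).2 n hn hc
    · exact hnoq n hn (List.mem_singleton.1 hc)

/-- While `x` and `p` are given up and `q` is restored, the opponent replaces `p` in the position
whose chain goes through `x` to `p`. In an earlier position the chain may have lost the argument `e`
of the first block, but it then goes on to an argument that is smaller than those of the second
block. -/
theorem IsStuck.second_ne_excised (h : IsStuck Δ f k l) (hm : Δ.IsLimitString (believed f) m)
    (hH : History Δ f k l t) (hkl : k < l) (hk : f k = Status.spent d) :
    f l ≠ Status.excised := by
  intro hl
  obtain ⟨β, w, b, -, hβ, hw, htr⟩ := hH.of_second (by rw [hl]; simp)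
  rw [hk, hl] at htr
  obtain ⟨hβk, hβl, rfl⟩ := Status.eq_of_trans_excised htr
  have hB := believed_of_block hl
  have hB' := believedList_of_block hβl
  have hE := believed_of_block hk
  have hE' := believedList_of_block hβk
  have hx : 3 * l ∉ believed f := by rw [hB.1]; simp [Status.accepted]
  have hp : 3 * l + 2 ∉ believed f := by rw [hB.2.2]; simp [Status.accepted]
  have he : 3 * k + 2 ∉ believed f := by rw [hE.2.2]; simp [Status.accepted]
  have hU : ∀ y < 3 * β.length, (y ∈ believedList β ∪ {y | y ∈ [3 * l + 1]} ↔
      y ∈ believed f ∪ {y | y ∈ [3 * k + 2, 3 * l + 2]}) := by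
    intro y hy
    by_cases hyl : y / 3 = l
    · rcases eq_or_of_div_eq hyl with rfl | rfl | rfl <;> simp [hB, hB', Status.accepted]; omega
    by_cases hyk : y / 3 = k
    · rcases eq_or_of_div_eq hyk with rfl | rfl | rfl
      · rw [Set.mem_union, Set.mem_union, hE.1, hE'.1]
        exact or_congr Iff.rfl (by simp; omega)
      · rw [Set.mem_union, Set.mem_union, hE.2.1, hE'.2.1]
        exact or_congr Iff.rfl (by simp; omega)
      · simp [hE'.2.2, Status.accepted]
    · have : y ∈ believedList β ↔ y ∈ believed f := mem_believed_congr (hβ _ (by omega) hyk hyl)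
      rw [Set.mem_union, Set.mem_union, this]
      refine or_congr_right ?_
      simp; omega
  have hpass := (hw.of_replaced hβk hβl).resolve_left (by simp)
  set V : Set ℕ := believed f ∪ {y | y ∈ [3 * k + 2, 3 * l + 2]} with hV
  set W : Set ℕ := V ∪ {3 * l} with hW
  have hBV : believed f ⊆ V := Set.subset_union_left
  have hBW : believed f ⊆ W := hBV.trans Set.subset_union_left
  have hUW : ∀ y < 3 * β.length, (y ∈ believedList β ∪ {y | y ∈ [3 * l, 3 * l + 1]} ↔ y ∈ W) := by
    intro y hy
    rw [hW, Set.mem_union _ V, ← hU y hy]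
    simp only [Set.mem_union, Set.mem_ofPred_eq, List.mem_cons, List.not_mem_nil, or_false,
      Set.mem_singleton_iff]
    rw [or_comm (a := y = 3 * l), or_assoc]
  obtain ⟨j, -, hav, s, -, ⟨hs, hjs⟩, n, -, ⟨hsn, hjn⟩, hbet⟩ := hpass.2
  have hs' := hs.isFirst hUW
  have hlt : n < m j := by
    refine hm.lt_of_forall_notMem fun i hi hiB => ?_
    rcases lt_trichotomy i s with his | rfl | his
    · exact hs'.2 i his (hBW hiB)
    · rw [hjs] at hiB; exact hx hiB
    · rcases hi.lt_or_eq with hi | rfl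
      · obtain ⟨h1, h2⟩ := (hbet i hi).resolve_left (not_not.2 his)
        exact h1 ((hU _ h2).2 (hBV hiB))
      · rw [hjn] at hiB; exact hp hiB
  obtain ⟨β', w', b', hlen, hβ', hgd, hb', i₀, -, n₀, -, ⟨hn₀, hi₀, hmem, hne⟩, hsmall⟩ :=
    hH.of_ne_guard (by rw [hk]; simp) (by rw [hk]; simp)
  have hb'd : d = b' := by rw [hk] at hb'; simpa using hb'
  subst hb'd
  -- the entry of the chain of `e` that was accepted when `e` was guarded is accepted again
  have hn₀B : Δ.chain i₀ n₀ ∈ believed f := by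
    have hlt := hsmall n₀ (by omega)
    by_cases hyk : Δ.chain i₀ n₀ / 3 = k
    · have hne' : Δ.chain i₀ n₀ ≠ 3 * k + 2 := hi₀ ▸ QSystem.chain_ne hn₀
      rcases eq_or_of_div_eq hyk with hc | hc | hc
      · rw [hc, hE.1]
        rw [hc] at hne
        cases d <;> simp [Status.accepted] at hne ⊢
      · rw [hc, hE.2.1]
        rw [hc] at hne
        cases d <;> simp [Status.accepted] at hne ⊢
      · exact absurd hc hne'
    · exact (mem_believed_congr (hβ' _ (by omega) hyk)).1 hmem
  have hnoq : ∀ i < j, Δ.chain i (m i) ≠ 3 * l + 1 := by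
    intro i hi
    obtain ⟨u, h1, h2⟩ := hav.exists_isFirst hUW hi
    by_cases hue : Δ.chain i u = 3 * k + 2
    · have hadd := QSystem.chain_add_of_eq (hue.trans (show 3 * k + 2 = Δ.chain i₀ 0 from hi₀.symm))
      have hu := hm.lt_of_isFirst hBW h1 (by rw [hue]; exact he)
      have hle : m i ≤ u + n₀ := by
        by_contra hlt
        refine (hm.isFirst i).2 (u + n₀) (by omega) ?_
        rw [hadd, Nat.zero_add]; exact hn₀B
      have h3 := hadd (m i - u)
      rw [Nat.add_sub_cancel' hu.le, Nat.zero_add] at h3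
      have h4 := hsmall (m i - u) (by omega)
      omega
    · have h3 : Δ.chain i u ∈ believed f := by
        simp only [List.mem_cons, not_or] at h2
        rcases h1.1 with (h3 | h3) | h3
        · exact h3
        · rcases List.mem_pair.1 h3 with h3 | h3
          · exact absurd h3 hue
          · exact absurd h3 h2.2.2.1
        · exact absurd h3 h2.1
      rw [← hm.eq_of_isFirst hBW h1 h3]
      intro hc
      exact h2 (by simp [hc])
  obtain ⟨n', hn', w'', hr⟩ := hm.exists_refuted (z := 3 * l + 1) rfl hlt (by rw [hjn]; simp) hnoq
    (k + l)
  rw [hjn] at hr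
  exact h.not_refuted_of_excised hk hl (by omega) (by omega) hr

/-- After `p` has been accepted instead of `q`, the refutation of `p` is one by beliefs. -/
theorem second_ne_rivalLost (hm : Δ.IsLimitString (believed f) m)
    (hH : History Δ f k l t) (hk : f k = Status.freed d) : f l ≠ Status.rivalLost := by
  intro hl
  obtain ⟨β, w, b, -, hβ, hw, htr⟩ := hH.of_second (by rw [hl]; simp)
  rw [hk, hl] at htr
  obtain ⟨hβk, hβl⟩ := Status.eq_of_trans_rivalLost htr
  refine hm.not_refuted ?_ (hw.refuted_of_rival hβk hβl)
  intro y hy h1 h2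
  have hB := believed_of_block hl
  by_cases hyl : y / 3 = l
  · rcases eq_or_of_div_eq hyl with rfl | rfl | rfl
    · simp [hB, Status.accepted]
    · exact absurd rfl h2
    · simp [hB, Status.accepted]
  · exact (mem_believedList_of_agree hβ (hβk.trans hk.symm) hy hyl).1
      (h1.resolve_right (by omega))

/-- After `q` has been accepted instead of `p`, the refutation of `q` is one by beliefs. -/
theorem second_ne_replacedBack (hm : Δ.IsLimitString (believed f) m)
    (hH : History Δ f k l t) (hk : f k = Status.freed d) : f l ≠ Status.replacedBack := by
  intro hl
  obtain ⟨β, w, b, -, hβ, hw, htr⟩ := hH.of_second (by rw [hl]; simp)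
  rw [hk, hl] at htr
  obtain ⟨hβk, hβl, rfl⟩ := Status.eq_of_trans_replacedBack htr
  refine hm.not_refuted ?_ ((hw.of_replaced hβk hβl).resolve_right (by simp)).2
  intro y hy h1 h2
  have hB := believed_of_block hl
  have hB' := believedList_of_block hβl
  by_cases hyl : y / 3 = l
  · rcases eq_or_of_div_eq hyl with rfl | rfl | rfl
    · simp [hB', Status.accepted] at h1
    · simp [hB, Status.accepted]
    · exact absurd rfl h2
  · exact (mem_believedList_of_agree hβ (hβk.trans hk.symm) hy hyl).1
      (h1.resolve_right (by omega))

theorem second_ne_excisedBack (hm : Δ.IsLimitString (believed f) m)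
    (hH : History Δ f k l t) (hk : f k = Status.spent d) : f l ≠ Status.excisedBack := by
  intro hl
  obtain ⟨β, w, b, -, hβ, hw, htr⟩ := hH.of_second (by rw [hl]; simp)
  rw [hk, hl] at htr
  obtain ⟨hβk, hβl⟩ := Status.eq_of_trans_excisedBack htr
  refine hm.not_refuted ?_ (hw.refuted_of_excised hβk hβl)
  intro y hy h1 h2
  have hB := believed_of_block hl
  have hB' := believedList_of_block hβl
  by_cases hyl : y / 3 = l
  · rcases eq_or_of_div_eq hyl with rfl | rfl | rfl
    · simp [hB', Status.accepted] at h1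
    · exact absurd rfl h2
    · simp [hB, Status.accepted]
  · exact (mem_believedList_of_agree hβ (hβk.trans hk.symm) hy hyl).1
      (h1.resolve_right (by omega))

/-- A requirement that is stuck has an opponent with other beliefs, whatever the statuses of its two
blocks are. -/
theorem IsStuck.not_isLimitString (h : IsStuck Δ f k l) (hH : History Δ f k l t)
    (hp : (f k = Status.fresh ∨ f k = Status.guard) ∨
      k < l ∧ Status.paired (f k) (f l)) : ¬ Δ.IsLimitString (believed f) m := by
  intro hm
  rcases hp with (hk | hk) | ⟨hkl, hp⟩
  · exact h.ne_fresh hm hk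
  · exact h.ne_guard hm hH hk
  · have key : ∀ e g : Status, Status.paired e g →
        (∃ d, e = Status.freed d) ∧ (g = Status.fresh ∨ g = Status.rival ∨ g = Status.rivalLost ∨
          g = Status.replaced ∨ g = Status.replacedBack) ∨
        (∃ d, e = Status.spent d) ∧ (g = Status.excised ∨ g = Status.excisedBack) := by
      intro e g h
      cases e <;> cases g <;> simp [Status.paired] at h ⊢
    rcases key _ _ hp with ⟨⟨d, hk⟩, hl | hl | hl | hl | hl⟩ | ⟨⟨d, hk⟩, hl | hl⟩
    · exact h.second_ne_fresh hm hk hl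
    · exact h.second_ne_rival hm hH hk hl
    · exact second_ne_rivalLost hm hH hk hl
    · exact h.second_ne_replaced hm hH hk hl
    · exact second_ne_replacedBack hm hH hk hl
    · exact h.second_ne_excised hm hH hkl hk hl
    · exact second_ne_excisedBack hm hH hk hl

end

theorem beliefs_blockSystem : blockSystem.beliefs = believed finalSt :=
  Set.ext mem_beliefs_blockSystem

/-- Every block contains an accepted argument. -/
theorem infinite_beliefs_blockSystem : blockSystem.beliefs.Infinite := by
  rw [beliefs_blockSystem]
  refine Set.infinite_of_forall_exists_gt fun n => ?_
  obtain ⟨h1, h2, h3⟩ := believed_of_block (f := finalSt) (k := n + 1) rfl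
  have key : ∀ e : Status, e.accepted.1 = true ∨ e.accepted.2.1 = true ∨ e.accepted.2.2 = true := by
    decide
  rcases key (finalSt (n + 1)) with h | h | h
  · exact ⟨_, h1.2 h, by omega⟩
  · exact ⟨_, h2.2 h, by omega⟩
  · exact ⟨_, h3.2 h, by omega⟩

/-- A p-dialectical system with the beliefs of the block system would be refuted by the requirement
of a code that answers the questions about it. -/
theorem beliefs_blockSystem_ne {Δ : QSystem} (hP : Δ.IsP) : blockSystem.beliefs ≠ Δ.beliefs := by
  intro hB
  obtain ⟨m, hm⟩ := QSystem.exists_isLimitString hP (hB ▸ infinite_beliefs_blockSystem)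
  rw [← hB, beliefs_blockSystem] at hm
  obtain ⟨c, hsound, hcomplete⟩ := Δ.exists_code_test
  obtain ⟨ρ, s₀, hρ⟩ := exists_final_record (Encodable.encode c)
  obtain ⟨t, ht⟩ := exists_forall_lt_st_eq (ρ.2.2 + 1)
  have hrec := (hρ (max s₀ t) (le_max_left _ _)).1
  have hst : ∀ i ≤ ρ.2.2, st (max s₀ t) i = finalSt i := fun i hi =>
    ht _ (le_max_right _ _) i (by omega)
  have hg := (goodStage (max s₀ t)).good _ _ hrec
  have hH := (history_of_record hsound (max s₀ t) ρ hrec).congr hg.2.1 hg.second_le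
    fun i hi => (hst i hi).symm
  have hstuck : IsStuck Δ finalSt ρ.1 ρ.2.1 := not_test_of_final hcomplete hρ
  refine hstuck.not_isLimitString hH ?_ hm
  rw [← hst _ hg.2.1, ← hst _ hg.second_le]
  exact hg.2.2.2.imp And.right fun h => ⟨h.1, h.2.2⟩

end Dialectical

theorem theorem1 :
    ∃ Γ : Dialectical.QSystem, Γ.Loopless ∧
      ∀ Δ : Dialectical.QSystem, Δ.IsP → Γ.beliefs ≠ Δ.beliefs :=
  ⟨Dialectical.blockSystem, Dialectical.blockSystem_loopless, fun _ hP =>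
    Dialectical.beliefs_blockSystem_ne hP⟩
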